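/- **Setting.** For integers $q\ge 0$ and $\Lambda\ge 0$ let $C^q_\Lambda[c,d]$ be the set of $q$ times differentiable functions on $[c,d]$ whose $q$-th derivative is Lipschitz continuous with constant $\Lambda$. Let $a<b$ and consider the Volterra integral equation of the first kind $\int_a^x k(x,y)u(y)\,dy=f(x)$, $a\le x\le b$. For an integer $N\ge1$ put $h=(b-a)/N$, $x_n=a+nh$. *Method.* Let $m\ge 1$ and let $\sum_{j=0}^m a_j\varphi_{r+j}=h\sum_{j=0}^m b_j\psi_{r+j}$ be a linear $m$-step method, $a_m\ne0$, $|a_0|+|b_0|\neq0$, and let $0\le\mu\le m$ be such that $b_{m-\mu}\ne0$ and $b_j=0$ for $m-\mu<j\le m$. Assume that the method is nullstable (all roots of $\varrho(\xi)=\sum_j a_j\xi^j$ lie in $|\xi|\le1$ and those with $|\xi|=1$ are simple) and has maximal consistency order $p_0$ with $1\le p_0\le m$, and that all roots of $\sigma(\xi)=\sum_{j\le m-\mu}b_j\xi^j$ satisfy $|\xi|<1$. *Solution and kernel.* Let $1\le p\le p_0$ be an integer, and let $u\in C^{p-1}_{\Lambda}[a,b]$, for some $\Lambda$, solve the integral equation.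 Let $N_{\min}\ge m$ be an integer, $h_{\max}=(b-a)/N_{\min}$, and $E=\{(x,y): a\le y\le x\le b\}\cup[a,a+mh_{\max}]^2$. Assume $k\in C^p(E)$, $k(x,x)=1$ for $x\in[a,b]$, and $\partial_x k(x,\cdot)\in C^{p-1}_{\Lambda_1}[a,x]$ for all $x\in[a,b]$ with some $\Lambda_1$ that does not depend on $x$ (this holds, e.g., if $k\in C^{p+1}(E)$). Let $L\ge0$ be a Lipschitz constant of $k$ on $E$ with respect to the first variable, and $\|k\|_\infty=\max_E|k|$. *Scheme.* For $r=1,\dots,m$ let $w_{r0},\dots,w_{r,m-1}$ be the weights of the interpolatory quadrature rule for $\int_0^r$ with nodes $0,\dots,m-1$, i.e. $\sum_{s<m}s^iw_{rs}=r^{i+1}/(i+1)$ for $i=0,\dots,m-1$. For $N\ge N_{\min}$ and given values $f^\delta_1,\dots,f^\delta_N$ the approximations $u^\delta_0,\dots,u^\delta_{N-\mu}$ to $u(x_0),\dots,u(x_{N-\mu})$ are determined as follows. First, $u_0^\delta,\dots,u_{m-1}^\delta$ solve $h\sum_{s=0}^{m-1}w_{ns}k(x_n,x_s)u^\delta_s=f^\delta_n$,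 $n=1,\dots,m$. Then, for $n=m+\mu,\dots,N$, $u^\delta_{n-\mu}$ is determined by the requirement that with $\psi_s=k(x_n,x_s)u_s^\delta$, $\varphi_0=0$, $\varphi_r=h\sum_{s<m}w_{rs}\psi_s$ $(1\le r\le m-1)$ and $\varphi_m,\dots,\varphi_n$ obtained from $\sum_{j=0}^ma_j\varphi_{r+j}=h\sum_{j=0}^{m-\mu}b_j\psi_{r+j}$ $(0\le r\le n-m)$ one has $\varphi_n=f_n^\delta$. Write $I_h=\{x_0,\dots,x_{N-\mu}\}$ and $u^\delta(x_n;h)=u^\delta_n$. *Constants.* Let $\alpha_j=a_{m-j}$ $(0\le j\le m)$, $\beta_j=b_{m-\mu-j}$ $(0\le j\le m-\mu)$, all other $\alpha_j,\beta_j$ being $0$, let $\gamma(\xi)=\sum\gamma_n\xi^n=\beta(\xi)/\alpha(\xi)$ and $1/\gamma(\xi)=\sum\gamma^{(-1)}_n\xi^n$ as formal power series. For $s<m$ let $\omega_{0s}=0$, $\omega_{ns}=w_{ns}$ for $1\le n<m$, and let $\omega_{ns}$ for $n\ge m$ be given recursively by $\sum_{t=0}^n\alpha_{n-t}\omega_{ts}=\beta_{n-\mu-s}$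 (with right-hand side $0$ if $n<\mu+s$). Let $T=(w_{ns})_{1\le n\le m,\,0\le s\le m-1}$, let $\|\cdot\|_\infty$ be the row sum norm, $\mathrm{cond}_\infty(T)=\|T\|_\infty\|T^{-1}\|_\infty$, and $$C_{2a}=(1+L)\|T^{-1}\|_\infty,\quad C_3=\Big(\sup_{r\ge0}|\gamma_r|\Big)\sum_{s\ge1}s\,|\gamma_s^{(-1)}|,\quad C_{2b}=(1+\mu L)\Big(\sum_{s\ge0}|\gamma_s^{(-1)}|\Big)e^{(1+\mu L)C_3L(b-a)},$$ $$C_2=\max\Big\{C_{2a},\ C_{2b}\Big(1+C_{2a}\|k\|_\infty\sup_{n\ge m+\mu}\sum_{s=0}^{m-1}|\omega_{ns}|\Big)\Big\},\qquad \overline h=\min\Big\{\frac1{m(1+L)\,\mathrm{cond}_\infty(T)},\,h_{\max}\Big\},$$ except that $\overline h=h_{\max}$ if $k\equiv1$ on $E$. *Balancing principle.* Let $\kappa\ge1$ be an integer, $c_*,c_{**},\delta_0>0$ and $\beta>2C_2$. For $0<\delta\le\delta_0$ let $\overline s=\overline s(\delta)\ge0$ and $\underline N=\underline N(\delta)\ge1$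 be integers such that the step sizes $h_s=(b-a)/N_s$, $N_s=\underline N2^{\kappa(\overline s-s)}$, $s=0,\dots,\overline s$, satisfy $h_0\le c_*\delta^{1/2}$ and $c_{**}\delta^{1/(p_0+1)}\le h_{\overline s}\le\overline h$. Let $\Sigma=\{h_0<\dots<h_{\overline s}\}$, and for each $h\in\Sigma$ let values $f^\delta_n$ with $|f^\delta_n-f(x_n)|\le\delta$ $(1\le n\le N)$ on the corresponding grid be given, and let $u^\delta(\cdot;h)$ be the resulting approximations. Let $h(\delta)=\max H^\delta$, where $H^\delta$ is the set of all $h_*\in\Sigma$ such that $$\max_{y\in I_{h'}}|u^\delta(y;h')-u^\delta(y;h)|\le\beta\,\frac{\delta}{h}\qquad\text{for all }h,h'\in\Sigma\text{ with }h<h'\le h_* .$$ **Theorem (balancing principle).** For every step size $h=(b-a)/N\le\overline h$, $N\ge N_{\min}$, and arbitrary right-hand side values the approximations exist and are uniquely determined. Moreover, there are constants $K,C>0$ which do not depend on $\delta$, on the noisy data, or on $\overline s(\delta),\underline N(\delta)$, such that for all $0<\delta\le\delta_0$ $$\max_{y\in I_{h(\delta)}}|u^\delta(y;h(\delta))-u(y)|\le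 K\,\delta^{p/(p+1)},\qquad h(\delta)\ge C\,\delta^{1/(p+1)} .$$ (The choice of $h(\delta)$ does not use the smoothness index $p$.) -/

import Mathlib

open Filter Topology

noncomputable section

/-- The space `C^q_L[c,d]`: the function is `q` times differentiable on `[c,d]` and its `q`-th
derivative is Lipschitz continuous on `[c,d]` with constant `L`. -/
def MemHoelderLip (q : ℕ) (L : ℝ) (c d : ℝ) (g : ℝ → ℝ) : Prop :=
  ContDiffOn ℝ q g (Set.Icc c d) ∧
    ∀ y₁ ∈ Set.Icc c d, ∀ y₂ ∈ Set.Icc c d,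
      |iteratedDerivWithin q g (Set.Icc c d) y₁ - iteratedDerivWithin q g (Set.Icc c d) y₂|
        ≤ L * |y₁ - y₂|

/-- A linear `m`-step method `∑_{j ≤ m} a_j φ_{r+j} = h ∑_{j ≤ m} b_j ψ_{r+j}`. Only the
coefficients with index at most `m` are ever used. The number `mu` is determined by the `b_j`:
`b_{m-mu}` is the last nonvanishing one of them. -/
structure MultistepMethod (m : ℕ) where
  a : ℕ → ℝ
  b : ℕ → ℝ
  one_le : 1 ≤ m
  lead_ne : a m ≠ 0
  low_ne : |a 0| + |b 0| ≠ 0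
  mu : ℕ
  mu_le : mu ≤ m
  b_ne : b (m - mu) ≠ 0
  b_zero : ∀ j, m - mu < j → j ≤ m → b j = 0

namespace MultistepMethod

variable {m : ℕ} (M : MultistepMethod m)

/-- First characteristic polynomial. -/
def rho : Polynomial ℂ :=
  ∑ j ∈ Finset.range (m + 1), Polynomial.C (M.a j : ℂ) * Polynomial.X ^ j

/-- Second characteristic polynomial. -/
def sigma : Polynomial ℂ :=
  ∑ j ∈ Finset.range (m - M.mu + 1), Polynomial.C (M.b j : ℂ) * Polynomial.X ^ j

/-- All roots of the first characteristic polynomial lie in the closed unit disk, and those on the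
unit circle are simple. -/
def NullStable : Prop :=
  ∀ ξ : ℂ, M.rho.eval ξ = 0 → ‖ξ‖ ≤ 1 ∧ (‖ξ‖ = 1 → M.rho.derivative.eval ξ ≠ 0)

/-- All roots of the second characteristic polynomial lie in the open unit disk. -/
def SigmaSchur : Prop := ∀ ξ : ℂ, M.sigma.eval ξ = 0 → ‖ξ‖ < 1

/-- Local truncation error at `y` with step size `h` for `ψ : [c,d] → ℝ`, where
`φ(x) = ∫_c^x ψ`. -/
def locErr (ψ : ℝ → ℝ) (c y h : ℝ) : ℝ :=
  ∑ j ∈ Finset.range (m + 1), M.a j * (∫ t in c..(y + j * h), ψ t)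
    - h * ∑ j ∈ Finset.range (m + 1), M.b j * ψ (y + j * h)

/-- Consistency order (at least) `q`. -/
def HasOrder (q : ℕ) : Prop :=
  ∀ c d : ℝ, c < d → ∀ ψ : ℝ → ℝ,
    ContDiffOn ℝ ((⊤ : ℕ∞) : WithTop ℕ∞) ψ (Set.Icc c d) → ∀ y ∈ Set.Ico c d,
      (fun h : ℝ => M.locErr ψ c y h) =O[𝓝[>] 0] (fun h : ℝ => h ^ (q + 1))

def HasMaximalOrder (q : ℕ) : Prop := M.HasOrder q ∧ ¬ M.HasOrder (q + 1)

/-- Reflected coefficients `α_j`. -/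
def alpha (j : ℕ) : ℝ := if j ≤ m then M.a (m - j) else 0

/-- Reflected coefficients `β_j`. -/
def beta (j : ℕ) : ℝ := if j ≤ m - M.mu then M.b (m - M.mu - j) else 0

/-- The power series `γ(ξ)` with `α(ξ) γ(ξ) = β(ξ)`; note `α_0 = a_m ≠ 0`. -/
def gammaSeries : PowerSeries ℝ := PowerSeries.mk M.beta * (PowerSeries.mk M.alpha)⁻¹

def gamma (n : ℕ) : ℝ := PowerSeries.coeff n M.gammaSeries

/-- Coefficients of `1/γ(ξ)`; note `γ_0 = b_{m-mu} / a_m ≠ 0`. -/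
def gammaInv (n : ℕ) : ℝ := PowerSeries.coeff n M.gammaSeries⁻¹

end MultistepMethod

/-- The matrix with rows `(0^i, 1^i, …, (m-1)^i)`, `i = 0, …, m-1`. -/
def startMatrix (m : ℕ) : Matrix (Fin m) (Fin m) ℝ := Matrix.of fun i s => ((s : ℕ) : ℝ) ^ (i : ℕ)

/-- The weights `w_{r0}, …, w_{r,m-1}` of the interpolatory quadrature rule with nodes
`0, 1, …, m-1` for the integral over `[0, r]`. -/
def startVector (m r : ℕ) : Fin m → ℝ :=
  (startMatrix m)⁻¹.mulVec fun i : Fin m => (r : ℝ) ^ ((i : ℕ) + 1) / (((i : ℕ) : ℝ) + 1)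

theorem startMatrix_mulVec_startVector (m r : ℕ) :
    (startMatrix m).mulVec (startVector m r)
      = fun i : Fin m => (r : ℝ) ^ ((i : ℕ) + 1) / (((i : ℕ) : ℝ) + 1) := by
  have h : startMatrix m
      = (Matrix.vandermonde (fun s : Fin m => ((s : ℕ) : ℝ))).transpose := by
    ext i s
    simp [startMatrix, Matrix.vandermonde]
  have hdet : IsUnit (startMatrix m).det := by
    rw [h, Matrix.det_transpose, isUnit_iff_ne_zero, Matrix.det_vandermonde_ne_zero_iff]
    intro s t hst
    have h2 : ((s : ℕ) : ℝ) = ((t : ℕ) : ℝ) := hst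
    exact Fin.ext (by exact_mod_cast h2)
  unfold startVector
  rw [Matrix.mulVec_mulVec, Matrix.mul_nonsing_inv _ hdet, Matrix.one_mulVec]

def startWeight (m r s : ℕ) : ℝ := if hs : s < m then startVector m r ⟨s, hs⟩ else 0

/-- The matrix `T = (w_{ns})`, `n = 1, …, m`, `s = 0, …, m-1`. -/
def startT (m : ℕ) : Matrix (Fin m) (Fin m) ℝ := Matrix.of fun i s => startVector m ((i : ℕ) + 1) s

/-- Matrix norm induced by the maximum norm. -/
def matMaxNorm {m : ℕ} (A : Matrix (Fin m) (Fin m) ℝ) : ℝ :=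
  letI := Matrix.linftyOpNormedAddCommGroup (m := Fin m) (n := Fin m) (α := ℝ)
  ‖A‖

namespace MultistepMethod

variable {m : ℕ} (M : MultistepMethod m)

/-- The weights `w_{ns}`, `0 ≤ s ≤ m-1`, of the quadrature form of the method. For `n < m` they are
the starting weights (with `w_{0s} = 0`), and for `n ≥ m` they are given recursively by
`∑_{t ≤ n} α_{n-t} w_{ts} = β_{n-mu-s}` (right-hand side `0` if `n < mu + s`). -/
def quadWeight (s n : ℕ) : ℝ :=
  if n = 0 then 0
  else if n < m then startWeight m n s
  else ((if M.mu + s ≤ n then M.beta (n - M.mu - s) else 0)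
    - ∑ t : Fin n, M.alpha (n - t) * quadWeight s t) / M.alpha 0
termination_by n
decreasing_by exact t.2

/-- `sup_{n ≥ m+mu} ∑_{s < m} |w_{ns}|`. -/
def quadWeightBound : ℝ :=
  ⨆ i : ℕ, ∑ s ∈ Finset.range m, |M.quadWeight s (m + M.mu + i)|

/-- The constant `C₃`. -/
def C3 : ℝ := (⨆ r : ℕ, |M.gamma r|) * ∑' s : ℕ, |M.gammaInv s| * (s : ℝ)

end MultistepMethod

/-- Step size belonging to `N` subintervals of `[a,b]`. -/
def stepSize (a b : ℝ) (N : ℕ) : ℝ := (b - a) / N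

/-- Grid point `x_n = a + n h`. -/
def gridPt (a b : ℝ) (N n : ℕ) : ℝ := a + n * stepSize a b N

/-- The set `E` on which the kernel is considered. -/
def kernelDomain (a b : ℝ) (m Nmin : ℕ) : Set (ℝ × ℝ) :=
  {q | (a ≤ q.2 ∧ q.2 ≤ q.1 ∧ q.1 ≤ b) ∨
    (q.1 ∈ Set.Icc a (a + m * stepSize a b Nmin) ∧ q.2 ∈ Set.Icc a (a + m * stepSize a b Nmin))}

/-- Partial derivative of the kernel on `E` with respect to the first variable. -/
def kernelDerivFst (E : Set (ℝ × ℝ)) (k : ℝ → ℝ → ℝ) (x y : ℝ) : ℝ :=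
  fderivWithin ℝ (Function.uncurry k) E (x, y) (1, 0)

/-- `max_E |k|`. -/
def kernelMaxNorm (E : Set (ℝ × ℝ)) (k : ℝ → ℝ → ℝ) : ℝ := ⨆ q : E, |k q.1.1 q.1.2|

/-- `v_0, v_1, …` are approximations generated by the scheme on the grid with `N` subintervals from
the right-hand side values `g_1, …, g_N`: the values `v_0, …, v_{m-1}` solve the starting system,
and for each `n = m+mu, …, N` the numbers `ψ_s = k(x_n,x_s) v_s` and the values `φ_0 = 0`,
`φ_1, …, φ_{m-1}` (starting quadrature), `φ_m, …, φ_n` given by the multistep recurrence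
satisfy `φ_n = g_n`, which determines `v_{n-mu}`. Only `v_n` for `n ≤ N - mu` is used later. -/
def IsApproximation {m : ℕ} (M : MultistepMethod m) (k : ℝ → ℝ → ℝ) (a b : ℝ) (N : ℕ)
    (g v : ℕ → ℝ) : Prop :=
  (∀ n, 1 ≤ n → n ≤ m →
    stepSize a b N * ∑ s ∈ Finset.range m,
      startWeight m n s * k (gridPt a b N n) (gridPt a b N s) * v s = g n) ∧
  ∀ n, m + M.mu ≤ n → n ≤ N → ∃ φ : ℕ → ℝ,
    φ 0 = 0 ∧
    (∀ r, 1 ≤ r → r < m →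
      φ r = stepSize a b N * ∑ s ∈ Finset.range m,
        startWeight m r s * (k (gridPt a b N n) (gridPt a b N s) * v s)) ∧
    (∀ r, r + m ≤ n →
      ∑ j ∈ Finset.range (m + 1), M.a j * φ (r + j)
        = stepSize a b N * ∑ j ∈ Finset.range (m - M.mu + 1),
            M.b j * (k (gridPt a b N n) (gridPt a b N (r + j)) * v (r + j))) ∧
    φ n = g n

/-- The constant `C_{2a}`. -/
def C2a (m : ℕ) (L : ℝ) : ℝ := (1 + L) * matMaxNorm (startT m)⁻¹

/-- The constant `C_{2b}`. -/
def C2b {m : ℕ} (M : MultistepMethod m) (a b L : ℝ) : ℝ :=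
  (1 + M.mu * L) * (∑' s : ℕ, |M.gammaInv s|) * Real.exp ((1 + M.mu * L) * M.C3 * L * (b - a))

/-- The constant `C₂`, the coefficient of `δ / h`. -/
def C2 {m : ℕ} (M : MultistepMethod m) (k : ℝ → ℝ → ℝ) (a b : ℝ) (Nmin : ℕ) (L : ℝ) : ℝ :=
  max (C2a m L)
    (C2b M a b L *
      (1 + C2a m L * kernelMaxNorm (kernelDomain a b m Nmin) k * M.quadWeightBound))

open Classical in
/-- The step size bound: `h_max` if `k ≡ 1` on `E`, and
`min {1 / (m (1 + L) cond_∞(T)), h_max}` otherwise. -/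
def hBar (m : ℕ) (k : ℝ → ℝ → ℝ) (a b : ℝ) (Nmin : ℕ) (L : ℝ) : ℝ :=
  if ∀ x y, (x, y) ∈ kernelDomain a b m Nmin → k x y = 1 then stepSize a b Nmin
  else min (1 / (m * (1 + L) * (matMaxNorm (startT m) * matMaxNorm (startT m)⁻¹)))
    (stepSize a b Nmin)

/-- The numbers `N_s = Nlow * 2^(κ (sbar - s))`, `0 ≤ s ≤ sbar`, so that the step sizes
`h_s = (b-a)/N_s` increase geometrically with `s`. -/
def gridNum (κ sbar Nlow s : ℕ) : ℕ := Nlow * 2 ^ (κ * (sbar - s))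

/-- The indices of the step sizes in `H^δ`: all `s ≤ sbar` such that, for all step sizes
`h = h_t < h' = h_{t'} ≤ h_s` and all points of the grid of `h'` (which belongs to that of `h`), the
approximations `v N_t` and `v N_{t'}` differ there by at most `β δ / h`. -/
def balancingSet (mu : ℕ) (a b : ℝ) (κ sbar Nlow : ℕ) (β δ : ℝ) (v : ℕ → ℕ → ℝ) : Set ℕ :=
  {s | s ≤ sbar ∧ ∀ t t', t < t' → t' ≤ s →
    ∀ n' ≤ gridNum κ sbar Nlow t' - mu, ∀ n ≤ gridNum κ sbar Nlow t - mu,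
      gridPt a b (gridNum κ sbar Nlow t') n' = gridPt a b (gridNum κ sbar Nlow t) n →
        |v (gridNum κ sbar Nlow t') n' - v (gridNum κ sbar Nlow t) n|
          ≤ β * (δ / stepSize a b (gridNum κ sbar Nlow t))}

theorem exists_isGreatest_balancingSet (mu : ℕ) (a b : ℝ) (κ sbar Nlow : ℕ) (β δ : ℝ)
    (v : ℕ → ℕ → ℝ) : ∃ s, IsGreatest (balancingSet mu a b κ sbar Nlow β δ v) s := by
  have h0 : (0 : ℕ) ∈ balancingSet mu a b κ sbar Nlow β δ v :=
    ⟨Nat.zero_le _, fun t t' h h' => absurd (lt_of_lt_of_le h h') (Nat.not_lt_zero t)⟩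
  have hb : BddAbove (balancingSet mu a b κ sbar Nlow β δ v) := ⟨sbar, fun s hs => hs.1⟩
  exact ⟨sSup _, Nat.sSup_mem ⟨0, h0⟩ hb, fun s hs => le_csSup hb hs⟩

end

/-! The balancing principle is a comparison argument built on the a priori estimate |u^δ_n - u(x_n)|
≤ C₁ h^p + C₂ δ/h (`exists_error_bound`), in which C₂ is explicit. Put d = δ^(1/(p+1)). For step
sizes below a small multiple ε d the term C₁ h^p is dominated by the noise, and since β > 2 C₂ all
of them pass the test; so the selected step size is at least a constant times d. If it is much
larger, passing the test means that its approximation stays close to one on a finer grid whose step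
size is of order d, where the error is of order d^p (`balancing_principle`).

For the estimate, the method is rewritten as a quadrature φ_n = h ∑ ω_{ns} ψ_s, which beyond the m
starting nodes is a convolution with γ (`isApproximation_iff`, `quad_split`). Factoring the
characteristic polynomials turns the root conditions into bounds on power series: 1/α has bounded
coefficients, since inner roots give summable factors and simple unimodular roots a bounded one,
while the coefficients of 1/β are summable with a weight R^n, R > 1. Hence γ = β/α is bounded and
1/γ = α/β is summable, even against the weight s.

Stability: the starting errors are controlled by viewing the starting system as a perturbation of T.
For the others, convolution with 1/γ would invert the error equation exactly if the kernel row were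
frozen. Letting the row vary costs L h ∑ s|γ_s^{(-1)}| times the sum of earlier errors, which a
discrete Gronwall inequality absorbs (`abs_le_of_gamma_system`).

Consistency: quadrature errors accumulate to O(h^p), so dividing the error equation by h would lose
one power. But 1/γ = (1/β)·α, and α maps the quadrature errors of a fixed integrand to local errors
O(h^{p+1}). The integrand changes from row to row; this change is a quadrature error for ∂_x k times
a distance O(h), so it is again O(h^{p+1}) (`abs_quadErr_sub_le`, `exists_bound_filtered_quadErr`).
Smoothness enters only through Taylor expansions with uniform constants (`TaylorBdd`). -/

/-! ### Reciprocals of polynomials as power series -/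

/-- The geometric series `∑ zⁿ Xⁿ`. -/
noncomputable def geomSeries (z : ℂ) : PowerSeries ℂ := PowerSeries.mk fun n => z ^ n

theorem one_sub_mul_geomSeries (z : ℂ) :
    (1 - PowerSeries.C z * PowerSeries.X) * geomSeries z = 1 := by
  ext n
  rw [sub_mul, one_mul, mul_assoc, map_sub, PowerSeries.coeff_C_mul]
  cases n with
  | zero => simp [geomSeries]
  | succ n =>
    rw [PowerSeries.coeff_succ_X_mul]
    simp [geomSeries, PowerSeries.coeff_one, pow_succ']

theorem prod_one_sub_mul_prod_geomSeries (s : Multiset ℂ) :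
    (s.map fun z => 1 - PowerSeries.C z * PowerSeries.X).prod * (s.map geomSeries).prod = 1 := by
  rw [← Multiset.prod_map_mul]
  simp [one_sub_mul_geomSeries]

/-- Absolute convergence at radius `R`. -/
def WeightedSummable (R : ℝ) (F : PowerSeries ℂ) : Prop :=
  Summable fun n => ‖PowerSeries.coeff n F‖ * R ^ n

/-- The weight R^n is multiplicative, so it can be absorbed into the coefficients, and the claim
becomes the Cauchy product of two absolutely summable series. -/
theorem WeightedSummable.mul {R : ℝ} (hR : 0 ≤ R) {F G : PowerSeries ℂ}
    (hF : WeightedSummable R F) (hG : WeightedSummable R G) : WeightedSummable R (F * G) := by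
  have key : ∀ H : PowerSeries ℂ, ∀ n, ‖PowerSeries.coeff n H‖ * R ^ n
      = ‖PowerSeries.coeff n H * (R : ℂ) ^ n‖ := by
    intro H n
    rw [norm_mul, norm_pow, Complex.norm_real, Real.norm_of_nonneg hR]
  unfold WeightedSummable at *
  simp only [key] at *
  refine (summable_norm_sum_mul_antidiagonal_of_summable_norm hF hG).congr fun n => ?_
  rw [PowerSeries.coeff_mul, Finset.sum_mul]
  congr 1
  refine Finset.sum_congr rfl fun x hx => ?_
  rw [← Finset.HasAntidiagonal.mem_antidiagonal.1 hx, pow_add]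
  ring

theorem WeightedSummable.mono {R R' : ℝ} (hR : 0 ≤ R) (h : R ≤ R') {F : PowerSeries ℂ}
    (hF : WeightedSummable R' F) : WeightedSummable R F :=
  Summable.of_nonneg_of_le (fun _ => by positivity)
    (fun n => by gcongr) hF

theorem weightedSummable_geomSeries {R : ℝ} {z : ℂ} (hR : 0 ≤ R) (h : ‖z‖ * R < 1) :
    WeightedSummable R (geomSeries z) := by
  refine (summable_geometric_of_lt_one (by positivity) h).congr fun n => ?_
  simp [geomSeries, mul_pow]

/-- There are finitely many roots in the open disk, so some radius larger than 1 serves all factors.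
The strict gain over 1 later yields summability against the weight n. -/
theorem exists_weightedSummable_prod_geomSeries (s : Multiset ℂ) (hs : ∀ z ∈ s, ‖z‖ < 1) :
    ∃ R : ℝ, 1 < R ∧ WeightedSummable R (s.map geomSeries).prod := by
  induction s using Multiset.induction_on with
  | empty =>
    refine ⟨2, by norm_num, ?_⟩
    refine summable_of_ne_finset_zero (s := {0}) fun n hn => ?_
    simp only [Finset.mem_singleton] at hn
    simp [PowerSeries.coeff_one, hn]
  | cons z s ih =>
    obtain ⟨R, hR, h⟩ := ih fun w hw => hs w (Multiset.mem_cons_of_mem hw)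
    have hz := hs z (Multiset.mem_cons_self z s)
    have hz0 := norm_nonneg z
    obtain ⟨R', hR', hz'⟩ : ∃ R' : ℝ, 1 < R' ∧ ‖z‖ * R' < 1 := by
      refine ⟨2 / (1 + ‖z‖), by rw [lt_div_iff₀ (by positivity)]; linarith, ?_⟩
      rw [← mul_div_assoc, div_lt_one (by positivity)]
      linarith
    refine ⟨min R R', lt_min hR hR', ?_⟩
    have h0 : (0 : ℝ) ≤ min R R' := le_trans zero_le_one (lt_min hR hR').le
    rw [Multiset.map_cons, Multiset.prod_cons]
    exact ((weightedSummable_geomSeries (by linarith) hz').mono h0 (min_le_right _ _)).mul h0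
      (h.mono h0 (min_le_left _ _))

/-- Partial fractions for two distinct poles. This is the place where simplicity of the roots is
used: coinciding poles would produce coefficients growing like n. -/
theorem geomSeries_mul_geomSeries {z w : ℂ} (h : z ≠ w) :
    geomSeries z * geomSeries w
      = PowerSeries.C (z / (z - w)) * geomSeries z + PowerSeries.C (w / (w - z)) * geomSeries w := by
  have hz := one_sub_mul_geomSeries z
  have hw := one_sub_mul_geomSeries w
  have h1 : z - w ≠ 0 := sub_ne_zero.2 h
  have h2 : w - z ≠ 0 := sub_ne_zero.2 h.symm
  have e1 : PowerSeries.C (z / (z - w)) + PowerSeries.C (w / (w - z)) = (1 : PowerSeries ℂ) := by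
    rw [← map_add, ← map_one PowerSeries.C]
    congr 1
    field_simp
    ring
  have e2 : PowerSeries.C (z / (z - w)) * PowerSeries.C w
      + PowerSeries.C (w / (w - z)) * PowerSeries.C z = (0 : PowerSeries ℂ) := by
    rw [← map_mul, ← map_mul, ← map_add, ← map_zero PowerSeries.C]
    congr 1
    field_simp
    ring
  linear_combination (-(geomSeries z * geomSeries w)) * e1
    + (PowerSeries.X * geomSeries z * geomSeries w) * e2
    + (PowerSeries.C (z / (z - w)) * geomSeries z) * hw
    + (PowerSeries.C (w / (w - z)) * geomSeries w) * hz

theorem exists_prod_geomSeries_eq_sum (s : Finset ℂ) (hs : s.Nonempty) :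
    ∃ c : ℂ → ℂ, ∏ z ∈ s, geomSeries z = ∑ z ∈ s, PowerSeries.C (c z) * geomSeries z := by
  induction hs using Finset.Nonempty.cons_induction with
  | singleton a => exact ⟨fun _ => 1, by simp⟩
  | cons a s ha hs ih =>
    obtain ⟨c, hc⟩ := ih
    classical
    -- Each old term is split against the new factor; all the resulting parts with pole `a` are
    -- collected into one coefficient.
    refine ⟨fun z => if z = a then ∑ w ∈ s, c w * (a / (a - w)) else c z * (z / (z - a)), ?_⟩
    rw [Finset.prod_cons, Finset.sum_cons, hc, Finset.mul_sum]
    beta_reduce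
    rw [if_pos rfl, map_sum, Finset.sum_mul,
      ← Finset.sum_add_distrib]
    refine Finset.sum_congr rfl fun w hw => ?_
    have hwa : w ≠ a := fun h => ha (h ▸ hw)
    rw [if_neg hwa, map_mul, map_mul]
    linear_combination (PowerSeries.C (c w)) * geomSeries_mul_geomSeries hwa.symm

theorem exists_bound_prod_geomSeries (s : Finset ℂ) (hs : ∀ z ∈ s, ‖z‖ ≤ 1) :
    ∃ C : ℝ, ∀ n, ‖PowerSeries.coeff n (∏ z ∈ s, geomSeries z)‖ ≤ C := by
  rcases s.eq_empty_or_nonempty with rfl | hne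
  · refine ⟨1, fun n => ?_⟩
    rw [Finset.prod_empty, PowerSeries.coeff_one]
    split_ifs <;> simp
  · obtain ⟨c, hc⟩ := exists_prod_geomSeries_eq_sum s hne
    refine ⟨∑ z ∈ s, ‖c z‖, fun n => ?_⟩
    rw [hc, map_sum]
    refine norm_sum_le_of_le _ fun z hz => ?_
    rw [PowerSeries.coeff_C_mul, geomSeries, PowerSeries.coeff_mk, norm_mul, norm_pow]
    exact mul_le_of_le_one_right (norm_nonneg _) (pow_le_one₀ (norm_nonneg _) (hs z hz))

/-- Young's inequality for ℓ^∞ * ℓ^1. Only the coefficients of `F` up to `n` need a bound, so it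
also applies to sequences controlled only up to the end of the grid. -/
theorem norm_coeff_mul_le {𝕜 : Type*} [NormedField 𝕜] {F G : PowerSeries 𝕜} {C : ℝ} (hC : 0 ≤ C)
    (n : ℕ) (hF : ∀ i ≤ n, ‖PowerSeries.coeff i F‖ ≤ C)
    (hG : Summable fun n => ‖PowerSeries.coeff n G‖) :
    ‖PowerSeries.coeff n (F * G)‖ ≤ C * ∑' i, ‖PowerSeries.coeff i G‖ := by
  rw [PowerSeries.coeff_mul, Finset.Nat.sum_antidiagonal_eq_sum_range_succ_mk,
    ← Finset.sum_range_reflect]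
  refine (norm_sum_le _ _).trans ?_
  calc _ ≤ ∑ j ∈ Finset.range (n + 1), C * ‖PowerSeries.coeff j G‖ := by
        refine Finset.sum_le_sum fun j hj => ?_
        have hj' := Finset.mem_range.1 hj
        rw [norm_mul]
        have : n - (n + 1 - 1 - j) = j := by omega
        simp only [this]
        gcongr
        exact hF _ (by omega)
    _ = C * ∑ j ∈ Finset.range (n + 1), ‖PowerSeries.coeff j G‖ := by rw [Finset.mul_sum]
    _ ≤ _ := by
        gcongr
        exact hG.sum_le_tsum _ fun _ _ => norm_nonneg _

/-- Reversal turns each factor X - z into 1 - zX. A root 0 gives the factor 1, in accordance with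
the drop of degree. -/
theorem reverse_eq_prod_roots (P : Polynomial ℂ) :
    (P.reverse : PowerSeries ℂ) = PowerSeries.C P.leadingCoeff
      * (P.roots.map fun z => 1 - PowerSeries.C z * PowerSeries.X).prod := by
  have hrev : ∀ s : Multiset ℂ, (s.map fun z => Polynomial.X - Polynomial.C z).prod.reverse
      = (s.map fun z => 1 - Polynomial.C z * Polynomial.X).prod := by
    intro s
    induction s using Multiset.induction_on with
    | empty => simpa using Polynomial.reverse_C (1 : ℂ)
    | cons z s ih =>
      simp only [Multiset.map_cons, Multiset.prod_cons]
      rw [Polynomial.reverse_mul_of_domain, ih]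
      congr 1
      rw [Polynomial.reverse, Polynomial.natDegree_X_sub_C, Polynomial.reflect_sub,
        Polynomial.reflect_one_X, Polynomial.reflect_C, pow_one]
  conv_lhs => rw [(IsAlgClosed.splits P).eq_prod_roots]
  rw [Polynomial.reverse_mul_of_domain, hrev, Polynomial.reverse_C, Polynomial.coe_mul,
    Polynomial.coe_C]
  congr 1
  rw [← Polynomial.coeToPowerSeries.ringHom_apply, map_multiset_prod, Multiset.map_map]
  refine congrArg Multiset.prod (Multiset.map_congr rfl fun z _ => ?_)
  simp

/-- Roots inside the disk contribute an absolutely summable factor. Roots on the circle are distinct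
and contribute a bounded factor by partial fractions. The product of the two is bounded. -/
theorem exists_bound_coeff_of_mul_reverse {P : Polynomial ℂ} (hP : P ≠ 0)
    (hroot : ∀ z, P.eval z = 0 → ‖z‖ ≤ 1 ∧ (‖z‖ = 1 → P.derivative.eval z ≠ 0))
    {F : PowerSeries ℂ} (hF : (P.reverse : PowerSeries ℂ) * F = 1) :
    ∃ C : ℝ, ∀ n, ‖PowerSeries.coeff n F‖ ≤ C := by
  classical
  set s := P.roots.filter fun z => ‖z‖ < 1
  set t := P.roots.filter fun z => ¬ ‖z‖ < 1
  have hst : s + t = P.roots := Multiset.filter_add_not _ _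
  have ht1 : ∀ z ∈ t, ‖z‖ = 1 := by
    intro z hz
    obtain ⟨hz1, hz2⟩ := Multiset.mem_filter.1 hz
    exact le_antisymm (hroot z ((Polynomial.mem_roots hP).1 hz1)).1 (not_lt.1 hz2)
  have hnd : t.Nodup := by
    rw [Multiset.nodup_iff_count_le_one]
    intro z
    by_cases hz : z ∈ t
    · have hz1 := Multiset.mem_filter.1 hz
      have hr : P.IsRoot z := (Polynomial.mem_roots hP).1 hz1.1
      refine (Multiset.count_le_of_le z (Multiset.filter_le _ _)).trans ?_
      rw [Polynomial.count_roots]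
      by_contra hlt
      exact (hroot z hr).2 (ht1 z hz)
        ((Polynomial.one_lt_rootMultiplicity_iff_isRoot hP).1 (not_le.1 hlt)).2
    · rw [Multiset.count_eq_zero_of_notMem hz]; exact Nat.zero_le _
  obtain ⟨R, hR, hs⟩ := exists_weightedSummable_prod_geomSeries s
    fun z hz => (Multiset.mem_filter.1 hz).2
  have hs1 : Summable fun n => ‖PowerSeries.coeff n (s.map geomSeries).prod‖ := by
    simpa [WeightedSummable] using hs.mono zero_le_one hR.le
  obtain ⟨C, hC⟩ := exists_bound_prod_geomSeries ⟨t, hnd⟩ fun z hz => (ht1 z hz).le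
  have hFeq : F = PowerSeries.C (P.leadingCoeff⁻¹)
      * ((∏ z ∈ (⟨t, hnd⟩ : Finset ℂ), geomSeries z) * (s.map geomSeries).prod) := by
    have h1 := prod_one_sub_mul_prod_geomSeries P.roots
    have h2 : (P.roots.map geomSeries).prod
        = (∏ z ∈ (⟨t, hnd⟩ : Finset ℂ), geomSeries z) * (s.map geomSeries).prod := by
      rw [← hst, Multiset.map_add, Multiset.prod_add, mul_comm]
      rfl
    rw [← h2]
    rw [reverse_eq_prod_roots] at hF
    have h3 : PowerSeries.C P.leadingCoeff⁻¹ * PowerSeries.C P.leadingCoeff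
        = (1 : PowerSeries ℂ) := by
      rw [← map_mul, inv_mul_cancel₀ (Polynomial.leadingCoeff_ne_zero.2 hP), map_one]
    linear_combination PowerSeries.C P.leadingCoeff⁻¹ * (P.roots.map geomSeries).prod * hF
      - F * PowerSeries.C P.leadingCoeff⁻¹ * PowerSeries.C P.leadingCoeff * h1 - F * h3
  refine ⟨‖P.leadingCoeff⁻¹‖ * (C * ∑' i, ‖PowerSeries.coeff i (s.map geomSeries).prod‖),
    fun n => ?_⟩
  rw [hFeq, PowerSeries.coeff_C_mul, norm_mul]
  gcongr
  exact norm_coeff_mul_le ((norm_nonneg _).trans (hC 0)) n (fun i _ => hC i) hs1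

theorem exists_weightedSummable_of_mul_reverse {P : Polynomial ℂ} (hP : P ≠ 0)
    (hroot : ∀ z, P.eval z = 0 → ‖z‖ < 1)
    {F : PowerSeries ℂ} (hF : (P.reverse : PowerSeries ℂ) * F = 1) :
    ∃ R : ℝ, 1 < R ∧ WeightedSummable R F := by
  obtain ⟨R, hR, hs⟩ := exists_weightedSummable_prod_geomSeries P.roots
    fun z hz => hroot z ((Polynomial.mem_roots hP).1 hz)
  have hFeq : F = PowerSeries.C (P.leadingCoeff⁻¹) * (P.roots.map geomSeries).prod := by
    have h1 := prod_one_sub_mul_prod_geomSeries P.roots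
    rw [reverse_eq_prod_roots] at hF
    have h3 : PowerSeries.C P.leadingCoeff⁻¹ * PowerSeries.C P.leadingCoeff
        = (1 : PowerSeries ℂ) := by
      rw [← map_mul, inv_mul_cancel₀ (Polynomial.leadingCoeff_ne_zero.2 hP), map_one]
    linear_combination PowerSeries.C P.leadingCoeff⁻¹ * (P.roots.map geomSeries).prod * hF
      - F * PowerSeries.C P.leadingCoeff⁻¹ * PowerSeries.C P.leadingCoeff * h1 - F * h3
  refine ⟨R, hR, ?_⟩
  refine (hs.mul_left ‖P.leadingCoeff⁻¹‖).congr fun n => ?_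
  rw [hFeq, PowerSeries.coeff_C_mul, norm_mul, mul_assoc]

/-! ### Generating functions of the method -/

namespace MultistepMethod

variable {m : ℕ} (M : MultistepMethod m)

/-- Generating function of the `α_j`. -/
noncomputable def alphaSeries : PowerSeries ℝ := PowerSeries.mk M.alpha

/-- Generating function of the `β_j`. -/
noncomputable def betaSeries : PowerSeries ℝ := PowerSeries.mk M.beta

theorem alpha_zero : M.alpha 0 = M.a m := by simp [alpha]

theorem beta_zero : M.beta 0 = M.b (m - M.mu) := by simp [beta]

theorem constantCoeff_alphaSeries : PowerSeries.constantCoeff M.alphaSeries ≠ 0 := by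
  rw [← PowerSeries.coeff_zero_eq_constantCoeff_apply, alphaSeries, PowerSeries.coeff_mk,
    alpha_zero]
  exact M.lead_ne

theorem constantCoeff_betaSeries : PowerSeries.constantCoeff M.betaSeries ≠ 0 := by
  rw [← PowerSeries.coeff_zero_eq_constantCoeff_apply, betaSeries, PowerSeries.coeff_mk,
    beta_zero]
  exact M.b_ne

theorem gammaSeries_eq : M.gammaSeries = M.betaSeries * M.alphaSeries⁻¹ := rfl

theorem constantCoeff_gammaSeries : PowerSeries.constantCoeff M.gammaSeries ≠ 0 := by
  rw [gammaSeries_eq, map_mul, PowerSeries.constantCoeff_inv]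
  exact mul_ne_zero M.constantCoeff_betaSeries (inv_ne_zero M.constantCoeff_alphaSeries)

theorem gamma_zero_ne : M.gamma 0 ≠ 0 := by
  rw [gamma, PowerSeries.coeff_zero_eq_constantCoeff_apply]
  exact M.constantCoeff_gammaSeries

theorem alphaSeries_mul_gammaSeries : M.alphaSeries * M.gammaSeries = M.betaSeries := by
  rw [gammaSeries_eq, mul_left_comm, PowerSeries.mul_inv_cancel _ M.constantCoeff_alphaSeries,
    mul_one]

theorem gammaSeries_inv : M.gammaSeries⁻¹ = M.alphaSeries * M.betaSeries⁻¹ := by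
  rw [PowerSeries.inv_eq_iff_mul_eq_one M.constantCoeff_gammaSeries, mul_right_comm,
    alphaSeries_mul_gammaSeries, PowerSeries.mul_inv_cancel _ M.constantCoeff_betaSeries]

/-- The condition `c d ≠ 0` makes the degree exactly `d`; otherwise the reversed polynomial would be
shifted against the reflected coefficients. -/
theorem coeff_reverse_sum {c : ℕ → ℝ} {d : ℕ} (hd : c d ≠ 0) (n : ℕ) :
    (∑ j ∈ Finset.range (d + 1), Polynomial.C (c j : ℂ) * Polynomial.X ^ j).reverse.coeff n
      = ((if n ≤ d then c (d - n) else 0 : ℝ) : ℂ) := by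
  set P := ∑ j ∈ Finset.range (d + 1), Polynomial.C (c j : ℂ) * Polynomial.X ^ j with hPdef
  have hcoef : ∀ i, P.coeff i = if i ≤ d then (c i : ℂ) else 0 := by
    intro i
    rw [hPdef, Polynomial.finsetSum_coeff]
    simp [Polynomial.coeff_C_mul, Polynomial.coeff_X_pow]
  have hdeg : P.natDegree = d := by
    refine le_antisymm ?_ (Polynomial.le_natDegree_of_ne_zero (by simp [hcoef, hd]))
    rw [Polynomial.natDegree_le_iff_coeff_eq_zero]
    intro i hi
    rw [hcoef, if_neg (not_le.2 hi)]
  rw [Polynomial.coeff_reverse, hdeg, hcoef]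
  by_cases hn : n ≤ d
  · rw [Polynomial.revAt_le hn, if_pos (Nat.sub_le _ _), if_pos hn]
  · rw [Polynomial.revAt_eq_self_of_lt (not_le.1 hn), if_neg hn, if_neg hn]
    simp

theorem reverse_rho : (M.rho.reverse : PowerSeries ℂ) = M.alphaSeries.map Complex.ofRealHom := by
  ext n
  rw [Polynomial.coeff_coe, rho, coeff_reverse_sum M.lead_ne]
  simp [alphaSeries, alpha]

theorem reverse_sigma :
    (M.sigma.reverse : PowerSeries ℂ) = M.betaSeries.map Complex.ofRealHom := by
  ext n
  rw [Polynomial.coeff_coe, sigma, coeff_reverse_sum M.b_ne]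
  simp [betaSeries, beta]

theorem rho_ne_zero : M.rho ≠ 0 := by
  intro h
  have h1 := M.reverse_rho
  rw [h] at h1
  have h2 := congrArg (PowerSeries.coeff 0) h1
  simp [alphaSeries, alpha_zero] at h2
  exact M.lead_ne (by exact_mod_cast h2.symm)

theorem sigma_ne_zero : M.sigma ≠ 0 := by
  intro h
  have h1 := M.reverse_sigma
  rw [h] at h1
  have h2 := congrArg (PowerSeries.coeff 0) h1
  simp [betaSeries, beta_zero] at h2
  exact M.b_ne (by exact_mod_cast h2.symm)

variable {M}

theorem NullStable.exists_bound (h : M.NullStable) :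
    ∃ C : ℝ, ∀ n, |PowerSeries.coeff n M.alphaSeries⁻¹| ≤ C := by
  have h1 : (M.rho.reverse : PowerSeries ℂ) * (M.alphaSeries⁻¹).map Complex.ofRealHom = 1 := by
    rw [reverse_rho, ← map_mul, PowerSeries.mul_inv_cancel _ M.constantCoeff_alphaSeries, map_one]
  obtain ⟨C, hC⟩ := exists_bound_coeff_of_mul_reverse M.rho_ne_zero h h1
  refine ⟨C, fun n => ?_⟩
  simpa using hC n

theorem SigmaSchur.exists_summable (h : M.SigmaSchur) :
    ∃ R : ℝ, 1 < R ∧ Summable fun n => |PowerSeries.coeff n M.betaSeries⁻¹| * R ^ n := by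
  have h1 : (M.sigma.reverse : PowerSeries ℂ) * (M.betaSeries⁻¹).map Complex.ofRealHom = 1 := by
    rw [reverse_sigma, ← map_mul, PowerSeries.mul_inv_cancel _ M.constantCoeff_betaSeries, map_one]
  obtain ⟨R, hR, hC⟩ := exists_weightedSummable_of_mul_reverse M.sigma_ne_zero h h1
  exact ⟨R, hR, hC.congr fun n => by simp⟩

variable (M) in
theorem coeff_alphaSeries_of_lt {n : ℕ} (hn : m < n) :
    PowerSeries.coeff n M.alphaSeries = 0 := by
  simp [alphaSeries, alpha, hn]

variable (M) in
theorem coeff_betaSeries_of_lt {n : ℕ} (hn : m - M.mu < n) :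
    PowerSeries.coeff n M.betaSeries = 0 := by
  simp [betaSeries, beta, hn]

theorem summable_of_eventually_zero {c : ℕ → ℝ} {d : ℕ} (h : ∀ n, d < n → c n = 0) :
    Summable fun n => |c n| :=
  summable_of_ne_finset_zero (s := Finset.range (d + 1)) fun n hn => by
    rw [h n (by simpa using hn), abs_zero]

/-- 1/γ is the polynomial α times 1/β, and the latter converges absolutely beyond the unit circle.
-/
theorem SigmaSchur.exists_summable_gammaInv (h : M.SigmaSchur) :
    ∃ R : ℝ, 1 < R ∧ Summable fun n => |M.gammaInv n| * R ^ n := by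
  obtain ⟨R, hR, hs⟩ := h.exists_summable
  have h0 : (0 : ℝ) ≤ R := by linarith
  refine ⟨R, hR, ?_⟩
  have hm : WeightedSummable R ((M.alphaSeries).map Complex.ofRealHom) :=
    summable_of_ne_finset_zero (s := Finset.range (m + 1)) fun n hn => by
      simp [M.coeff_alphaSeries_of_lt (by simpa using hn : m < n)]
  have hb : WeightedSummable R ((M.betaSeries⁻¹).map Complex.ofRealHom) :=
    hs.congr fun n => by simp
  refine (hm.mul h0 hb).congr fun n => ?_
  rw [← map_mul, ← gammaSeries_inv, PowerSeries.coeff_map, gammaInv]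
  simp

theorem SigmaSchur.summable_betaSeries_inv (h : M.SigmaSchur) :
    Summable fun n => |PowerSeries.coeff n M.betaSeries⁻¹| := by
  obtain ⟨R, hR, hs⟩ := h.exists_summable
  exact Summable.of_nonneg_of_le (fun _ => abs_nonneg _)
    (fun n => le_mul_of_one_le_right (abs_nonneg _) (one_le_pow₀ hR.le)) hs

theorem SigmaSchur.summable_gammaInv (h : M.SigmaSchur) :
    Summable fun n => |M.gammaInv n| := by
  obtain ⟨R, hR, hs⟩ := h.exists_summable_gammaInv
  exact Summable.of_nonneg_of_le (fun _ => abs_nonneg _)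
    (fun n => le_mul_of_one_le_right (abs_nonneg _) (one_le_pow₀ hR.le)) hs

theorem SigmaSchur.summable_gammaInv_mul (h : M.SigmaSchur) :
    Summable fun n => |M.gammaInv n| * (n : ℝ) := by
  obtain ⟨R, hR, hs⟩ := h.exists_summable_gammaInv
  refine Summable.of_nonneg_of_le (fun _ => by positivity) (fun n => ?_)
    (hs.mul_right (R - 1)⁻¹)
  rw [mul_assoc]
  gcongr
  rw [← div_eq_mul_inv, le_div_iff₀ (by linarith)]
  -- Bernoulli's inequality gives n (R - 1) ≤ R^n, so the linear weight is dominated by the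
  -- geometric one.
  have := one_add_mul_sub_le_pow (by linarith : -1 ≤ R) n
  linarith

theorem NullStable.bddAbove_gamma (h : M.NullStable) :
    BddAbove (Set.range fun r => |M.gamma r|) := by
  obtain ⟨C, hC⟩ := h.exists_bound
  refine ⟨C * ∑' i, |PowerSeries.coeff i M.betaSeries|, ?_⟩
  rintro _ ⟨n, rfl⟩
  have := norm_coeff_mul_le ((abs_nonneg _).trans (hC 0)) n (fun i _ => hC i)
    (G := M.betaSeries) (summable_of_eventually_zero fun n => M.coeff_betaSeries_of_lt)
  rw [mul_comm] at this
  exact this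

end MultistepMethod

/-! ### The quadrature form of the method -/

namespace MultistepMethod

variable {m : ℕ} (M : MultistepMethod m)

theorem alpha_of_lt {j : ℕ} (hj : m < j) : M.alpha j = 0 := by simp [alpha, hj]

theorem beta_of_lt {j : ℕ} (hj : m - M.mu < j) : M.beta j = 0 := by simp [beta, hj]

theorem alpha_zero_ne : M.alpha 0 ≠ 0 := by rw [alpha_zero]; exact M.lead_ne

theorem coeff_alphaSeries_mul (f : ℕ → ℝ) (t : ℕ) :
    PowerSeries.coeff t (M.alphaSeries * PowerSeries.mk f)
      = ∑ i ∈ Finset.range (t + 1), M.alpha i * f (t - i) := by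
  rw [PowerSeries.coeff_mul, Finset.Nat.sum_antidiagonal_eq_sum_range_succ_mk]
  simp [alphaSeries]

theorem sum_alpha_eq_sum_a (f : ℕ → ℝ) {t : ℕ} (ht : m ≤ t) :
    ∑ i ∈ Finset.range (t + 1), M.alpha i * f (t - i)
      = ∑ j ∈ Finset.range (m + 1), M.a j * f (t - m + j) := by
  rw [← Finset.sum_range_reflect (fun j => M.a j * f (t - m + j))]
  symm
  refine Finset.sum_subset_zero_on_sdiff (Finset.range_mono (by omega)) (fun i hi => ?_)
    (fun i hi => ?_)
  · rw [alpha_of_lt _ (by simp at hi; omega), zero_mul]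
  · have := Finset.mem_range.1 hi
    rw [alpha, if_pos (by omega)]
    congr 2
    omega

/-- The weights of the quadrature form of the method, for all nodes: `φ_t = h ∑_s w_{ts} ψ_s`. -/
noncomputable def weight (t s : ℕ) : ℝ :=
  if s < m then M.quadWeight s t else if M.mu + s ≤ t then M.gamma (t - M.mu - s) else 0

theorem quadWeight_rec (s : ℕ) {t : ℕ} (ht : m ≤ t) :
    ∑ i ∈ Finset.range (t + 1), M.alpha i * M.quadWeight s (t - i)
      = if M.mu + s ≤ t then M.beta (t - M.mu - s) else 0 := by
  have h1 := M.one_le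
  rw [← Finset.sum_range_reflect, Finset.sum_range_succ]
  have e2 : t + 1 - 1 - t = 0 := by omega
  have e3 : t - (t + 1 - 1 - t) = t := by omega
  rw [e3, e2, quadWeight, if_neg (by omega), if_neg (by omega), mul_div_cancel₀ _ M.alpha_zero_ne,
    Finset.sum_range, add_comm, sub_add_eq_add_sub, sub_eq_iff_eq_add]
  congr 1
  refine Finset.sum_congr rfl fun i _ => ?_
  have := i.2
  congr 2
  omega

theorem sum_alpha_mul_gamma (n : ℕ) :
    ∑ i ∈ Finset.range (n + 1), M.alpha i * M.gamma (n - i) = M.beta n := by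
  have h := congrArg (PowerSeries.coeff n) M.alphaSeries_mul_gammaSeries
  have h2 : M.gammaSeries = PowerSeries.mk M.gamma := by ext n; simp [gamma]
  rw [h2, coeff_alphaSeries_mul] at h
  simpa [betaSeries] using h

/-- For a starting node the recurrence is built into the definition. For a later node the column is
a shifted copy of γ vanishing before the shift, so the recurrence is α γ = β. -/
theorem weight_rec (s : ℕ) {t : ℕ} (ht : m ≤ t) :
    ∑ i ∈ Finset.range (t + 1), M.alpha i * M.weight (t - i) s
      = if M.mu + s ≤ t then M.beta (t - M.mu - s) else 0 := by
  by_cases hs : s < m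
  · simp only [weight, if_pos hs]
    exact M.quadWeight_rec s ht
  · simp only [weight, if_neg hs]
    split_ifs with h
    · rw [← M.sum_alpha_mul_gamma]
      symm
      refine Finset.sum_subset_zero_on_sdiff (Finset.range_mono (by omega)) (fun i hi => ?_)
        (fun i hi => ?_)
      · simp only [Finset.mem_sdiff, Finset.mem_range] at hi
        rw [if_neg (by omega), mul_zero]
      · have := Finset.mem_range.1 hi
        rw [if_pos (by omega)]
        congr 2
        omega
    · refine Finset.sum_eq_zero fun i _ => ?_
      rw [if_neg (by omega), mul_zero]

/-- The quadrature `∑_s w_{ts} ψ_s`. -/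
noncomputable def quad (t : ℕ) (ψ : ℕ → ℝ) : ℝ :=
  ∑ s ∈ Finset.range (m + t), M.weight t s * ψ s

theorem quad_eq_sum {t R : ℕ} (hR : m + t ≤ R) (ψ : ℕ → ℝ) :
    M.quad t ψ = ∑ s ∈ Finset.range R, M.weight t s * ψ s := by
  refine Finset.sum_subset (Finset.range_mono hR) fun s _ hs => ?_
  have h1 := M.one_le
  rw [Finset.mem_range, not_lt] at hs
  rw [weight, if_neg (by omega), if_neg (by omega), zero_mul]

theorem quad_rec (ψ : ℕ → ℝ) {t : ℕ} (ht : m ≤ t) :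
    ∑ i ∈ Finset.range (t + 1), M.alpha i * M.quad (t - i) ψ
      = ∑ j ∈ Finset.range (m - M.mu + 1), M.b j * ψ (t - m + j) := by
  have hmu := M.mu_le
  have h1 : ∀ i, M.alpha i * M.quad (t - i) ψ
      = ∑ s ∈ Finset.range (m + t), M.alpha i * M.weight (t - i) s * ψ s := by
    intro i
    rw [M.quad_eq_sum (R := m + t) (by omega), Finset.mul_sum]
    exact Finset.sum_congr rfl fun s _ => by ring
  simp only [h1]
  rw [Finset.sum_comm]
  simp only [← Finset.sum_mul, M.weight_rec _ ht]
  have h2 := Finset.sum_Ico_eq_sum_range (fun s => M.b (s - (t - m)) * ψ s) (t - m) (t - M.mu + 1)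
  have h3 : t - M.mu + 1 - (t - m) = m - M.mu + 1 := by omega
  rw [h3] at h2
  simp only [Nat.add_sub_cancel_left] at h2
  rw [← h2]
  symm
  refine Finset.sum_subset_zero_on_sdiff (fun s hs => ?_) (fun s hs => ?_) (fun s hs => ?_)
  · have h1 := M.one_le
    simp only [Finset.mem_Ico, Finset.mem_range] at hs ⊢
    omega
  · simp only [Finset.mem_sdiff, Finset.mem_Ico, Finset.mem_range] at hs
    split_ifs with h
    · rw [beta_of_lt _ (by omega), zero_mul]
    · rw [zero_mul]
  · simp only [Finset.mem_Ico] at hs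
    rw [if_pos (by omega), beta, if_pos (by omega)]
    congr 2
    omega

theorem quad_zero (ψ : ℕ → ℝ) : M.quad 0 ψ = 0 := by
  have h1 := M.one_le
  refine Finset.sum_eq_zero fun s hs => ?_
  rw [weight, if_pos (by simpa using hs), quadWeight, if_pos rfl, zero_mul]

theorem quad_of_lt (ψ : ℕ → ℝ) {r : ℕ} (h0 : 1 ≤ r) (hr : r < m) :
    M.quad r ψ = ∑ s ∈ Finset.range m, startWeight m r s * ψ s := by
  symm
  refine Finset.sum_subset_zero_on_sdiff (Finset.range_mono (by omega)) (fun s hs => ?_)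
    (fun s hs => ?_)
  · simp only [Finset.mem_sdiff, Finset.mem_range] at hs
    rw [weight, if_neg (by omega), if_neg (by omega), zero_mul]
  · rw [weight, if_pos (by simpa using hs), quadWeight, if_neg (by omega), if_pos hr]

/-- The starting nodes are replaced by zeros in the second sum rather than removed, so that it
remains a full convolution with γ and can be inverted by multiplication with 1/γ. -/
theorem quad_split (ψ : ℕ → ℝ) {n : ℕ} (hn : m + M.mu ≤ n) :
    M.quad n ψ = ∑ s ∈ Finset.range m, M.quadWeight s n * ψ s
      + ∑ s ∈ Finset.range (n - M.mu + 1), M.gamma (n - M.mu - s) * (if m ≤ s then ψ s else 0) := by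
  have h1 : ∑ s ∈ Finset.range m, M.quadWeight s n * ψ s
      = ∑ s ∈ Finset.range (m + n), if s < m then M.quadWeight s n * ψ s else 0 := by
    refine Finset.sum_subset_zero_on_sdiff (Finset.range_mono (by omega)) (fun s hs => ?_)
      (fun s hs => ?_)
    · simp only [Finset.mem_sdiff, Finset.mem_range] at hs
      rw [if_neg hs.2]
    · rw [if_pos (by simpa using hs)]
  have h2 : ∑ s ∈ Finset.range (n - M.mu + 1),
        M.gamma (n - M.mu - s) * (if m ≤ s then ψ s else 0)
      = ∑ s ∈ Finset.range (m + n), if M.mu + s ≤ n then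
        M.gamma (n - M.mu - s) * (if m ≤ s then ψ s else 0) else 0 := by
    have := M.one_le
    refine Finset.sum_subset_zero_on_sdiff (Finset.range_mono (by omega)) (fun s hs => ?_)
      (fun s hs => ?_)
    · simp only [Finset.mem_sdiff, Finset.mem_range] at hs
      rw [if_neg (by omega)]
    · simp only [Finset.mem_range] at hs
      rw [if_pos (show M.mu + s ≤ n by omega)]
  rw [h1, h2, ← Finset.sum_add_distrib]
  refine Finset.sum_congr rfl fun s _ => ?_
  rw [weight]
  by_cases hs : s < m
  · simp [hs, not_le.2 hs]
  · simp only [hs, if_false, not_lt.1 hs, if_true, zero_add]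
    split_ifs <;> simp

/-- Both sides have the same first m values and obey the same recurrence, whose leading coefficient
α_0 = a_m is nonzero. -/
theorem eq_quad_of_rec {h : ℝ} {ψ φ : ℕ → ℝ} {n : ℕ} (h0 : φ 0 = 0)
    (hstart : ∀ r, 1 ≤ r → r < m → φ r = h * ∑ s ∈ Finset.range m, startWeight m r s * ψ s)
    (hrec : ∀ r, r + m ≤ n → ∑ j ∈ Finset.range (m + 1), M.a j * φ (r + j)
      = h * ∑ j ∈ Finset.range (m - M.mu + 1), M.b j * ψ (r + j)) :
    ∀ t ≤ n, φ t = h * M.quad t ψ := by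
  intro t
  induction t using Nat.strong_induction_on with
  | _ t ih =>
    intro htn
    rcases Nat.eq_zero_or_pos t with rfl | ht0
    · rw [h0, quad_zero, mul_zero]
    by_cases htm : t < m
    · rw [hstart t ht0 htm, M.quad_of_lt ψ ht0 htm]
    · rw [not_lt] at htm
      have h1 := hrec (t - m) (by omega)
      rw [← M.quad_rec ψ htm, ← M.sum_alpha_eq_sum_a φ htm, Finset.sum_range_succ',
        Finset.sum_range_succ', mul_add, Finset.mul_sum] at h1
      have h2 : ∀ i ∈ Finset.range t, M.alpha (i + 1) * φ (t - (i + 1))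
          = h * (M.alpha (i + 1) * M.quad (t - (i + 1)) ψ) := by
        intro i _
        rw [ih (t - (i + 1)) (by omega) (by omega)]
        ring
      rw [Finset.sum_congr rfl h2, add_right_inj, Nat.sub_zero] at h1
      refine mul_left_cancel₀ M.alpha_zero_ne ?_
      rw [h1]
      ring

/-- This eliminates the auxiliary values φ: they are necessarily h times the quadratures, and these
do satisfy the recurrence. -/
theorem isApproximation_iff {k : ℝ → ℝ → ℝ} {a b : ℝ} {N : ℕ} {g v : ℕ → ℝ} :
    IsApproximation M k a b N g v ↔
      (∀ n, 1 ≤ n → n ≤ m → stepSize a b N * ∑ s ∈ Finset.range m,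
        startWeight m n s * k (gridPt a b N n) (gridPt a b N s) * v s = g n) ∧
      ∀ n, m + M.mu ≤ n → n ≤ N →
        stepSize a b N * M.quad n (fun s => k (gridPt a b N n) (gridPt a b N s) * v s) = g n := by
  refine and_congr_right fun _ => ?_
  refine forall_congr' fun n => forall_congr' fun hn => forall_congr' fun hnN => ?_
  constructor
  · rintro ⟨φ, h0, hs, hr, hg⟩
    rw [← hg]
    exact (M.eq_quad_of_rec h0 hs hr n le_rfl).symm
  · intro h
    refine ⟨fun t => stepSize a b N
      * M.quad t (fun s => k (gridPt a b N n) (gridPt a b N s) * v s), ?_, ?_, ?_, h⟩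
    · beta_reduce
      rw [quad_zero, mul_zero]
    · intro r h0 hr
      beta_reduce
      rw [M.quad_of_lt _ h0 hr]
    · intro r hr
      have h1 := M.quad_rec (fun s => k (gridPt a b N n) (gridPt a b N s) * v s)
        (t := r + m) (by omega)
      rw [M.sum_alpha_eq_sum_a (fun i => M.quad i _) (by omega)] at h1
      simp only [Nat.add_sub_cancel] at h1
      rw [← h1, Finset.mul_sum]
      exact Finset.sum_congr rfl fun j _ => by ring

theorem eq_alphaSeries_inv_mul (f : ℕ → ℝ) :
    PowerSeries.mk f = M.alphaSeries⁻¹ * (M.alphaSeries * PowerSeries.mk f) := by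
  rw [← mul_assoc, PowerSeries.inv_mul_cancel _ M.constantCoeff_alphaSeries, one_mul]

variable {M}

/-- By the recurrence, α times the generating function of a column is a polynomial; multiplying by
1/α, which has bounded coefficients, recovers the column. -/
theorem NullStable.exists_bound_quadWeight (h : M.NullStable) (s : ℕ) :
    ∃ C, ∀ n, |M.quadWeight s n| ≤ C := by
  obtain ⟨C, hC⟩ := h.exists_bound
  refine ⟨C * ∑' i, ‖PowerSeries.coeff i (M.alphaSeries * PowerSeries.mk (M.quadWeight s))‖,
    fun n => ?_⟩
  have hs : Summable fun i =>
      ‖PowerSeries.coeff i (M.alphaSeries * PowerSeries.mk (M.quadWeight s))‖ := by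
    refine summable_of_eventually_zero (d := m + s) fun i hi => ?_
    have := M.mu_le
    rw [coeff_alphaSeries_mul, quadWeight_rec _ _ (by omega)]
    split_ifs
    · exact beta_of_lt _ (by omega)
    · rfl
  have := norm_coeff_mul_le ((abs_nonneg _).trans (hC 0)) n (fun i _ => hC i) hs
  rwa [← eq_alphaSeries_inv_mul, PowerSeries.coeff_mk, Real.norm_eq_abs] at this

theorem NullStable.bddAbove_quadWeight (h : M.NullStable) :
    BddAbove (Set.range fun i : ℕ => ∑ s ∈ Finset.range m, |M.quadWeight s (m + M.mu + i)|) := by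
  choose C hC using h.exists_bound_quadWeight
  refine ⟨∑ s ∈ Finset.range m, C s, ?_⟩
  rintro _ ⟨i, rfl⟩
  exact Finset.sum_le_sum fun s _ => hC s _

theorem NullStable.sum_quadWeight_le (h : M.NullStable) {n : ℕ} (hn : m + M.mu ≤ n) :
    ∑ s ∈ Finset.range m, |M.quadWeight s n| ≤ M.quadWeightBound := by
  have := le_ciSup h.bddAbove_quadWeight (n - (m + M.mu))
  simp only [Nat.add_sub_cancel' hn] at this
  exact this

end MultistepMethod

/-! ### Taylor expansions with uniform constants -/

/-- Around each point of `S` the function `g` has an expansion of order `p` with coefficients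
and remainder bounded by means of the constant `B`. -/
def TaylorBdd (p : ℕ) (B : ℝ) (S : Set ℝ) (g : ℝ → ℝ) : Prop :=
  ∀ y₀ ∈ S, ∃ c : ℕ → ℝ, (∀ i < p, |c i| ≤ B) ∧
    ∀ y ∈ S, |g y - ∑ i ∈ Finset.range p, c i * (y - y₀) ^ i| ≤ B * |y - y₀| ^ p

namespace TaylorBdd

variable {p : ℕ} {B B' : ℝ} {S S' : Set ℝ} {g g' : ℝ → ℝ}

theorem mono (h : TaylorBdd p B S g) (hB : B ≤ B') (hS : S' ⊆ S) : TaylorBdd p B' S' g := by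
  intro y₀ hy₀
  obtain ⟨c, hc, hg⟩ := h y₀ (hS hy₀)
  refine ⟨c, fun i hi => (hc i hi).trans hB, fun y hy => (hg y (hS hy)).trans ?_⟩
  gcongr

theorem sum_range_self (hp : 1 ≤ p) (c : ℕ → ℝ) (y₀ : ℝ) :
    ∑ i ∈ Finset.range p, c i * (y₀ - y₀) ^ i = c 0 := by
  rw [Finset.sum_eq_single_of_mem 0 (Finset.mem_range.2 hp)]
  · simp
  · intro i _ hi
    simp [hi]

theorem abs_le (h : TaylorBdd p B S g) (hp : 1 ≤ p) {y : ℝ} (hy : y ∈ S) : |g y| ≤ B := by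
  obtain ⟨c, hc, hg⟩ := h y hy
  have h1 := hg y hy
  rw [sum_range_self hp, sub_self, abs_zero, zero_pow (by omega), mul_zero] at h1
  rw [sub_eq_zero.1 (abs_nonpos_iff.1 h1)]
  exact hc 0 (by omega)

theorem nonneg (h : TaylorBdd p B S g) (hp : 1 ≤ p) (hS : S.Nonempty) : 0 ≤ B := by
  obtain ⟨y, hy⟩ := hS
  exact (abs_nonneg _).trans (h.abs_le hp hy)

theorem continuousOn (h : TaylorBdd p B S g) (hp : 1 ≤ p) : ContinuousOn g S := by
  intro y₀ hy₀
  obtain ⟨c, hc, hg⟩ := h y₀ hy₀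
  have h1 : g y₀ = ∑ i ∈ Finset.range p, c i * (y₀ - y₀) ^ i := by
    have h1 := hg y₀ hy₀
    rw [sub_self, abs_zero, zero_pow (by omega), mul_zero] at h1
    simpa using sub_eq_zero.1 (abs_nonpos_iff.1 h1)
  have h2 : Tendsto (fun y => ∑ i ∈ Finset.range p, c i * (y - y₀) ^ i) (𝓝[S] y₀) (𝓝 (g y₀)) := by
    rw [h1]
    have : Continuous fun y => ∑ i ∈ Finset.range p, c i * (y - y₀) ^ i := by fun_prop
    exact this.continuousWithinAt
  have h3 : Tendsto (fun y => g y - ∑ i ∈ Finset.range p, c i * (y - y₀) ^ i) (𝓝[S] y₀)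
      (𝓝 0) := by
    refine squeeze_zero_norm' (a := fun y => B * |y - y₀| ^ p) ?_ ?_
    · filter_upwards [self_mem_nhdsWithin] with y hy using hg y hy
    · have h4 : Continuous fun y => B * |y - y₀| ^ p := by fun_prop
      have h5 := h4.continuousWithinAt (s := S) (x := y₀)
      simpa [ContinuousWithinAt, zero_pow (by omega : p ≠ 0)] using h5
  simpa [ContinuousWithinAt] using h3.add h2

/-- The coefficients are those of the product of the two Taylor polynomials, truncated at degree p.
The dropped terms have degree between p and 2p, and `D ≥ 1` bounds every surplus power of the
distance by D^(2p). -/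
theorem mul {D : ℝ} (hp : 1 ≤ p) (hD : 1 ≤ D) (hS : ∀ y ∈ S, ∀ y₀ ∈ S, |y - y₀| ≤ D)
    (hg : TaylorBdd p B S g) (hg' : TaylorBdd p B' S g') :
    TaylorBdd p (B * B' * (1 + p * D ^ p + p ^ 2 * D ^ (2 * p))) S (fun y => g y * g' y) := by
  intro y₀ hy₀
  have hB := hg.nonneg hp ⟨y₀, hy₀⟩
  have hB' := hg'.nonneg hp ⟨y₀, hy₀⟩
  obtain ⟨c, hc, hcg⟩ := hg y₀ hy₀
  obtain ⟨d, hd, hdg⟩ := hg' y₀ hy₀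
  refine ⟨fun l => ∑ i ∈ Finset.range p, ∑ j ∈ Finset.range p, if i + j = l then c i * d j else 0,
    fun l _ => ?_, fun y hy => ?_⟩
  · calc _ ≤ ∑ i ∈ Finset.range p, ∑ j ∈ Finset.range p, B * B' := by
          refine (Finset.abs_sum_le_sum_abs _ _).trans (Finset.sum_le_sum fun i hi => ?_)
          refine (Finset.abs_sum_le_sum_abs _ _).trans (Finset.sum_le_sum fun j hj => ?_)
          split_ifs
          · rw [abs_mul]
            exact mul_le_mul (hc i (Finset.mem_range.1 hi)) (hd j (Finset.mem_range.1 hj))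
              (abs_nonneg _) hB
          · rw [abs_zero]; positivity
      _ = B * B' * (0 + 0 + p ^ 2 * 1) := by simp; ring
      _ ≤ _ := by
          gcongr
          · exact zero_le_one
          · positivity
          · exact one_le_pow₀ hD
  · set z := y - y₀ with hz
    have hzD : |z| ≤ D := hS y hy y₀ hy₀
    set P := ∑ i ∈ Finset.range p, c i * z ^ i with hP
    set Q := ∑ j ∈ Finset.range p, d j * z ^ j with hQ
    have htr : ∑ l ∈ Finset.range p, (∑ i ∈ Finset.range p, ∑ j ∈ Finset.range p,
        if i + j = l then c i * d j else 0) * z ^ l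
        = ∑ i ∈ Finset.range p, ∑ j ∈ Finset.range p,
          if i + j < p then c i * d j * z ^ (i + j) else 0 := by
      simp only [Finset.sum_mul, ite_mul, zero_mul]
      rw [Finset.sum_comm]
      refine Finset.sum_congr rfl fun i _ => ?_
      rw [Finset.sum_comm]
      refine Finset.sum_congr rfl fun j _ => ?_
      rw [Finset.sum_ite_eq]
      simp
    have hPQ : P * Q = ∑ i ∈ Finset.range p, ∑ j ∈ Finset.range p, c i * d j * z ^ (i + j) := by
      rw [hP, hQ, Finset.sum_mul_sum]
      refine Finset.sum_congr rfl fun i _ => Finset.sum_congr rfl fun j _ => ?_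
      ring
    have h1 : |P * Q - ∑ l ∈ Finset.range p, (∑ i ∈ Finset.range p, ∑ j ∈ Finset.range p,
        if i + j = l then c i * d j else 0) * z ^ l| ≤ B * B' * (p ^ 2 * D ^ (2 * p)) * |z| ^ p := by
      rw [htr, hPQ, ← Finset.sum_sub_distrib]
      calc _ ≤ ∑ i ∈ Finset.range p, ∑ j ∈ Finset.range p, B * B' * D ^ (2 * p) * |z| ^ p := by
            refine (Finset.abs_sum_le_sum_abs _ _).trans (Finset.sum_le_sum fun i hi => ?_)
            rw [← Finset.sum_sub_distrib]
            refine (Finset.abs_sum_le_sum_abs _ _).trans (Finset.sum_le_sum fun j hj => ?_)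
            rw [Finset.mem_range] at hi hj
            split_ifs with hij
            · rw [sub_self, abs_zero]; positivity
            · rw [sub_zero, abs_mul, abs_mul, abs_pow, mul_assoc (B * B')]
              refine mul_le_mul (mul_le_mul (hc i hi) (hd j hj) (abs_nonneg _) hB) ?_
                (by positivity) (by positivity)
              have : i + j = (i + j - p) + p := by omega
              rw [this, pow_add]
              gcongr
              calc |z| ^ (i + j - p) ≤ D ^ (i + j - p) := by gcongr
                _ ≤ D ^ (2 * p) := pow_le_pow_right₀ hD (by omega)
        _ = _ := by simp; ring
    have hPb : |P| ≤ B * (p * D ^ p) := by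
      calc _ ≤ ∑ i ∈ Finset.range p, B * D ^ p := by
            refine (Finset.abs_sum_le_sum_abs _ _).trans (Finset.sum_le_sum fun i hi => ?_)
            rw [Finset.mem_range] at hi
            rw [abs_mul, abs_pow]
            refine mul_le_mul (hc i hi) ?_ (by positivity) hB
            calc |z| ^ i ≤ D ^ i := by gcongr
              _ ≤ D ^ p := pow_le_pow_right₀ hD hi.le
        _ = _ := by simp; ring
    have h2 : |(g y - P) * g' y| ≤ B * |z| ^ p * B' := by
      rw [abs_mul]
      exact mul_le_mul (hcg y hy) (hg'.abs_le hp hy) (abs_nonneg _) (by positivity)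
    have h3 : |P * (g' y - Q)| ≤ B * (p * D ^ p) * (B' * |z| ^ p) := by
      rw [abs_mul]
      exact mul_le_mul hPb (hdg y hy) (abs_nonneg _) (by positivity)
    have h4 := abs_add_three ((g y - P) * g' y) (P * (g' y - Q)) (P * Q - ∑ l ∈ Finset.range p,
      (∑ i ∈ Finset.range p, ∑ j ∈ Finset.range p,
        if i + j = l then c i * d j else 0) * z ^ l)
    have h5 : ∀ x : ℝ, (g y - P) * g' y + P * (g' y - Q) + (P * Q - x) = g y * g' y - x := by
      intro x; ring
    rw [h5] at h4
    refine h4.trans ?_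
    nlinarith [h1, h2, h3]

/-- Integrating the expansion of the derivative gains one order; the remainder is estimated by the
mean value inequality. The constant does not grow, because integration divides the coefficients by i
≥ 1. -/
theorem succ {c d : ℝ} (hg : ∀ y ∈ Set.Icc c d, HasDerivWithinAt g (g' y) (Set.Icc c d) y)
    (hB : ∀ y ∈ Set.Icc c d, |g y| ≤ B) (h : TaylorBdd p B (Set.Icc c d) g') :
    TaylorBdd (p + 1) B (Set.Icc c d) g := by
  intro y₀ hy₀
  obtain ⟨e, he, heg⟩ := h y₀ hy₀
  have hB0 : 0 ≤ B := (abs_nonneg _).trans (hB y₀ hy₀)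
  set E : ℕ → ℝ := fun i => if i = 0 then g y₀ else e (i - 1) / i
  refine ⟨E, fun i hi => ?_, fun y hy => ?_⟩
  · by_cases h0 : i = 0
    · simpa [E, h0] using hB y₀ hy₀
    · simp only [E, h0, if_false]
      rw [abs_div, Nat.abs_cast]
      have h1 : (1 : ℝ) ≤ i := by exact_mod_cast Nat.one_le_iff_ne_zero.2 h0
      exact (div_le_self (abs_nonneg _) h1).trans (he _ (by omega))
  · have hsub : Set.uIcc y₀ y ⊆ Set.Icc c d := Set.uIcc_subset_Icc hy₀ hy
    set H : ℝ → ℝ := fun y => g y - ∑ i ∈ Finset.range (p + 1), E i * (y - y₀) ^ i with hH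
    have hder : ∀ z ∈ Set.uIcc y₀ y, HasDerivWithinAt H
        (g' z - ∑ i ∈ Finset.range p, e i * (z - y₀) ^ i) (Set.uIcc y₀ y) z := by
      intro z hz
      have hsum : (fun y => ∑ i ∈ Finset.range (p + 1), E i * (y - y₀) ^ i)
          = fun y => ∑ i ∈ Finset.range p, E (i + 1) * (y - y₀) ^ (i + 1) + E 0 := by
        funext y
        rw [Finset.sum_range_succ', pow_zero, mul_one]
      refine ((hg z (hsub hz)).mono hsub).sub ?_
      rw [hsum]
      have h1 : HasDerivAt (fun y => ∑ i ∈ Finset.range p, E (i + 1) * (y - y₀) ^ (i + 1))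
          (∑ i ∈ Finset.range p, e i * (z - y₀) ^ i) z := by
        refine HasDerivAt.fun_sum fun i _ => ?_
        have h2 := (((hasDerivAt_id z).sub_const y₀).pow (i + 1)).const_mul (E (i + 1))
        refine HasDerivAt.congr_deriv h2 ?_
        have : ((i : ℝ) + 1) ≠ 0 := by positivity
        simp [E]
        field_simp
      exact (h1.add_const (E 0)).hasDerivWithinAt
    have hbd : ∀ z ∈ Set.uIcc y₀ y,
        ‖g' z - ∑ i ∈ Finset.range p, e i * (z - y₀) ^ i‖ ≤ B * |y - y₀| ^ p := by
      intro z hz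
      refine (heg z (hsub hz)).trans ?_
      have := Set.abs_sub_left_of_mem_uIcc hz
      gcongr
    have h4 := Convex.norm_image_sub_le_of_norm_hasDerivWithin_le hder hbd (convex_uIcc y₀ y)
      Set.left_mem_uIcc Set.right_mem_uIcc
    have h5 : H y₀ = 0 := by
      rw [hH]
      beta_reduce
      rw [sum_range_self (by omega)]
      simp [E]
    rw [h5, sub_zero, Real.norm_eq_abs, Real.norm_eq_abs, mul_assoc, ← pow_succ] at h4
    exact h4

theorem one_of_lipschitz (hB : ∀ y ∈ S, |g y| ≤ B)
    (hL : ∀ y₁ ∈ S, ∀ y₂ ∈ S, |g y₁ - g y₂| ≤ B * |y₁ - y₂|) : TaylorBdd 1 B S g := by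
  intro y₀ hy₀
  refine ⟨fun _ => g y₀, fun _ _ => hB y₀ hy₀, fun y hy => ?_⟩
  simpa using hL y hy y₀ hy₀

/-- The moment conditions say that the functional annihilates polynomials of degree below p centred
at `y₀`. Subtracting the Taylor polynomial there leaves only the remainder, of size B |y - y₀|^p. -/
theorem exact_functional {a T : ℝ} (hp : 1 ≤ p) (h : TaylorBdd p B (Set.Icc a T) g)
    {J J' : Finset ℕ} {A b : ℕ → ℝ} {y₀ η : ℝ} (hη : 0 ≤ η) (hy₀ : a ≤ y₀)
    (hmom : ∀ i < p, ∑ j ∈ J, A j * ((j : ℝ) ^ (i + 1) / (i + 1)) = ∑ j ∈ J', b j * (j : ℝ) ^ i)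
    (hJ : ∀ j ∈ J, y₀ + j * η ≤ T) (hJ' : ∀ j ∈ J', y₀ + j * η ≤ T) (hT : y₀ ≤ T) :
    |∑ j ∈ J, A j * (∫ y in y₀..(y₀ + j * η), g y) - η * ∑ j ∈ J', b j * g (y₀ + j * η)|
      ≤ (∑ j ∈ J, |A j| * (j : ℝ) ^ (p + 1) + ∑ j ∈ J', |b j| * (j : ℝ) ^ p) * B * η ^ (p + 1) := by
  have hcont := h.continuousOn hp
  have hB := h.nonneg hp ⟨y₀, hy₀, hT⟩
  obtain ⟨c, hc, hg⟩ := h y₀ ⟨hy₀, hT⟩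
  set P : ℝ → ℝ := fun y => ∑ i ∈ Finset.range p, c i * (y - y₀) ^ i with hP
  have hPc : Continuous P := by fun_prop
  have hmem : ∀ j : ℕ, y₀ + j * η ≤ T → y₀ + j * η ∈ Set.Icc a T := fun j hj =>
    ⟨by nlinarith [mul_nonneg (Nat.cast_nonneg (α := ℝ) j) hη], hj⟩
  have hsub : ∀ j : ℕ, y₀ + j * η ≤ T → Set.uIcc y₀ (y₀ + j * η) ⊆ Set.Icc a T := fun j hj =>
    Set.uIcc_subset_Icc ⟨hy₀, hT⟩ (hmem j hj)
  have hPint : ∀ j : ℕ, ∫ y in y₀..(y₀ + j * η), P y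
      = ∑ i ∈ Finset.range p, c i * ((j * η) ^ (i + 1) / (i + 1)) := by
    intro j
    rw [hP, intervalIntegral.integral_finsetSum
      fun i _ => (Continuous.intervalIntegrable (by fun_prop) _ _)]
    refine Finset.sum_congr rfl fun i _ => ?_
    rw [intervalIntegral.integral_const_mul, intervalIntegral.integral_comp_sub_right
      (fun y => y ^ i), integral_pow]
    simp
  have hexact : ∑ j ∈ J, A j * (∫ y in y₀..(y₀ + j * η), P y)
      - η * ∑ j ∈ J', b j * P (y₀ + j * η) = 0 := by
    simp only [hPint]
    rw [hP]
    simp only [Finset.mul_sum]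
    rw [Finset.sum_comm, Finset.sum_comm (s := J'), ← Finset.sum_sub_distrib]
    refine Finset.sum_eq_zero fun i hi => ?_
    have h1 := hmom i (Finset.mem_range.1 hi)
    have h2 : ∑ j ∈ J, A j * (c i * ((j * η) ^ (i + 1) / (i + 1)))
        = c i * η ^ (i + 1) * ∑ j ∈ J, A j * ((j : ℝ) ^ (i + 1) / (i + 1)) := by
      rw [Finset.mul_sum]
      exact Finset.sum_congr rfl fun j _ => by ring
    have h3 : ∑ j ∈ J', η * (b j * (c i * (y₀ + j * η - y₀) ^ i))
        = c i * η ^ (i + 1) * ∑ j ∈ J', b j * (j : ℝ) ^ i := by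
      rw [Finset.mul_sum]
      exact Finset.sum_congr rfl fun j _ => by ring
    rw [h2, h3, h1, sub_self]
  have hdiff : ∑ j ∈ J, A j * (∫ y in y₀..(y₀ + j * η), g y) - η * ∑ j ∈ J', b j * g (y₀ + j * η)
      = ∑ j ∈ J, A j * (∫ y in y₀..(y₀ + j * η), (g y - P y))
        - η * ∑ j ∈ J', b j * (g (y₀ + j * η) - P (y₀ + j * η)) := by
    have h1 : ∑ j ∈ J, A j * (∫ y in y₀..(y₀ + j * η), (g y - P y))
        = ∑ j ∈ J, A j * (∫ y in y₀..(y₀ + j * η), g y)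
          - ∑ j ∈ J, A j * (∫ y in y₀..(y₀ + j * η), P y) := by
      rw [← Finset.sum_sub_distrib]
      refine Finset.sum_congr rfl fun j hj => ?_
      rw [intervalIntegral.integral_sub, mul_sub]
      · exact (hcont.mono (hsub j (hJ j hj))).intervalIntegrable
      · exact hPc.intervalIntegrable _ _
    simp only [mul_sub, Finset.sum_sub_distrib] at *
    rw [h1]
    linear_combination hexact
  rw [hdiff]
  have hI : ∀ j ∈ J, |∫ y in y₀..(y₀ + j * η), (g y - P y)| ≤ B * (j * η) ^ p * (j * η) := by
    intro j hj
    have hjη : (0 : ℝ) ≤ j * η := by positivity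
    have h1 := intervalIntegral.norm_integral_le_of_norm_le_const (a := y₀) (b := y₀ + j * η)
      (f := fun y => g y - P y) (C := B * (j * η) ^ p) ?_
    · simpa [abs_of_nonneg hjη, abs_of_nonneg hη] using h1
    · intro y hy
      have hy' := Set.uIoc_subset_uIcc hy
      refine (hg y (hsub j (hJ j hj) hy')).trans ?_
      have := Set.abs_sub_left_of_mem_uIcc hy'
      rw [add_sub_cancel_left, abs_of_nonneg hjη] at this
      gcongr
  refine (abs_sub _ _).trans ?_
  rw [add_mul, add_mul]
  refine add_le_add ?_ ?_
  · rw [Finset.sum_mul, Finset.sum_mul]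
    refine (Finset.abs_sum_le_sum_abs _ _).trans (Finset.sum_le_sum fun j hj => ?_)
    rw [abs_mul]
    calc _ ≤ |A j| * (B * (j * η) ^ p * (j * η)) := by gcongr; exact hI j hj
      _ = _ := by ring
  · rw [abs_mul, abs_of_nonneg hη, Finset.sum_mul, Finset.sum_mul]
    have h1 : |∑ j ∈ J', b j * (g (y₀ + j * η) - P (y₀ + j * η))|
        ≤ ∑ j ∈ J', |b j| * (B * (j * η) ^ p) := by
      refine (Finset.abs_sum_le_sum_abs _ _).trans (Finset.sum_le_sum fun j hj => ?_)
      rw [abs_mul]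
      have h2 := hg _ (hmem j (hJ' j hj))
      have hjη : (0 : ℝ) ≤ j * η := by positivity
      rw [add_sub_cancel_left, abs_of_nonneg hjη] at h2
      have h3 : P (y₀ + j * η) = ∑ i ∈ Finset.range p, c i * (j * η) ^ i := by
        simp [hP]
      rw [h3]
      gcongr
    refine (mul_le_mul_of_nonneg_left h1 hη).trans (le_of_eq ?_)
    rw [Finset.mul_sum]
    exact Finset.sum_congr rfl fun j _ => by ring

end TaylorBdd

/-! ### Order conditions and quadrature errors -/

theorem eq_zero_of_isBigO_pow {D : ℝ} {q r : ℕ} (hqr : q < r)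
    (h : (fun x : ℝ => D * x ^ q) =O[𝓝[>] 0] fun x : ℝ => x ^ r) : D = 0 := by
  obtain ⟨C, hC⟩ := h.bound
  have h1 : ∀ᶠ x : ℝ in 𝓝[>] 0, |D| ≤ C * x ^ (r - q) := by
    filter_upwards [hC, self_mem_nhdsWithin] with x hx hx0
    have hx0' : (0 : ℝ) < x := hx0
    rw [Real.norm_eq_abs, Real.norm_eq_abs, abs_mul, abs_of_pos (pow_pos hx0' q),
      abs_of_pos (pow_pos hx0' r)] at hx
    have : x ^ r = x ^ (r - q) * x ^ q := by rw [← pow_add]; congr 1; omega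
    rw [this, ← mul_assoc] at hx
    exact le_of_mul_le_mul_right hx (pow_pos hx0' q)
  have h2 : Tendsto (fun x : ℝ => C * x ^ (r - q)) (𝓝[>] 0) (𝓝 0) := by
    have h3 : Continuous fun x : ℝ => C * x ^ (r - q) := by fun_prop
    have h4 := h3.continuousWithinAt (s := Set.Ioi 0) (x := 0)
    simpa [ContinuousWithinAt, zero_pow (by omega : r - q ≠ 0)] using h4
  exact abs_nonpos_iff.1 (ge_of_tendsto h2 h1)

namespace MultistepMethod

variable {m : ℕ} {M : MultistepMethod m}

/-- For the monomial t^i with c = y = 0 the local error is exactly a constant times h^(i+1), so it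
can be O(h^(q+1)) only if this constant vanishes. -/
theorem HasOrder.moment_eq {q : ℕ} (h : M.HasOrder q) {i : ℕ} (hi : i < q) :
    ∑ j ∈ Finset.range (m + 1), M.a j * ((j : ℝ) ^ (i + 1) / (i + 1))
      = ∑ j ∈ Finset.range (m + 1), M.b j * (j : ℝ) ^ i := by
  have h1 := h 0 1 one_pos (fun t => t ^ i) (by fun_prop) 0 (by simp)
  rw [← sub_eq_zero]
  refine eq_zero_of_isBigO_pow (q := i + 1) (r := q + 1) (by omega) (h1.congr_left fun x => ?_)
  simp only [locErr, integral_pow, zero_add]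
  rw [sub_mul, Finset.sum_mul, Finset.sum_mul, Finset.mul_sum]
  congr 1
  · refine Finset.sum_congr rfl fun j _ => ?_
    simp
    ring
  · exact Finset.sum_congr rfl fun j _ => by ring

/-- Here the base point y must differ from the lower limit c: for ψ = 1, c = 0, y = 1 the first
moment condition cancels the terms in h and leaves ∑ a_j. -/
theorem HasOrder.sum_a {q : ℕ} (h : M.HasOrder q) (hq : 1 ≤ q) :
    ∑ j ∈ Finset.range (m + 1), M.a j = 0 := by
  have h0 := h.moment_eq (i := 0) hq
  have h1 := h 0 2 two_pos (fun _ => 1) (by fun_prop) 1 (by norm_num)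
  refine eq_zero_of_isBigO_pow (q := 0) (r := q + 1) (by omega) (h1.congr_left fun x => ?_)
  simp only [locErr, intervalIntegral.integral_const, smul_eq_mul, mul_one, sub_zero, pow_zero]
  simp at h0
  simp only [mul_add, mul_one, Finset.sum_add_distrib]
  rw [← h0, Finset.mul_sum, add_sub_assoc, ← Finset.sum_sub_distrib]
  simp only [mul_left_comm x, mul_comm x, sub_self, Finset.sum_const_zero, add_zero]

theorem HasOrder.moment_eq' {q : ℕ} (h : M.HasOrder q) {i : ℕ} (hi : i < q) :
    ∑ j ∈ Finset.range (m + 1), M.a j * ((j : ℝ) ^ (i + 1) / (i + 1))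
      = ∑ j ∈ Finset.range (m - M.mu + 1), M.b j * (j : ℝ) ^ i := by
  rw [h.moment_eq hi]
  symm
  refine Finset.sum_subset (Finset.range_mono (by omega)) fun j hj hj' => ?_
  rw [Finset.mem_range] at hj hj'
  rw [M.b_zero j (by omega) (by omega), zero_mul]

theorem startWeight_moment {r i : ℕ} (hi : i < m) :
    ∑ s ∈ Finset.range m, startWeight m r s * (s : ℝ) ^ i = (r : ℝ) ^ (i + 1) / (i + 1) := by
  have h := congrFun (startMatrix_mulVec_startVector m r) ⟨i, hi⟩
  rw [← h, Finset.sum_range, Matrix.mulVec, dotProduct]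
  refine Finset.sum_congr rfl fun s _ => ?_
  simp [startWeight, startMatrix, mul_comm]

variable (M) in
/-- Error of the quadrature method on `[a, a + t η]`. -/
noncomputable def quadErr (g : ℝ → ℝ) (a η : ℝ) (t : ℕ) : ℝ :=
  (∫ y in a..(a + t * η), g y) - η * M.quad t fun s => g (a + s * η)

theorem abs_startErr_le {p r : ℕ} {B a η : ℝ} {g : ℝ → ℝ} (hp : 1 ≤ p) (hpm : p ≤ m) (hη : 0 ≤ η)
    (hr : r ≤ m) (h : TaylorBdd p B (Set.Icc a (a + m * η)) g) :
    |(∫ y in a..(a + r * η), g y) - η * ∑ s ∈ Finset.range m, startWeight m r s * g (a + s * η)|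
      ≤ ((r : ℝ) ^ (p + 1) + ∑ s ∈ Finset.range m, |startWeight m r s| * (s : ℝ) ^ p)
        * B * η ^ (p + 1) := by
  have hle : ∀ j : ℕ, j ≤ m → a + j * η ≤ a + m * η := by
    intro j hj
    gcongr
  have := h.exact_functional hp (J := {r}) (J' := Finset.range m) (A := fun _ => 1)
    (b := startWeight m r) hη le_rfl (fun i hi => ?_) (fun j hj => ?_) (fun j hj => ?_) ?_
  · simpa using this
  · rw [startWeight_moment (by omega)]
    simp
  · rw [Finset.mem_singleton] at hj
    exact hle j (by omega)
  · exact hle j (Finset.mem_range.1 hj).le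
  · have : (0 : ℝ) ≤ m * η := by positivity
    linarith

/-- The combination with α of the global quadrature errors is the local truncation error at the node
t - m, to which `exact_functional` applies. -/
theorem abs_sum_alpha_quadErr_le {q p t R : ℕ} {B a η : ℝ} {g : ℝ → ℝ} (hord : M.HasOrder q)
    (hp : 1 ≤ p) (hpq : p ≤ q) (hη : 0 ≤ η) (ht : m ≤ t) (htR : t ≤ R)
    (h : TaylorBdd p B (Set.Icc a (a + R * η)) g) :
    |∑ i ∈ Finset.range (t + 1), M.alpha i * M.quadErr g a η (t - i)|
      ≤ (∑ j ∈ Finset.range (m + 1), |M.a j| * (j : ℝ) ^ (p + 1)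
        + ∑ j ∈ Finset.range (m - M.mu + 1), |M.b j| * (j : ℝ) ^ p) * B * η ^ (p + 1) := by
  have hcont := h.continuousOn hp
  have hle : ∀ j : ℕ, j ≤ R → a + j * η ∈ Set.Icc a (a + R * η) := by
    intro j hj
    refine ⟨?_, by gcongr⟩
    have : (0 : ℝ) ≤ j * η := by positivity
    linarith
  have hcast : ∀ j : ℕ, a + ((t - m : ℕ) : ℝ) * η + j * η = a + ((t - m + j : ℕ) : ℝ) * η := by
    intro j; push_cast; ring
  have key := h.exact_functional hp (J := Finset.range (m + 1))
    (J' := Finset.range (m - M.mu + 1)) (A := M.a) (b := M.b) (y₀ := a + ((t - m : ℕ) : ℝ) * η) hη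
    (hle _ (by omega)).1 (fun i hi => hord.moment_eq' (by omega)) (fun j hj => ?_)
    (fun j hj => ?_) (hle _ (by omega)).2
  · refine le_trans (le_of_eq ?_) key
    congr 1
    have h1 : ∑ i ∈ Finset.range (t + 1), M.alpha i * M.quadErr g a η (t - i)
        = ∑ i ∈ Finset.range (t + 1), M.alpha i * (∫ y in a..(a + ((t - i : ℕ) : ℝ) * η), g y)
          - η * ∑ i ∈ Finset.range (t + 1), M.alpha i * M.quad (t - i) fun s => g (a + s * η) := by
      rw [Finset.mul_sum, ← Finset.sum_sub_distrib]
      refine Finset.sum_congr rfl fun i _ => ?_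
      rw [quadErr]
      ring
    rw [h1, M.quad_rec _ ht, M.sum_alpha_eq_sum_a (fun i => ∫ y in a..(a + (i : ℝ) * η), g y) ht]
    congr 1
    -- Since ∑ a_j = 0, the lower limit of all integrals may be moved from `a` to the node t - m.
    · have h2 : ∑ j ∈ Finset.range (m + 1), M.a j * (∫ y in a..(a + ((t - m : ℕ) : ℝ) * η), g y)
          = 0 := by
        rw [← Finset.sum_mul, hord.sum_a (by omega), zero_mul]
      rw [← sub_zero (∑ j ∈ Finset.range (m + 1), M.a j * _), ← h2, ← Finset.sum_sub_distrib]
      refine Finset.sum_congr rfl fun j hj => ?_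
      rw [Finset.mem_range] at hj
      rw [← mul_sub, hcast, intervalIntegral.integral_interval_sub_left]
      · exact (hcont.mono (Set.uIcc_subset_Icc (by simpa using hle 0 (by omega))
          (hle _ (by omega)))).intervalIntegrable
      · exact (hcont.mono (Set.uIcc_subset_Icc (by simpa using hle 0 (by omega))
          (hle _ (by omega)))).intervalIntegrable
    · simp only [hcast]
  · rw [hcast]
    rw [Finset.mem_range] at hj
    exact (hle _ (by omega)).2
  · have := M.mu_le
    rw [hcast]
    rw [Finset.mem_range] at hj
    exact (hle _ (by omega)).2

/-- The constant depends only on the method and p. The three bounds concern the starting rules, the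
local errors, and the global errors; the factor t + 1 in the last one is the accumulation of local
errors under the bounded coefficients of 1/α. -/
theorem exists_quadErr_bound {q p : ℕ} (hnull : M.NullStable) (hord : M.HasOrder q)
    (hp : 1 ≤ p) (hpq : p ≤ q) (hqm : q ≤ m) :
    ∃ C : ℝ, 0 ≤ C ∧ ∀ (a η B : ℝ) (R : ℕ) (g : ℝ → ℝ), 0 ≤ η → m ≤ R →
      TaylorBdd p B (Set.Icc a (a + R * η)) g →
      (∀ r ≤ m, |(∫ y in a..(a + r * η), g y)
          - η * ∑ s ∈ Finset.range m, startWeight m r s * g (a + s * η)| ≤ C * B * η ^ (p + 1)) ∧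
      (∀ t, m ≤ t → t ≤ R → |∑ i ∈ Finset.range (t + 1), M.alpha i * M.quadErr g a η (t - i)|
          ≤ C * B * η ^ (p + 1)) ∧
      (∀ t ≤ R, |M.quadErr g a η t| ≤ C * (t + 1) * B * η ^ (p + 1)) := by
  obtain ⟨Ca, hCa⟩ := hnull.exists_bound
  have hCa0 : 0 ≤ Ca := (abs_nonneg _).trans (hCa 0)
  set Cs := ∑ r ∈ Finset.range (m + 1),
    ((r : ℝ) ^ (p + 1) + ∑ s ∈ Finset.range m, |startWeight m r s| * (s : ℝ) ^ p) with hCs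
  have hCs0 : 0 ≤ Cs := by positivity
  set Cl := ∑ j ∈ Finset.range (m + 1), |M.a j| * (j : ℝ) ^ (p + 1)
        + ∑ j ∈ Finset.range (m - M.mu + 1), |M.b j| * (j : ℝ) ^ p with hCl
  have hCl0 : 0 ≤ Cl := by positivity
  set Cα := ∑ i ∈ Finset.range (m + 1), |M.alpha i| with hCα
  have hCα0 : 0 ≤ Cα := by positivity
  refine ⟨Cs + Cl + Ca * (Cl + Cα * Cs), by positivity, ?_⟩
  intro a η B R g hη hmR h
  have hB : 0 ≤ B := h.nonneg hp ⟨a, le_rfl, by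
    have : (0 : ℝ) ≤ R * η := by positivity
    linarith⟩
  have hmη : a + m * η ≤ a + R * η := by gcongr
  have hstart : ∀ r ≤ m, |(∫ y in a..(a + r * η), g y)
      - η * ∑ s ∈ Finset.range m, startWeight m r s * g (a + s * η)| ≤ Cs * B * η ^ (p + 1) := by
    intro r hr
    refine (abs_startErr_le hp (by omega) hη hr
      (h.mono le_rfl (Set.Icc_subset_Icc_right hmη))).trans ?_
    gcongr
    exact Finset.single_le_sum (f := fun r : ℕ => (r : ℝ) ^ (p + 1)
      + ∑ s ∈ Finset.range m, |startWeight m r s| * (s : ℝ) ^ p) (fun _ _ => by positivity)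
      (Finset.mem_range.2 (by omega))
  have hloc : ∀ t, m ≤ t → t ≤ R →
      |∑ i ∈ Finset.range (t + 1), M.alpha i * M.quadErr g a η (t - i)| ≤ Cl * B * η ^ (p + 1) :=
    fun t ht htR => abs_sum_alpha_quadErr_le hord hp hpq hη ht htR h
  have hX : 0 ≤ B * η ^ (p + 1) := by positivity
  have hsmall : ∀ t < m, |M.quadErr g a η t| ≤ Cs * B * η ^ (p + 1) := by
    intro t ht
    rcases Nat.eq_zero_or_pos t with rfl | ht0
    · simp only [quadErr, quad_zero]
      simp
      positivity
    · rw [quadErr, M.quad_of_lt _ ht0 ht]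
      exact hstart t ht.le
  refine ⟨fun r hr => (hstart r hr).trans ?_, fun t ht htR => (hloc t ht htR).trans ?_,
    fun t htR => ?_⟩
  · gcongr
    have : 0 ≤ Ca * (Cl + Cα * Cs) := by positivity
    linarith
  · gcongr
    have : 0 ≤ Ca * (Cl + Cα * Cs) := by positivity
    linarith
  -- Coefficients of α times the error series: below m they are combinations of starting errors,
  -- from m on they are local errors.
  · have hall : ∀ i ≤ R, |PowerSeries.coeff i
        (M.alphaSeries * PowerSeries.mk (M.quadErr g a η))| ≤ (Cl + Cα * Cs) * B * η ^ (p + 1) := by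
      intro i hi
      rw [coeff_alphaSeries_mul]
      by_cases him : i < m
      · calc _ ≤ ∑ j ∈ Finset.range (i + 1), |M.alpha j| * (Cs * B * η ^ (p + 1)) := by
              refine (Finset.abs_sum_le_sum_abs _ _).trans (Finset.sum_le_sum fun j hj => ?_)
              rw [abs_mul]
              gcongr
              exact hsmall _ (by omega)
          _ = (∑ j ∈ Finset.range (i + 1), |M.alpha j|) * (Cs * B * η ^ (p + 1)) := by
              exact (Finset.sum_mul _ _ _).symm
          _ ≤ Cα * (Cs * B * η ^ (p + 1)) := by
              gcongr
              rw [hCα]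
              exact Finset.sum_le_sum_of_subset_of_nonneg (Finset.range_mono (by omega))
                fun _ _ _ => abs_nonneg _
          _ ≤ _ := by nlinarith [mul_nonneg hCl0 hX]
      · refine (hloc i (not_lt.1 him) hi).trans ?_
        nlinarith [mul_nonneg (mul_nonneg hCα0 hCs0) hX]
    have h1 : M.quadErr g a η t = PowerSeries.coeff t (M.alphaSeries⁻¹
        * (M.alphaSeries * PowerSeries.mk (M.quadErr g a η))) := by
      rw [← eq_alphaSeries_inv_mul, PowerSeries.coeff_mk]
    rw [h1, PowerSeries.coeff_mul, Finset.Nat.sum_antidiagonal_eq_sum_range_succ_mk]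
    calc _ ≤ ∑ j ∈ Finset.range (t + 1), Ca * ((Cl + Cα * Cs) * B * η ^ (p + 1)) := by
          refine (Finset.abs_sum_le_sum_abs _ _).trans (Finset.sum_le_sum fun j hj => ?_)
          rw [abs_mul]
          exact mul_le_mul (hCa j) (hall _ (by omega)) (abs_nonneg _) hCa0
      _ = Ca * (Cl + Cα * Cs) * ((t + 1) * B * η ^ (p + 1)) := by
          rw [Finset.sum_const, Finset.card_range, nsmul_eq_mul]
          push_cast
          ring
      _ ≤ (Cs + Cl + Ca * (Cl + Cα * Cs)) * ((t + 1) * B * η ^ (p + 1)) := by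
          gcongr
          linarith
      _ = _ := by ring

end MultistepMethod

/-! ### Regularity of the kernel along slices -/

theorem hasDerivWithinAt_slice_snd {E : Set (ℝ × ℝ)} {F : ℝ × ℝ → ℝ} (hF : DifferentiableOn ℝ F E)
    {x : ℝ} {S : Set ℝ} (hS : ∀ y ∈ S, (x, y) ∈ E) {y : ℝ} (hy : y ∈ S) :
    HasDerivWithinAt (fun y => F (x, y)) (fderivWithin ℝ F E (x, y) (0, 1)) S y := by
  have h1 : HasDerivWithinAt (fun y : ℝ => (x, y)) ((0 : ℝ), (1 : ℝ)) S y :=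
    ((hasDerivAt_const y x).prodMk (hasDerivAt_id y)).hasDerivWithinAt
  exact ((hF (x, y) (hS y hy)).hasFDerivWithinAt).comp_hasDerivWithinAt y h1 hS

theorem hasDerivWithinAt_slice_fst {E : Set (ℝ × ℝ)} {F : ℝ × ℝ → ℝ} (hF : DifferentiableOn ℝ F E)
    {y : ℝ} {S : Set ℝ} (hS : ∀ x ∈ S, (x, y) ∈ E) {x : ℝ} (hx : x ∈ S) :
    HasDerivWithinAt (fun x => F (x, y)) (fderivWithin ℝ F E (x, y) (1, 0)) S x := by
  have h1 : HasDerivWithinAt (fun x : ℝ => (x, y)) ((1 : ℝ), (0 : ℝ)) S x :=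
    ((hasDerivAt_id x).prodMk (hasDerivAt_const x y)).hasDerivWithinAt
  exact ((hF (x, y) (hS x hx)).hasFDerivWithinAt).comp_hasDerivWithinAt x h1 hS

theorem ContDiffOn.fderivWithin_apply_const {E : Set (ℝ × ℝ)} {F : ℝ × ℝ → ℝ} {q : ℕ}
    (hE : UniqueDiffOn ℝ E) (hF : ContDiffOn ℝ ((q + 1 : ℕ) : WithTop ℕ∞) F E) (v : ℝ × ℝ) :
    ContDiffOn ℝ q (fun z => fderivWithin ℝ F E z v) E :=
  (hF.fderivWithin hE (by norm_cast)).clm_apply contDiffOn_const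

/-- Compactness of E bounds the function and its partial derivatives in y uniformly, and each such
derivative adds one order through `TaylorBdd.succ`. -/
theorem exists_taylorBdd_slice {E : Set (ℝ × ℝ)} (hE : IsCompact E) (hE' : UniqueDiffOn ℝ E)
    {p : ℕ} {F : ℝ × ℝ → ℝ} (hF : ContDiffOn ℝ p F E) :
    ∃ B, ∀ x c d, (∀ y ∈ Set.Icc c d, (x, y) ∈ E) →
      TaylorBdd p B (Set.Icc c d) (fun y => F (x, y)) := by
  induction p generalizing F with
  | zero =>
    obtain ⟨B, hB⟩ := hE.exists_bound_of_continuousOn hF.continuousOn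
    exact ⟨B, fun x c d hS y₀ _ => ⟨0, fun i hi => absurd hi (Nat.not_lt_zero i),
      fun y hy => by simpa using hB _ (hS y hy)⟩⟩
  | succ p ih =>
    obtain ⟨B, hB⟩ := hE.exists_bound_of_continuousOn hF.continuousOn
    obtain ⟨B', hB'⟩ := ih (hF.fderivWithin_apply_const hE' (0, 1))
    refine ⟨max B B', fun x c d hS => TaylorBdd.succ (fun y hy =>
      hasDerivWithinAt_slice_snd (hF.differentiableOn (by norm_cast)) hS hy)
      (fun y hy => (hB _ (hS y hy)).trans (le_max_left _ _))
      ((hB' x c d hS).mono (le_max_right _ _) subset_rfl)⟩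

/-- Here the last order comes from the Lipschitz condition on the q-th slice derivative. The set `A`
lists the slices as triples (x, c, d); c < d is needed for derivatives within [c, d] to be unique.
-/
theorem exists_taylorBdd_slice_of_lipschitz {E : Set (ℝ × ℝ)} (hE : IsCompact E)
    (hE' : UniqueDiffOn ℝ E) {q : ℕ} {F : ℝ × ℝ → ℝ} (hF : ContDiffOn ℝ q F E) (Λ : ℝ)
    (A : Set (ℝ × ℝ × ℝ)) (hA : ∀ s ∈ A, s.2.1 < s.2.2)
    (hAE : ∀ s ∈ A, ∀ y ∈ Set.Icc s.2.1 s.2.2, (s.1, y) ∈ E)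
    (hΛ : ∀ s ∈ A, ∀ y₁ ∈ Set.Icc s.2.1 s.2.2, ∀ y₂ ∈ Set.Icc s.2.1 s.2.2,
      |iteratedDerivWithin q (fun y => F (s.1, y)) (Set.Icc s.2.1 s.2.2) y₁
        - iteratedDerivWithin q (fun y => F (s.1, y)) (Set.Icc s.2.1 s.2.2) y₂| ≤ Λ * |y₁ - y₂|) :
    ∃ B, ∀ s ∈ A, TaylorBdd (q + 1) B (Set.Icc s.2.1 s.2.2) (fun y => F (s.1, y)) := by
  induction q generalizing F with
  | zero =>
    obtain ⟨B, hB⟩ := hE.exists_bound_of_continuousOn hF.continuousOn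
    refine ⟨max B Λ, fun s hs => TaylorBdd.one_of_lipschitz
      (fun y hy => (hB _ (hAE s hs y hy)).trans (le_max_left _ _)) fun y₁ h₁ y₂ h₂ => ?_⟩
    have := hΛ s hs y₁ h₁ y₂ h₂
    simp only [iteratedDerivWithin_zero] at this
    refine this.trans ?_
    gcongr
    exact le_max_right _ _
  | succ q ih =>
    obtain ⟨B, hB⟩ := hE.exists_bound_of_continuousOn hF.continuousOn
    have hder : ∀ s ∈ A, ∀ y ∈ Set.Icc s.2.1 s.2.2, HasDerivWithinAt (fun y => F (s.1, y))
        (fderivWithin ℝ F E (s.1, y) (0, 1)) (Set.Icc s.2.1 s.2.2) y := fun s hs y hy =>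
      hasDerivWithinAt_slice_snd (hF.differentiableOn (by norm_cast)) (hAE s hs) hy
    obtain ⟨B', hB'⟩ := ih (hF.fderivWithin_apply_const hE' (0, 1)) fun s hs y₁ h₁ y₂ h₂ => by
      have h3 := hΛ s hs y₁ h₁ y₂ h₂
      rw [iteratedDerivWithin_succ'] at h3
      -- The slice derivative is the partial derivative within E, so the Lipschitz hypothesis passes
      -- to ∂_y F with q lowered by one.
      have h4 : Set.EqOn (derivWithin (fun y => F (s.1, y)) (Set.Icc s.2.1 s.2.2))
          (fun y => fderivWithin ℝ F E (s.1, y) (0, 1)) (Set.Icc s.2.1 s.2.2) := fun y hy =>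
        (hder s hs y hy).derivWithin (uniqueDiffOn_Icc (hA s hs) y hy)
      rwa [iteratedDerivWithin_congr h4 h₁, iteratedDerivWithin_congr h4 h₂] at h3
    exact ⟨max B B', fun s hs => TaylorBdd.succ (hder s hs)
      (fun y hy => (hB _ (hAE s hs y hy)).trans (le_max_left _ _))
      ((hB' s hs).mono (le_max_right _ _) subset_rfl)⟩

theorem MemHoelderLip.exists_taylorBdd {q : ℕ} {Λ a b : ℝ} {u : ℝ → ℝ} (hab : a < b)
    (h : MemHoelderLip q Λ a b u) : ∃ B, TaylorBdd (q + 1) B (Set.Icc a b) u := by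
  obtain ⟨B, hB⟩ := exists_taylorBdd_slice_of_lipschitz (E := Set.Icc a b ×ˢ Set.Icc a b)
    (isCompact_Icc.prod isCompact_Icc) ((uniqueDiffOn_Icc hab).prod (uniqueDiffOn_Icc hab))
    (F := fun z => u z.2) (q := q) (h.1.comp contDiffOn_snd fun z hz => hz.2) Λ {(a, a, b)}
    (by simpa using hab) (by rintro s rfl y hy; exact ⟨⟨le_rfl, hab.le⟩, hy⟩)
    (by rintro s rfl; exact h.2)
  exact ⟨B, hB _ rfl⟩

section kernelDomain

variable {a b : ℝ} {m Nmin : ℕ}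

theorem mem_kernelDomain_of_le {x y : ℝ} (h1 : a ≤ y) (h2 : y ≤ x) (h3 : x ≤ b) :
    (x, y) ∈ kernelDomain a b m Nmin := Or.inl ⟨h1, h2, h3⟩

theorem stepSize_pos {N : ℕ} (hab : a < b) (hN : 1 ≤ N) : 0 < stepSize a b N :=
  div_pos (sub_pos.2 hab) (by exact_mod_cast hN)

theorem mul_stepSize {N : ℕ} (hN : 1 ≤ N) : (N : ℝ) * stepSize a b N = b - a :=
  mul_div_cancel₀ _ (by positivity)

theorem isCompact_kernelDomain : IsCompact (kernelDomain a b m Nmin) := by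
  have h : kernelDomain a b m Nmin = ((Set.Icc a b ×ˢ Set.Icc a b) ∩ {q : ℝ × ℝ | q.2 ≤ q.1})
      ∪ (Set.Icc a (a + m * stepSize a b Nmin) ×ˢ Set.Icc a (a + m * stepSize a b Nmin)) := by
    ext q
    simp only [kernelDomain, Set.mem_ofPred_eq, Set.mem_union, Set.mem_inter_iff, Set.mem_prod,
      Set.mem_Icc]
    constructor
    · rintro (⟨h1, h2, h3⟩ | h)
      · exact Or.inl ⟨⟨⟨h1.trans h2, h3⟩, h1, h2.trans h3⟩, h2⟩
      · exact Or.inr h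
    · rintro (⟨⟨⟨h1, h2⟩, h3, h4⟩, h5⟩ | h)
      · exact Or.inl ⟨h3, h5, h2⟩
      · exact Or.inr h
  rw [h]
  exact ((isCompact_Icc.prod isCompact_Icc).inter_right
    (isClosed_le continuous_snd continuous_fst)).union (isCompact_Icc.prod isCompact_Icc)

/-- Each of the two pieces, triangle and square, has unique derivatives by itself, and enlarging a
set preserves this at its points. -/
theorem uniqueDiffOn_kernelDomain (hab : a < b) (hm : 1 ≤ m) (hmN : m ≤ Nmin) :
    UniqueDiffOn ℝ (kernelDomain a b m Nmin) := by
  rintro q (hq | hq)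
  · have hconv : Convex ℝ {q : ℝ × ℝ | a ≤ q.2 ∧ q.2 ≤ q.1 ∧ q.1 ≤ b} := by
      rintro ⟨x, y⟩ ⟨h1, h2, h3⟩ ⟨x', y'⟩ ⟨h1', h2', h3'⟩ s t hs ht hst
      simp only [Prod.smul_mk, Prod.mk_add_mk, smul_eq_mul, Set.mem_ofPred_eq] at *
      have ha : a = s * a + t * a := by rw [← add_mul, hst, one_mul]
      have hb : b = s * b + t * b := by rw [← add_mul, hst, one_mul]
      refine ⟨?_, by gcongr, ?_⟩
      · rw [ha]; gcongr
      · rw [hb]; gcongr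
    have hint : (interior {q : ℝ × ℝ | a ≤ q.2 ∧ q.2 ≤ q.1 ∧ q.1 ≤ b}).Nonempty := by
      have ho : IsOpen {q : ℝ × ℝ | a < q.2 ∧ q.2 < q.1 ∧ q.1 < b} :=
        (isOpen_lt continuous_const continuous_snd).inter
          ((isOpen_lt continuous_snd continuous_fst).inter
            (isOpen_lt continuous_fst continuous_const))
      have hsub : {q : ℝ × ℝ | a < q.2 ∧ q.2 < q.1 ∧ q.1 < b}
          ⊆ {q : ℝ × ℝ | a ≤ q.2 ∧ q.2 ≤ q.1 ∧ q.1 ≤ b} :=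
        fun q hq => ⟨hq.1.le, hq.2.1.le, hq.2.2.le⟩
      have hmem : (a + 2 * (b - a) / 3, a + (b - a) / 3)
          ∈ {q : ℝ × ℝ | a < q.2 ∧ q.2 < q.1 ∧ q.1 < b} := by
        simp only [Set.mem_ofPred_eq]
        refine ⟨?_, ?_, ?_⟩ <;> linarith
      exact ⟨_, interior_maximal hsub ho hmem⟩
    exact (uniqueDiffOn_convex hconv hint q hq).mono fun z hz => Or.inl hz
  · have hpos := stepSize_pos hab (hm.trans hmN)
    have h1 : a < a + m * stepSize a b Nmin := by
      have : (0 : ℝ) < m := by exact_mod_cast hm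
      have := mul_pos this hpos
      linarith
    exact ((uniqueDiffOn_Icc h1).prod (uniqueDiffOn_Icc h1) q hq).mono fun z hz => Or.inr hz

variable {k : ℝ → ℝ → ℝ} {u : ℝ → ℝ} {p : ℕ}

/-- One constant serves all rows. In the second part x = a is left out, because the slice [a, a] is
degenerate. -/
theorem exists_taylorBdd_kernel_mul (hab : a < b) (hm : 1 ≤ m) (hmN : m ≤ Nmin) (hp : 1 ≤ p)
    (hu : ∃ Lu, MemHoelderLip (p - 1) Lu a b u)
    (hk : ContDiffOn ℝ p (Function.uncurry k) (kernelDomain a b m Nmin))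
    (hkx : ∃ Lk, ∀ x ∈ Set.Icc a b,
      MemHoelderLip (p - 1) Lk a x (kernelDerivFst (kernelDomain a b m Nmin) k x)) :
    ∃ B, (∀ x d, d ≤ b → (∀ y ∈ Set.Icc a d, (x, y) ∈ kernelDomain a b m Nmin) →
        TaylorBdd p B (Set.Icc a d) (fun y => k x y * u y)) ∧
      (∀ x ∈ Set.Ioc a b, TaylorBdd p B (Set.Icc a x)
        (fun y => kernelDerivFst (kernelDomain a b m Nmin) k x y * u y)) := by
  have hE := isCompact_kernelDomain (a := a) (b := b) (m := m) (Nmin := Nmin)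
  have hE' := uniqueDiffOn_kernelDomain hab hm hmN
  obtain ⟨Lu, hLu⟩ := hu
  obtain ⟨Lk, hLk⟩ := hkx
  obtain ⟨q, rfl⟩ : ∃ q, p = q + 1 := ⟨p - 1, by omega⟩
  rw [Nat.add_sub_cancel] at hLu hLk
  obtain ⟨B₁, h₁⟩ := hLu.exists_taylorBdd hab
  obtain ⟨B₂, h₂⟩ := exists_taylorBdd_slice hE hE' hk
  obtain ⟨B₃, h₃⟩ := exists_taylorBdd_slice_of_lipschitz hE hE'
    (hk.fderivWithin_apply_const hE' (1, 0)) Lk {s | s.2.1 = a ∧ s.2.2 = s.1 ∧ s.1 ∈ Set.Ioc a b}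
    (fun s hs => by rw [hs.1, hs.2.1]; exact hs.2.2.1)
    (fun s hs y hy => by
      rw [hs.1, hs.2.1] at hy
      exact mem_kernelDomain_of_le hy.1 hy.2 hs.2.2.2)
    (fun s hs => by
      rw [hs.1, hs.2.1]
      exact (hLk s.1 ⟨hs.2.2.1.le, hs.2.2.2⟩).2)
  set D := max 1 (b - a)
  have hdiam : ∀ d ≤ b, ∀ y ∈ Set.Icc a d, ∀ y₀ ∈ Set.Icc a d, |y - y₀| ≤ D := by
    intro d hd y hy y₀ hy₀
    refine le_trans ?_ (le_max_right _ _)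
    rw [abs_le]
    constructor <;> linarith [hy.1, hy.2, hy₀.1, hy₀.2]
  refine ⟨max (B₂ * B₁ * (1 + (q + 1 : ℕ) * D ^ (q + 1) + (q + 1 : ℕ) ^ 2 * D ^ (2 * (q + 1))))
    (B₃ * B₁ * (1 + (q + 1 : ℕ) * D ^ (q + 1) + (q + 1 : ℕ) ^ 2 * D ^ (2 * (q + 1)))), ?_, ?_⟩
  · intro x d hd hS
    exact ((h₂ x a d hS).mul (by omega) (le_max_left _ _) (hdiam d hd)
      (h₁.mono le_rfl (Set.Icc_subset_Icc_right hd))).mono (le_max_left _ _) subset_rfl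
  · intro x hx
    exact ((h₃ (x, a, x) ⟨rfl, rfl, hx⟩).mul (by omega) (le_max_left _ _) (hdiam x hx.2)
      (h₁.mono le_rfl (Set.Icc_subset_Icc_right hx.2))).mono (le_max_right _ _) subset_rfl

end kernelDomain

/-! ### Dependence of the quadrature error on the kernel row -/

namespace MultistepMethod

variable {m : ℕ} {M : MultistepMethod m}

variable (M) in
theorem quad_eq_sum_range_succ {t : ℕ} (ht : m ≤ t) (ψ : ℕ → ℝ) :
    M.quad t ψ = ∑ s ∈ Finset.range (t + 1), M.weight t s * ψ s := by
  symm
  have := M.one_le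
  refine Finset.sum_subset (Finset.range_mono (by omega)) fun s _ hs => ?_
  rw [Finset.mem_range, not_lt] at hs
  rw [weight, if_neg (by omega), if_neg (by omega), zero_mul]

/-- Differentiating under the integral, the x-derivative of the quadrature error of f(x, ·) is the
quadrature error of ∂_x f(x, ·); then the mean value theorem applies. -/
theorem abs_quadErr_sub_le {p t : ℕ} {a η B x₁ x₂ C : ℝ} {f f' : ℝ → ℝ → ℝ} (hp : 1 ≤ p)
    (hη : 0 ≤ η) (ht : m ≤ t) (hx : x₁ ≤ x₂)
    (hf : ∀ x ∈ Set.Icc x₁ x₂, TaylorBdd p B (Set.Icc a (a + t * η)) (f x))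
    (hf' : ∀ x ∈ Set.Icc x₁ x₂, TaylorBdd p B (Set.Icc a (a + t * η)) (f' x))
    (hder : ∀ y ∈ Set.Icc a (a + t * η), ∀ x ∈ Set.Icc x₁ x₂,
      HasDerivWithinAt (fun x => f x y) (f' x y) (Set.Icc x₁ x₂) x)
    (hC : ∀ x ∈ Set.Icc x₁ x₂, |M.quadErr (f' x) a η t| ≤ C) :
    |M.quadErr (f x₂) a η t - M.quadErr (f x₁) a η t| ≤ C * (x₂ - x₁) := by
  rcases hx.eq_or_lt with rfl | hlt
  · simp
  have htη : (0 : ℝ) ≤ t * η := by positivity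
  have hle : a ≤ a + t * η := by linarith
  have hIoc : Set.uIoc a (a + t * η) ⊆ Set.Icc a (a + t * η) := by
    rw [Set.uIoc_of_le hle]; exact Set.Ioc_subset_Icc_self
  have hnode : ∀ s ∈ Finset.range (t + 1), a + s * η ∈ Set.Icc a (a + t * η) := by
    intro s hs
    have h1 : (s : ℝ) ≤ t := by exact_mod_cast Nat.lt_succ_iff.1 (Finset.mem_range.1 hs)
    have h2 : (0 : ℝ) ≤ s * η := by positivity
    exact ⟨by linarith, by gcongr⟩
  have hint : ∀ g, TaylorBdd p B (Set.Icc a (a + t * η)) g →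
      IntervalIntegrable g MeasureTheory.volume a (a + t * η) := by
    intro g hg
    refine ContinuousOn.intervalIntegrable ?_
    rw [Set.uIcc_of_le hle]
    exact hg.continuousOn hp
  have hmeas : ∀ g, TaylorBdd p B (Set.Icc a (a + t * η)) g → MeasureTheory.AEStronglyMeasurable g
      (MeasureTheory.volume.restrict (Set.uIoc a (a + t * η))) := fun g hg =>
    (hint g hg).def'.aestronglyMeasurable
  have heq : ∀ g, M.quadErr g a η t = (∫ y in a..(a + t * η), g y)
      - η * ∑ s ∈ Finset.range (t + 1), M.weight t s * g (a + s * η) := by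
    intro g
    rw [quadErr, quad_eq_sum_range_succ M ht]
  have hcont : ContinuousOn (fun x => M.quadErr (f x) a η t) (Set.Icc x₁ x₂) := by
    simp only [heq]
    refine ContinuousOn.sub (fun x hx => ?_) ?_
    · refine intervalIntegral.continuousWithinAt_of_dominated_interval (bound := fun _ => B)
        ?_ ?_ intervalIntegrable_const ?_
      · filter_upwards [self_mem_nhdsWithin] with z hz using hmeas _ (hf z hz)
      · filter_upwards [self_mem_nhdsWithin] with z hz
        exact Eventually.of_forall fun y hy => (hf z hz).abs_le hp (hIoc hy)
      · exact Eventually.of_forall fun y hy => (hder y (hIoc hy) x hx).continuousWithinAt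
    · refine continuousOn_const.mul (continuousOn_finsetSum _ fun s hs => continuousOn_const.mul ?_)
      exact fun x hx => (hder _ (hnode s hs) x hx).continuousWithinAt
  have hderiv : ∀ x ∈ Set.Ioo x₁ x₂,
      HasDerivAt (fun x => M.quadErr (f x) a η t) (M.quadErr (f' x) a η t) x := by
    intro x hx
    have hnhds : ∀ z ∈ Set.Ioo x₁ x₂, Set.Icc x₁ x₂ ∈ 𝓝 z := fun z hz =>
      Icc_mem_nhds hz.1 hz.2
    simp only [heq]
    refine HasDerivAt.sub ?_ ?_
    · refine (intervalIntegral.hasDerivAt_integral_of_dominated_loc_of_deriv_le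
        (s := Set.Ioo x₁ x₂) (bound := fun _ => B) (Ioo_mem_nhds hx.1 hx.2) ?_
        (hint _ (hf x (Set.Ioo_subset_Icc_self hx)))
        (hmeas _ (hf' x (Set.Ioo_subset_Icc_self hx))) ?_ intervalIntegrable_const ?_).2
      · filter_upwards [hnhds x hx] with z hz using hmeas _ (hf z hz)
      · exact Eventually.of_forall fun y hy z hz =>
          (hf' z (Set.Ioo_subset_Icc_self hz)).abs_le hp (hIoc hy)
      · exact Eventually.of_forall fun y hy z hz =>
          (hder y (hIoc hy) z (Set.Ioo_subset_Icc_self hz)).hasDerivAt (hnhds z hz)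
    · refine HasDerivAt.const_mul _ (HasDerivAt.fun_sum fun s hs => HasDerivAt.const_mul _ ?_)
      exact (hder _ (hnode s hs) x (Set.Ioo_subset_Icc_self hx)).hasDerivAt (hnhds x hx)
  obtain ⟨c, hc, hslope⟩ := exists_hasDerivAt_eq_slope (fun x => M.quadErr (f x) a η t)
    (fun x => M.quadErr (f' x) a η t) hlt hcont hderiv
  have h1 : M.quadErr (f x₂) a η t - M.quadErr (f x₁) a η t
      = M.quadErr (f' c) a η t * (x₂ - x₁) := by
    rw [hslope, div_mul_cancel₀ _ (sub_ne_zero.2 hlt.ne')]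
  rw [h1, abs_mul, abs_of_pos (sub_pos.2 hlt)]
  gcongr
  exact hC c (Set.Ioo_subset_Icc_self hc)

end MultistepMethod

/-! ### The starting system -/

section matMaxNorm

variable {m : ℕ} (A : Matrix (Fin m) (Fin m) ℝ)

theorem norm_mulVec_le_matMaxNorm (v : Fin m → ℝ) : ‖A.mulVec v‖ ≤ matMaxNorm A * ‖v‖ :=
  Matrix.linfty_opNorm_mulVec A v

theorem matMaxNorm_nonneg : 0 ≤ matMaxNorm A := by
  let _ := Matrix.linftyOpNormedAddCommGroup (m := Fin m) (n := Fin m) (α := ℝ)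
  exact norm_nonneg A

theorem sum_abs_le_matMaxNorm (i : Fin m) : ∑ j, |A i j| ≤ matMaxNorm A := by
  let _ := Matrix.linftyOpNormedAddCommGroup (m := Fin m) (n := Fin m) (α := ℝ)
  have h1 : matMaxNorm A = ((Finset.univ.sup fun i => ∑ j, ‖A i j‖₊ : NNReal) : ℝ) :=
    Matrix.linfty_opNorm_def A
  have h2 : (∑ j, ‖A i j‖₊ : NNReal) ≤ Finset.univ.sup fun i => ∑ j, ‖A i j‖₊ :=
    Finset.le_sup (f := fun i => ∑ j, ‖A i j‖₊) (Finset.mem_univ i)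
  rw [h1]
  refine le_trans (le_of_eq ?_) (NNReal.coe_le_coe.2 h2)
  simp

/-- The moment identities ∑ s^i w_{rs} = r^(i+1)/(i+1) factor T times a Vandermonde matrix into
diagonal, Vandermonde, diagonal, all invertible. -/
theorem isUnit_det_startT (m : ℕ) : IsUnit (startT m).det := by
  have h1 : startT m * (startMatrix m).transpose
      = Matrix.diagonal (fun i : Fin m => ((i : ℕ) : ℝ) + 1)
        * Matrix.vandermonde (fun i : Fin m => ((i : ℕ) : ℝ) + 1)
        * Matrix.diagonal (fun i : Fin m => 1 / (((i : ℕ) : ℝ) + 1)) := by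
    ext i l
    have h := congrFun (startMatrix_mulVec_startVector m ((i : ℕ) + 1)) l
    rw [Matrix.mul_diagonal, Matrix.diagonal_mul, Matrix.vandermonde_apply, Matrix.mul_apply]
    simp only [Matrix.transpose_apply]
    rw [Matrix.mulVec, dotProduct] at h
    simp only [startT, Matrix.of_apply, mul_comm (startVector m _ _)]
    rw [h]
    push_cast
    ring
  have h2 := congrArg Matrix.det h1
  rw [Matrix.det_mul, Matrix.det_mul, Matrix.det_mul, Matrix.det_diagonal,
    Matrix.det_diagonal] at h2
  rw [isUnit_iff_ne_zero]
  intro h0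
  rw [h0, zero_mul] at h2
  refine absurd h2.symm (mul_ne_zero (mul_ne_zero ?_ ?_) ?_)
  · exact Finset.prod_ne_zero_iff.2 fun i _ => by positivity
  · rw [Matrix.det_vandermonde_ne_zero_iff]
    intro s t hst
    simp only [add_left_inj, Nat.cast_inj] at hst
    exact Fin.ext hst
  · exact Finset.prod_ne_zero_iff.2 fun i _ => by positivity

theorem one_le_cond_startT (hm : 1 ≤ m) :
    1 ≤ matMaxNorm (startT m) * matMaxNorm (startT m)⁻¹ := by
  have : Nonempty (Fin m) := ⟨⟨0, hm⟩⟩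
  have h1 := norm_mulVec_le_matMaxNorm (startT m) ((startT m)⁻¹.mulVec fun _ => 1)
  rw [Matrix.mulVec_mulVec, Matrix.mul_nonsing_inv _ (isUnit_det_startT m),
    Matrix.one_mulVec] at h1
  have h2 := norm_mulVec_le_matMaxNorm (startT m)⁻¹ (fun _ => 1)
  have h3 : ‖(fun _ => 1 : Fin m → ℝ)‖ = 1 := by simp
  rw [h3] at h1 h2
  have := mul_le_mul_of_nonneg_left h2 (matMaxNorm_nonneg (startT m))
  linarith

/-- The system matrix is an entrywise perturbation of T. After applying T⁻¹ the perturbation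
contributes at most L/(1+L) times the norm of `e`; absorbing it leaves 1/(1+L), which is the origin
of the factor 1 + L in C_{2a}. -/
theorem norm_le_of_start_system {L θ : ℝ} (hL : 0 ≤ L) {κ : Fin m → Fin m → ℝ}
    (hκ : ∀ i s, |κ i s - 1| ≤ θ)
    (hθ : θ * (matMaxNorm (startT m) * matMaxNorm (startT m)⁻¹) ≤ L / (1 + L)) {e d : Fin m → ℝ}
    (h : ∀ i, ∑ s, startT m i s * κ i s * e s = d i) : ‖e‖ ≤ C2a m L * ‖d‖ := by
  rcases isEmpty_or_nonempty (Fin m) with hm | hm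
  · rw [Subsingleton.elim e 0, Subsingleton.elim d 0]; simp
  have hθ0 : 0 ≤ θ := (abs_nonneg _).trans (hκ hm.some hm.some)
  set T := startT m
  set r : Fin m → ℝ := fun i => ∑ s, T i s * (κ i s - 1) * e s with hr
  have hTe : T.mulVec e = d - r := by
    funext i
    rw [Pi.sub_apply, ← h i, hr, Matrix.mulVec, dotProduct, ← Finset.sum_sub_distrib]
    exact Finset.sum_congr rfl fun s _ => by ring
  have hrb : ‖r‖ ≤ matMaxNorm T * (θ * ‖e‖) := by
    refine (pi_norm_le_iff_of_nonneg (by have := matMaxNorm_nonneg T; positivity)).2 fun i => ?_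
    calc ‖r i‖ ≤ ∑ s, |T i s| * (θ * ‖e‖) := by
          refine norm_sum_le_of_le _ fun s _ => ?_
          rw [Real.norm_eq_abs, abs_mul, abs_mul, mul_assoc]
          gcongr
          · exact hκ i s
          · exact norm_le_pi_norm e s
      _ = (∑ s, |T i s|) * (θ * ‖e‖) := (Finset.sum_mul _ _ _).symm
      _ ≤ _ := by
          gcongr
          exact sum_abs_le_matMaxNorm T i
  have he : e = T⁻¹.mulVec (d - r) := by
    rw [← hTe, Matrix.mulVec_mulVec, Matrix.nonsing_inv_mul _ (isUnit_det_startT m),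
      Matrix.one_mulVec]
  have h0 := matMaxNorm_nonneg T⁻¹
  have h1 : ‖e‖ ≤ matMaxNorm T⁻¹ * (‖d‖ + matMaxNorm T * (θ * ‖e‖)) := by
    calc ‖e‖ ≤ matMaxNorm T⁻¹ * ‖d - r‖ := by
          conv_lhs => rw [he]
          exact norm_mulVec_le_matMaxNorm _ _
      _ ≤ _ := by
          gcongr
          exact (norm_sub_le _ _).trans (by gcongr)
  have h2 : ‖e‖ ≤ matMaxNorm T⁻¹ * ‖d‖ + L / (1 + L) * ‖e‖ := by
    have := mul_le_mul_of_nonneg_right hθ (norm_nonneg e)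
    nlinarith
  have h3 : ‖e‖ / (1 + L) ≤ matMaxNorm T⁻¹ * ‖d‖ := by
    have : ‖e‖ / (1 + L) = ‖e‖ - L / (1 + L) * ‖e‖ := by field_simp; ring
    linarith
  rw [div_le_iff₀ (by positivity)] at h3
  rw [C2a]
  linarith

/-- The a priori estimate with zero right-hand side gives injectivity, hence invertibility of the
square matrix. -/
theorem exists_start_system_solution {L θ : ℝ} (hL : 0 ≤ L) {κ : Fin m → Fin m → ℝ}
    (hκ : ∀ i s, |κ i s - 1| ≤ θ)
    (hθ : θ * (matMaxNorm (startT m) * matMaxNorm (startT m)⁻¹) ≤ L / (1 + L)) (d : Fin m → ℝ) :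
    ∃ e : Fin m → ℝ, ∀ i, ∑ s, startT m i s * κ i s * e s = d i := by
  set B : Matrix (Fin m) (Fin m) ℝ := Matrix.of fun i s => startT m i s * κ i s with hB
  have hdet : IsUnit B.det := by
    rw [isUnit_iff_ne_zero]
    intro h0
    obtain ⟨e, he0, he⟩ := Matrix.exists_mulVec_eq_zero_iff.2 h0
    have := norm_le_of_start_system hL hκ hθ (e := e) (d := 0) fun i => congrFun he i
    rw [norm_zero, mul_zero] at this
    exact he0 (norm_le_zero_iff.1 this)
  refine ⟨B⁻¹.mulVec d, fun i => ?_⟩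
  have h1 : B.mulVec (B⁻¹.mulVec d) = d := by
    rw [Matrix.mulVec_mulVec, Matrix.mul_nonsing_inv _ hdet, Matrix.one_mulVec]
  exact congrFun h1 i

end matMaxNorm

/-! ### Grid geometry and admissible step sizes -/

section grid

variable {a b : ℝ} {m N Nmin n : ℕ}

theorem stepSize_anti (hab : a < b) (hNmin : 1 ≤ Nmin) (hN : Nmin ≤ N) :
    stepSize a b N ≤ stepSize a b Nmin := by
  have : (0 : ℝ) < Nmin := by exact_mod_cast hNmin
  exact div_le_div_of_nonneg_left (sub_pos.2 hab).le this (by exact_mod_cast hN)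

theorem gridPt_mem_Icc (hab : a < b) (hN : 1 ≤ N) (hn : n ≤ N) : gridPt a b N n ∈ Set.Icc a b := by
  have h0 := stepSize_pos hab hN
  have h1 := mul_stepSize (a := a) (b := b) hN
  have h2 : (n : ℝ) ≤ N := by exact_mod_cast hn
  rw [gridPt]
  constructor
  · have : (0 : ℝ) ≤ n * stepSize a b N := by positivity
    linarith
  · nlinarith

theorem gridPt_mono (hab : a < b) (hN : 1 ≤ N) {s : ℕ} (hs : s ≤ n) :
    gridPt a b N s ≤ gridPt a b N n := by
  have h0 := (stepSize_pos hab hN).le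
  rw [gridPt, gridPt]
  gcongr

theorem gridPt_sub (s : ℕ) :
    gridPt a b N n - gridPt a b N s = ((n : ℝ) - s) * stepSize a b N := by
  rw [gridPt, gridPt]; ring

theorem gridPt_mem_square (hab : a < b) (hm : 1 ≤ m) (hmN : m ≤ Nmin) (hN : Nmin ≤ N)
    (hn : n ≤ m) : gridPt a b N n ∈ Set.Icc a (a + m * stepSize a b Nmin) := by
  have h0 := stepSize_pos hab (hm.trans (hmN.trans hN))
  have h1 := stepSize_anti hab (hm.trans hmN) hN
  rw [gridPt]
  constructor
  · have : (0 : ℝ) ≤ n * stepSize a b N := by positivity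
    linarith
  · gcongr

theorem hBar_le {k : ℝ → ℝ → ℝ} {L : ℝ} : hBar m k a b Nmin L ≤ stepSize a b Nmin := by
  rw [hBar]
  split_ifs
  · exact le_rfl
  · exact min_le_right _ _

/-- The kernel conditions that the admissible step sizes guarantee on the grid. -/
theorem kernel_near_one {k : ℝ → ℝ → ℝ} {L : ℝ} (hab : a < b) (hm : 1 ≤ m) (hmN : m ≤ Nmin)
    (hN : Nmin ≤ N) (hh : stepSize a b N ≤ hBar m k a b Nmin L)
    (hdiag : ∀ x ∈ Set.Icc a b, k x x = 1) (hL : 0 ≤ L)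
    (hLip : ∀ x₁ x₂ y, (x₁, y) ∈ kernelDomain a b m Nmin → (x₂, y) ∈ kernelDomain a b m Nmin →
      |k x₁ y - k x₂ y| ≤ L * |x₁ - x₂|) :
    (∃ θ, θ * (matMaxNorm (startT m) * matMaxNorm (startT m)⁻¹) ≤ L / (1 + L) ∧
      ∀ n s, n ≤ m → s < m → |k (gridPt a b N n) (gridPt a b N s) - 1| ≤ θ) ∧
    ∀ j μ, μ ≤ m → j + μ ≤ N → 1 ≤ (1 + μ * L) * k (gridPt a b N (j + μ)) (gridPt a b N j) := by
  have hN1 : 1 ≤ N := hm.trans (hmN.trans hN)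
  have hpos := stepSize_pos hab hN1
  have hmem : ∀ n s, n ≤ m → s ≤ m →
      (gridPt a b N n, gridPt a b N s) ∈ kernelDomain a b m Nmin := fun n s hn hs =>
    Or.inr ⟨gridPt_mem_square hab hm hmN hN hn, gridPt_mem_square hab hm hmN hN hs⟩
  have hmem' : ∀ n s, n ≤ N → s ≤ n →
      (gridPt a b N n, gridPt a b N s) ∈ kernelDomain a b m Nmin := fun n s hn hs =>
    mem_kernelDomain_of_le (gridPt_mem_Icc hab hN1 (hs.trans hn)).1 (gridPt_mono hab hN1 hs)
      (gridPt_mem_Icc hab hN1 hn).2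
  by_cases hk1 : ∀ x y, (x, y) ∈ kernelDomain a b m Nmin → k x y = 1
  · refine ⟨⟨0, by rw [zero_mul]; positivity, fun n s hn hs => ?_⟩, fun j μ _ hj => ?_⟩
    · rw [hk1 _ _ (hmem n s hn hs.le), sub_self, abs_zero]
    · rw [hk1 _ _ (hmem' _ _ hj (Nat.le_add_right _ _)), mul_one]
      have : 0 ≤ μ * L := by positivity
      linarith
  · rw [hBar, if_neg hk1] at hh
    set cond := matMaxNorm (startT m) * matMaxNorm (startT m)⁻¹
    have hcond : 1 ≤ cond := one_le_cond_startT hm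
    have hm0 : (0 : ℝ) < m := by exact_mod_cast hm
    have hh' := hh.trans (min_le_left _ _)
    rw [le_div_iff₀ (by positivity)] at hh'
    have hlip : ∀ n s, n ≤ N → s ≤ N → (gridPt a b N n, gridPt a b N s) ∈ kernelDomain a b m Nmin →
        |k (gridPt a b N n) (gridPt a b N s) - 1| ≤ L * (|(n : ℝ) - s| * stepSize a b N) := by
      intro n s hn hs hns
      rw [← hdiag _ (gridPt_mem_Icc hab hN1 hs)]
      refine (hLip _ _ _ hns (hmem' s s hs le_rfl)).trans (le_of_eq ?_)
      rw [gridPt_sub, abs_mul, abs_of_pos hpos]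
    -- Starting nodes are at most m h apart, and k equals 1 on the diagonal.
    refine ⟨⟨L * (m * stepSize a b N), ?_, fun n s hn hs => ?_⟩, fun j μ hμ hj => ?_⟩
    · rw [le_div_iff₀ (by positivity)]
      have := mul_le_mul_of_nonneg_left hh' hL
      linarith
    · refine (hlip n s (by omega) (by omega) (hmem n s hn hs.le)).trans ?_
      gcongr
      have h1 : (n : ℝ) ≤ m := by exact_mod_cast hn
      have h2 : (s : ℝ) ≤ m := by exact_mod_cast hs.le
      have h3 : (0 : ℝ) ≤ n := Nat.cast_nonneg _
      have h4 : (0 : ℝ) ≤ s := Nat.cast_nonneg _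
      rw [abs_le]
      constructor <;> linarith
    · have h1 := hlip (j + μ) j hj (by omega) (hmem' _ _ hj (Nat.le_add_right _ _))
      have h2 : |((j + μ : ℕ) : ℝ) - j| = μ := by
        push_cast
        rw [add_sub_cancel_left, Nat.abs_cast]
      rw [h2] at h1
      have h3 := (abs_le.1 h1).1
      have hμm : (μ : ℝ) ≤ m := by exact_mod_cast hμ
      have hm1 : (1 : ℝ) ≤ m := by exact_mod_cast hm
      -- The condition number is at least 1, so the step size bound gives h (1 + μL) ≤ 1. Then (1 +
      -- μL)(1 - μLh) = 1 + μL (1 - h(1 + μL)) ≥ 1.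
      have h4 : stepSize a b N * (1 + μ * L) ≤ 1 := by
        calc stepSize a b N * (1 + μ * L) ≤ stepSize a b N * (m * (1 + L) * cond) := by
              gcongr
              calc 1 + μ * L ≤ m + m * L := by gcongr
                _ = m * (1 + L) * 1 := by ring
                _ ≤ _ := by gcongr
          _ ≤ 1 := hh'
      have h5 : 0 ≤ μ * L := by positivity
      nlinarith [mul_le_mul_of_nonneg_right h4 h5]

end grid

/-! ### Existence and uniqueness of the approximations -/

theorem exists_eq_of_strong_rec (F : ℕ → (ℕ → ℝ) → ℝ)
    (hF : ∀ j v w, (∀ i < j, v i = w i) → F j v = F j w) : ∃ v : ℕ → ℝ, ∀ j, v j = F j v := by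
  let v : ℕ → ℝ := fun j => Nat.strongRec (motive := fun _ => ℝ)
    (fun j ih => F j fun i => if h : i < j then ih i h else 0) j
  refine ⟨v, fun j => ?_⟩
  have h1 : v j = F j fun i => if i < j then v i else 0 := by
    change Nat.strongRec (motive := fun _ => ℝ)
      (fun j ih => F j fun i => if h : i < j then ih i h else 0) j = _
    rw [Nat.strongRec_eq]
    simp only [dite_eq_ite]
    rfl
  rw [h1]
  exact hF j _ _ fun i hi => if_pos hi

namespace MultistepMethod

variable {m : ℕ} {M : MultistepMethod m} {a b L : ℝ} {N : ℕ} {k : ℝ → ℝ → ℝ}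

theorem sum_startWeight_eq {n : ℕ} (hn : 1 ≤ n) (hnm : n ≤ m) (κ v : ℕ → ℝ) :
    ∑ s ∈ Finset.range m, startWeight m n s * κ s * v s
      = ∑ s : Fin m, startT m ⟨n - 1, by omega⟩ s * κ s * v s := by
  rw [Finset.sum_range]
  refine Finset.sum_congr rfl fun s _ => ?_
  have : n - 1 + 1 = n := by omega
  simp [startWeight, startT, this]

theorem abs_le_of_start_system {θ h D : ℝ} (hL : 0 ≤ L) (hh : 0 < h) {κ : ℕ → ℕ → ℝ}
    (hκ : ∀ n s, n ≤ m → s < m → |κ n s - 1| ≤ θ)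
    (hθ : θ * (matMaxNorm (startT m) * matMaxNorm (startT m)⁻¹) ≤ L / (1 + L)) {e d : ℕ → ℝ}
    (hD : ∀ n, 1 ≤ n → n ≤ m → |d n| ≤ D)
    (hsys : ∀ n, 1 ≤ n → n ≤ m →
      h * ∑ s ∈ Finset.range m, startWeight m n s * κ n s * e s = d n) {s : ℕ} (hs : s < m) :
    |e s| ≤ C2a m L * (D / h) := by
  have h1 := norm_le_of_start_system (m := m) hL (κ := fun i s => κ (i + 1) s)
    (fun i s => hκ _ _ i.2 s.2) hθ (e := fun s => e s) (d := fun i => d (i + 1) / h) fun i => by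
      have h2 := hsys (i + 1) (by omega) i.2
      rw [sum_startWeight_eq (by omega) i.2] at h2
      rw [← h2, mul_div_cancel_left₀ _ hh.ne']
      rfl
  have h3 : ‖(fun s : Fin m => e s)‖ ≤ C2a m L * (D / h) := by
    refine h1.trans ?_
    have h4 : 0 ≤ C2a m L := mul_nonneg (by positivity) (matMaxNorm_nonneg _)
    have hD0 : 0 ≤ D := (abs_nonneg _).trans (hD 1 le_rfl (by omega))
    gcongr
    refine (pi_norm_le_iff_of_nonneg (by positivity)).2 fun i => ?_
    rw [Real.norm_eq_abs, abs_div, abs_of_pos hh]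
    gcongr
    exact hD _ (by omega) i.2
  exact (norm_le_pi_norm (fun s : Fin m => e s) ⟨s, hs⟩).trans h3

/-- After the starting system the equations are lower triangular: in row j + μ the newest unknown
v_j has coefficient γ_0 k(x_{j+μ}, x_j), which is nonzero. -/
theorem exists_unique_approximation {θ : ℝ} (hL : 0 ≤ L) (hh : 0 < stepSize a b N)
    (hκ : ∀ n s, n ≤ m → s < m → |k (gridPt a b N n) (gridPt a b N s) - 1| ≤ θ)
    (hθ : θ * (matMaxNorm (startT m) * matMaxNorm (startT m)⁻¹) ≤ L / (1 + L))
    (hk : ∀ j, j + M.mu ≤ N → k (gridPt a b N (j + M.mu)) (gridPt a b N j) ≠ 0) (g : ℕ → ℝ) :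
    (∃ v, IsApproximation M k a b N g v) ∧
      ∀ v w, IsApproximation M k a b N g v → IsApproximation M k a b N g w →
        ∀ n ≤ N - M.mu, v n = w n := by
  simp only [isApproximation_iff]
  set x := gridPt a b N with hx
  set h := stepSize a b N
  have hsplit : ∀ (v : ℕ → ℝ) j, m ≤ j → M.quad (j + M.mu) (fun s => k (x (j + M.mu)) (x s) * v s)
      = ∑ s ∈ Finset.range m, M.quadWeight s (j + M.mu) * (k (x (j + M.mu)) (x s) * v s)
        + (∑ s ∈ Finset.range j, M.gamma (j - s)
            * (if m ≤ s then k (x (j + M.mu)) (x s) * v s else 0)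
          + M.gamma 0 * k (x (j + M.mu)) (x j) * v j) := by
    intro v j hj
    rw [M.quad_split _ (by omega), Nat.add_sub_cancel, Finset.sum_range_succ, Nat.sub_self,
      if_pos hj]
    ring
  constructor
  · obtain ⟨e, he⟩ := exists_start_system_solution (m := m) hL
      (κ := fun i s => k (x (i + 1)) (x s)) (fun i s => hκ _ _ i.2 s.2) hθ
      (fun i => g (i + 1) / h)
    obtain ⟨v, hv⟩ := exists_eq_of_strong_rec (fun j w => if hj : j < m then e ⟨j, hj⟩ else
      (g (j + M.mu) / h
        - ∑ s ∈ Finset.range m, M.quadWeight s (j + M.mu) * (k (x (j + M.mu)) (x s) * w s)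
        - ∑ s ∈ Finset.range j, M.gamma (j - s)
            * (if m ≤ s then k (x (j + M.mu)) (x s) * w s else 0))
        / (M.gamma 0 * k (x (j + M.mu)) (x j))) (by
        intro j w w' hw
        split_ifs with hj
        · rfl
        · congr 2
          · congr 1
            refine Finset.sum_congr rfl fun s hs => ?_
            rw [hw s (by simp at hs; omega)]
          · refine Finset.sum_congr rfl fun s hs => ?_
            rw [hw s (by simpa using hs)])
    refine ⟨v, fun n hn hnm => ?_, fun n hn hnN => ?_⟩
    · rw [sum_startWeight_eq hn hnm]
      have h1 := he ⟨n - 1, by omega⟩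
      have h2 : n - 1 + 1 = n := by omega
      simp only [h2] at h1
      rw [← mul_div_cancel₀ (g n) hh.ne', ← h1]
      congr 1
      refine Finset.sum_congr rfl fun s _ => ?_
      rw [hv s, dif_pos s.2]
    · obtain ⟨j, rfl⟩ : ∃ j, n = j + M.mu := ⟨n - M.mu, by omega⟩
      rw [hsplit v j (by omega)]
      have h1 := hv j
      rw [dif_neg (by omega), eq_div_iff (mul_ne_zero M.gamma_zero_ne (hk j hnN))] at h1
      rw [← mul_div_cancel₀ (g (j + M.mu)) hh.ne']
      congr 1
      linarith
  · intro v w hv hw n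
    induction n using Nat.strong_induction_on with
    | _ n ih =>
      intro hn
      by_cases hnm : n < m
      · have h1 := abs_le_of_start_system (m := m) (D := 0) hL hh
          (κ := fun n s => k (x n) (x s)) hκ hθ
          (e := fun s => v s - w s) (d := fun _ => 0) (fun n _ _ => by simp)
          (fun n h1 h2 => by
            have h3 := hv.1 n h1 h2
            rw [← hw.1 n h1 h2] at h3
            simp only [mul_sub, Finset.sum_sub_distrib]
            linarith) hnm
        rw [zero_div, mul_zero] at h1
        exact sub_eq_zero.1 (abs_nonpos_iff.1 h1)
      -- The subtraction in N - μ is truncated, but n ≥ m ≥ 1 and n ≤ N - μ exclude the case N ≤ μ.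
      · have hnN : n + M.mu ≤ N := by
          have := M.one_le
          omega
        have h1 := hv.2 (n + M.mu) (by omega) hnN
        rw [← hw.2 (n + M.mu) (by omega) hnN, hsplit v n (by omega), hsplit w n (by omega)] at h1
        have h2 := mul_left_cancel₀ hh.ne' h1
        have h3 : ∀ s < n, v s = w s := fun s hs => ih s hs (by omega)
        rw [Finset.sum_congr rfl fun s hs => by rw [h3 s (by simp at hs; omega)],
          add_right_inj, Finset.sum_congr rfl fun s hs => by rw [h3 s (by simpa using hs)],
          add_right_inj] at h2
        exact mul_left_cancel₀ (mul_ne_zero M.gamma_zero_ne (hk n hnN)) h2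

end MultistepMethod

/-! ### Stability by filtering with 1/γ -/

/-- Discrete Gronwall inequality: inserting the bound for earlier indices produces a geometric sum
that reproduces the bound for j. -/
theorem le_mul_pow_of_le_add_sum {A Q : ℝ} (hQ : 0 ≤ Q) {x : ℕ → ℝ} {J : ℕ}
    (h : ∀ j ≤ J, x j ≤ A + Q * ∑ s ∈ Finset.range j, x s) : ∀ j ≤ J, x j ≤ A * (1 + Q) ^ j := by
  intro j
  induction j using Nat.strong_induction_on with
  | _ j ih =>
    intro hj
    calc x j ≤ A + Q * ∑ s ∈ Finset.range j, x s := h j hj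
      _ ≤ A + Q * ∑ s ∈ Finset.range j, A * (1 + Q) ^ s := by
          gcongr with s hs
          have := Finset.mem_range.1 hs
          exact ih s this (by omega)
      _ = A + A * ((∑ s ∈ Finset.range j, (1 + Q) ^ s) * (1 + Q - 1)) := by
          rw [← Finset.mul_sum]; ring
      _ = A * (1 + Q) ^ j := by rw [geom_sum_mul]; ring

namespace MultistepMethod

variable {m : ℕ} {M : MultistepMethod m}

theorem SigmaSchur.sum_gammaInv_le (h : M.SigmaSchur) (j : ℕ) :
    ∑ r ∈ Finset.range (j + 1), |M.gammaInv (j - r)| ≤ ∑' s, |M.gammaInv s| := by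
  have h1 := Finset.sum_range_reflect (fun i => |M.gammaInv i|) (j + 1)
  simp only [Nat.add_sub_cancel] at h1
  rw [h1]
  exact h.summable_gammaInv.sum_le_tsum _ fun _ _ => abs_nonneg _

theorem SigmaSchur.sum_gammaInv_mul_le (h : M.SigmaSchur) (j : ℕ) :
    ∑ r ∈ Finset.range (j + 1), |M.gammaInv (j - r)| * ((j - r : ℕ) : ℝ)
      ≤ ∑' s : ℕ, |M.gammaInv s| * (s : ℝ) := by
  have h1 := Finset.sum_range_reflect (fun i : ℕ => |M.gammaInv i| * (i : ℝ)) (j + 1)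
  simp only [Nat.add_sub_cancel] at h1
  rw [h1]
  exact h.summable_gammaInv_mul.sum_le_tsum _ fun _ _ => by positivity

theorem sum_gammaInv_mul_eq_coeff (f : ℕ → ℝ) (j : ℕ) :
    ∑ r ∈ Finset.range (j + 1), M.gammaInv (j - r) * f r
      = PowerSeries.coeff j (PowerSeries.mk f * M.gammaSeries⁻¹) := by
  rw [PowerSeries.coeff_mul, Finset.Nat.sum_antidiagonal_eq_sum_range_succ_mk]
  exact Finset.sum_congr rfl fun r _ => by rw [PowerSeries.coeff_mk, gammaInv, mul_comm]

theorem sum_gammaInv_mul_sum_gamma (z : ℕ → ℝ) (j : ℕ) :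
    ∑ r ∈ Finset.range (j + 1), M.gammaInv (j - r)
      * ∑ s ∈ Finset.range (r + 1), M.gamma (r - s) * z s = z j := by
  have h1 : PowerSeries.mk (fun r => ∑ s ∈ Finset.range (r + 1), M.gamma (r - s) * z s)
      = PowerSeries.mk z * M.gammaSeries := by
    ext r
    rw [PowerSeries.coeff_mk, PowerSeries.coeff_mul,
      Finset.Nat.sum_antidiagonal_eq_sum_range_succ_mk]
    exact Finset.sum_congr rfl fun s _ => by rw [PowerSeries.coeff_mk, gamma, mul_comm]
  rw [sum_gammaInv_mul_eq_coeff, h1, mul_assoc,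
    PowerSeries.mul_inv_cancel _ M.constantCoeff_gammaSeries, mul_one, PowerSeries.coeff_mk]

theorem C3_nonneg : 0 ≤ M.C3 :=
  mul_nonneg (Real.iSup_nonneg fun _ => abs_nonneg _) (tsum_nonneg fun _ => by positivity)

theorem quadWeightBound_nonneg : 0 ≤ M.quadWeightBound :=
  Real.iSup_nonneg fun _ => Finset.sum_nonneg fun _ _ => abs_nonneg _

/-- With the row frozen at j, the filter 1/γ would recover κ_{jj} e_j exactly. Replacing row r by
row j costs L (j - r) h, and the weights (j - r) |γ_{j-r}^{(-1)}| are summable; this explains C₃. -/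
theorem abs_diag_sub_le (hnull : M.NullStable) (hsigma : M.SigmaSchur) {L h : ℝ} (hL : 0 ≤ L)
    (hh : 0 ≤ h) {κ : ℕ → ℕ → ℝ} {e : ℕ → ℝ} {j : ℕ}
    (hκ : ∀ s r, s ≤ r → r ≤ j → |κ r s - κ j s| ≤ L * (((j - r : ℕ) : ℝ) * h)) :
    |κ j j * e j - ∑ r ∈ Finset.range (j + 1), M.gammaInv (j - r)
        * ∑ s ∈ Finset.range (r + 1), M.gamma (r - s) * (κ r s * e s)|
      ≤ M.C3 * L * h * ∑ s ∈ Finset.range j, |e s| := by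
  set S := ∑ s ∈ Finset.range j, |e s|
  set G := ⨆ r, |M.gamma r| with hG
  have hγ : ∀ r, |M.gamma r| ≤ G := fun r => le_ciSup hnull.bddAbove_gamma r
  have hG0 : 0 ≤ G := (abs_nonneg _).trans (hγ 0)
  have hS0 : 0 ≤ S := Finset.sum_nonneg fun _ _ => abs_nonneg _
  have h1 := sum_gammaInv_mul_sum_gamma (M := M) (fun s => κ j s * e s) j
  rw [← h1, ← Finset.sum_sub_distrib]
  calc _ ≤ ∑ r ∈ Finset.range (j + 1),
        |M.gammaInv (j - r)| * ((j - r : ℕ) : ℝ) * (G * L * h * S) := by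
        refine (Finset.abs_sum_le_sum_abs _ _).trans (Finset.sum_le_sum fun r hr => ?_)
        rw [Finset.mem_range, Nat.lt_succ_iff] at hr
        rw [← mul_sub, ← Finset.sum_sub_distrib, abs_mul, mul_assoc]
        gcongr
        have h2 : ∀ s ∈ Finset.range (r + 1),
            |M.gamma (r - s) * (κ j s * e s) - M.gamma (r - s) * (κ r s * e s)|
              ≤ ((j - r : ℕ) : ℝ) * (G * L * h) * |e s| := by
          intro s hs
          rw [Finset.mem_range, Nat.lt_succ_iff] at hs
          rw [← mul_sub, ← sub_mul, abs_mul, abs_mul, abs_sub_comm]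
          calc _ ≤ G * (L * (((j - r : ℕ) : ℝ) * h) * |e s|) := by
                gcongr
                · exact hγ _
                · exact hκ s r hs hr
            _ = _ := by ring
        refine (Finset.abs_sum_le_sum_abs _ _).trans ((Finset.sum_le_sum h2).trans ?_)
        rw [← Finset.mul_sum]
        -- For r = j the factor j - r vanishes, so e_j itself does not occur on the right and no
        -- smallness of h is needed.
        rcases hr.eq_or_lt with rfl | hlt
        · simp
        · have hle : ∑ s ∈ Finset.range (r + 1), |e s| ≤ S :=
            Finset.sum_le_sum_of_subset_of_nonneg (Finset.range_mono (by omega))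
              fun _ _ _ => abs_nonneg _
          refine (mul_le_mul_of_nonneg_left hle (by positivity)).trans (le_of_eq ?_)
          ring
    _ = (∑ r ∈ Finset.range (j + 1), |M.gammaInv (j - r)| * ((j - r : ℕ) : ℝ))
        * (G * L * h * S) := (Finset.sum_mul _ _ _).symm
    _ ≤ (∑' s : ℕ, |M.gammaInv s| * (s : ℝ)) * (G * L * h * S) := by
        gcongr
        exact hsigma.sum_gammaInv_mul_le j
    _ = _ := by rw [C3]; ring

/-- The lower bound 1/c on the diagonal entries converts the filtered identity into a Gronwall
inequality, with (1 + Q)^j bounded by an exponential over the length `w`. -/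
theorem abs_le_of_gamma_system (hnull : M.NullStable) (hsigma : M.SigmaSchur) {L h D w c : ℝ}
    (hL : 0 ≤ L) (hh : 0 ≤ h) (hc : 0 ≤ c) {κ : ℕ → ℕ → ℝ} {e : ℕ → ℝ} {J : ℕ}
    (hκ : ∀ s r j, s ≤ r → r ≤ j → j ≤ J → |κ r s - κ j s| ≤ L * (((j - r : ℕ) : ℝ) * h))
    (hdiag : ∀ j ≤ J, 1 ≤ c * κ j j) (hw : J * h ≤ w)
    (hD : ∀ j ≤ J, |∑ r ∈ Finset.range (j + 1), M.gammaInv (j - r)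
        * ∑ s ∈ Finset.range (r + 1), M.gamma (r - s) * (κ r s * e s)| ≤ D) :
    ∀ j ≤ J, |e j| ≤ c * D * Real.exp (c * M.C3 * L * w) := by
  have hC3 : 0 ≤ M.C3 := C3_nonneg
  have hD0 : 0 ≤ D := (abs_nonneg _).trans (hD 0 (Nat.zero_le _))
  have hrec : ∀ j ≤ J, |e j| ≤ c * D + c * M.C3 * L * h * ∑ s ∈ Finset.range j, |e s| := by
    intro j hj
    have h1 := abs_diag_sub_le hnull hsigma hL hh (κ := κ) (e := e) (j := j)
      fun s r hs hr => hκ s r j hs hr hj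
    have h2 : |κ j j * e j| ≤ D + M.C3 * L * h * ∑ s ∈ Finset.range j, |e s| := by
      have h3 := abs_sub_abs_le_abs_sub (κ j j * e j) (∑ r ∈ Finset.range (j + 1),
        M.gammaInv (j - r) * ∑ s ∈ Finset.range (r + 1), M.gamma (r - s) * (κ r s * e s))
      linarith [hD j hj]
    have h4 := hdiag j hj
    calc |e j| ≤ |c * κ j j| * |e j| := by
          refine le_mul_of_one_le_left (abs_nonneg _) (h4.trans (le_abs_self _))
      _ = c * |κ j j * e j| := by rw [abs_mul, abs_mul, abs_of_nonneg hc, mul_assoc]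
      _ ≤ c * (D + M.C3 * L * h * ∑ s ∈ Finset.range j, |e s|) := by gcongr
      _ = _ := by ring
  intro j hj
  refine (le_mul_pow_of_le_add_sum (by positivity) hrec j hj).trans ?_
  gcongr
  calc (1 + c * M.C3 * L * h) ^ j ≤ (Real.exp (c * M.C3 * L * h)) ^ j := by
        gcongr
        rw [add_comm]
        exact Real.add_one_le_exp _
    _ = Real.exp (c * M.C3 * L * (j * h)) := by
        rw [← Real.exp_nat_mul]; congr 1; ring
    _ ≤ _ := by
        gcongr
        refine le_trans ?_ hw
        gcongr

theorem sum_alpha_range_eq (f : ℕ → ℝ) {t : ℕ} (ht : m ≤ t) :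
    ∑ i ∈ Finset.range (t + 1), M.alpha i * f i
      = ∑ i ∈ Finset.range (m + 1), M.alpha i * f i := by
  symm
  refine Finset.sum_subset (Finset.range_mono (by omega)) fun i _ hi => ?_
  rw [M.alpha_of_lt (by simpa using hi), zero_mul]

/-- Since 1/γ = α · (1/β), a sequence may first be reduced by α, which turns global errors into
local ones, and then convolved with the summable 1/β. -/
theorem abs_sum_gammaInv_mul_le {D : ℝ} {f : ℕ → ℝ} {j : ℕ} (hsigma : M.SigmaSchur)
    (hD : ∀ r ≤ j, |∑ i ∈ Finset.range (r + 1), M.alpha i * f (r - i)| ≤ D) :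
    |∑ r ∈ Finset.range (j + 1), M.gammaInv (j - r) * f r|
      ≤ D * ∑' i, |PowerSeries.coeff i M.betaSeries⁻¹| := by
  rw [sum_gammaInv_mul_eq_coeff, gammaSeries_inv, ← mul_assoc, mul_comm (PowerSeries.mk f)]
  have hF : ∀ r ≤ j, ‖PowerSeries.coeff r (M.alphaSeries * PowerSeries.mk f)‖ ≤ D := by
    intro r hr
    rw [coeff_alphaSeries_mul]
    exact hD r hr
  have hG : Summable fun n => ‖PowerSeries.coeff n M.betaSeries⁻¹‖ := by
    simpa only [Real.norm_eq_abs] using hsigma.summable_betaSeries_inv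
  have key := norm_coeff_mul_le ((norm_nonneg _).trans (hF 0 (Nat.zero_le _))) j hF hG
  simpa only [Real.norm_eq_abs] using key

/-! ### Consistency: filtered quadrature errors -/

section

variable {a b L : ℝ} {Nmin p : ℕ} {k : ℝ → ℝ → ℝ} {u f : ℝ → ℝ}

/-- The quadrature errors along the grid, filtered by `1/γ`, are of the order of the local
errors. -/
theorem exists_bound_filtered_quadErr {q : ℕ} (hab : a < b) (hnull : M.NullStable)
    (hsigma : M.SigmaSchur) (hord : M.HasOrder q) (hp : 1 ≤ p) (hpq : p ≤ q) (hqm : q ≤ m)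
    (hNmin : m ≤ Nmin) (hu : ∃ Lu, MemHoelderLip (p - 1) Lu a b u)
    (hk : ContDiffOn ℝ p (Function.uncurry k) (kernelDomain a b m Nmin))
    (hkx : ∃ Lk, ∀ x ∈ Set.Icc a b,
      MemHoelderLip (p - 1) Lk a x (kernelDerivFst (kernelDomain a b m Nmin) k x)) :
    ∃ C, 0 ≤ C ∧ ∀ N, Nmin ≤ N → ∀ j, j + M.mu ≤ N →
      |∑ r ∈ Finset.range (j + 1), M.gammaInv (j - r) * (if m ≤ r then
        M.quadErr (fun y => k (gridPt a b N (r + M.mu)) y * u y) a (stepSize a b N) (r + M.mu)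
        else 0)| ≤ C * stepSize a b N ^ (p + 1) := by
  have hm := M.one_le
  obtain ⟨B, hB1, hB2⟩ := exists_taylorBdd_kernel_mul hab hm hNmin hp hu hk hkx
  obtain ⟨C, hC0, hC⟩ := exists_quadErr_bound hnull hord hp hpq hqm
  have hB0 : 0 ≤ B := (hB1 a a hab.le fun y hy => by
    rw [Set.Icc_self, Set.mem_singleton_iff] at hy
    rw [hy]
    exact mem_kernelDomain_of_le le_rfl le_rfl hab.le).nonneg hp ⟨a, le_rfl, le_rfl⟩
  set Cα := ∑ i ∈ Finset.range (m + 1), |M.alpha i| with hCα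
  have hCα0 : 0 ≤ Cα := Finset.sum_nonneg fun _ _ => abs_nonneg _
  set Cβ := ∑' i, |PowerSeries.coeff i M.betaSeries⁻¹|
  have hCβ0 : 0 ≤ Cβ := tsum_nonneg fun _ => abs_nonneg _
  -- The summands account for the rows r < 2m, the local errors, and the change of the kernel row,
  -- in this order.
  set D := Cα * (C * (3 * m + 1) * B) + C * B + Cα * (2 * C * B * m * (b - a)) with hDdef
  have hba : 0 ≤ b - a := (sub_pos.2 hab).le
  refine ⟨D * Cβ, by positivity, fun N hN j hj => ?_⟩
  have hN1 : 1 ≤ N := hm.trans (hNmin.trans hN)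
  set h := stepSize a b N with hh
  have hpos : 0 < h := stepSize_pos hab hN1
  have hNh : (N : ℝ) * h = b - a := mul_stepSize hN1
  set x := gridPt a b N with hx
  have hxdef : ∀ n : ℕ, a + n * h = x n := fun n => rfl
  have hT : ∀ n ≤ N, TaylorBdd p B (Set.Icc a (a + n * h)) (fun y => k (x n) y * u y) := by
    intro n hn
    rw [hxdef]
    have := gridPt_mem_Icc (a := a) (b := b) hab hN1 hn
    exact hB1 _ _ this.2 fun y hy => mem_kernelDomain_of_le hy.1 hy.2 this.2
  set τ : ℕ → ℕ → ℝ := fun n t => M.quadErr (fun y => k (x n) y * u y) a h t with hτ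
  have hτb : ∀ n t, m ≤ n → n ≤ N → t ≤ n → |τ n t| ≤ C * (t + 1) * B * h ^ (p + 1) :=
    fun n t hmn hn ht => (hC a h B n _ hpos.le hmn (hT n hn)).2.2 t ht
  -- Passing from row n to row n - i changes x by i h. The quadrature error of ∂_x k carries the
  -- factor n - i + 1, which this h compensates.
  have hτd : ∀ n i, i ≤ m → m + i ≤ n → n ≤ N → |τ n (n - i) - τ (n - i) (n - i)|
      ≤ 2 * C * B * m * (b - a) * h ^ (p + 1) := by
    intro n i hi hin hn
    have hmono := gridPt_mono (a := a) (b := b) (n := n) hab hN1 (Nat.sub_le n i)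
    have htb : x (n - i) ∈ Set.Icc a b := gridPt_mem_Icc hab hN1 (by omega)
    have hnb : x n ∈ Set.Icc a b := gridPt_mem_Icc hab hN1 hn
    have hat : a < x (n - i) := by
      rw [hx, gridPt]
      have h1 : (0 : ℝ) < ((n - i : ℕ) : ℝ) := by exact_mod_cast (by omega : 0 < n - i)
      have := mul_pos h1 hpos
      linarith
    have key := abs_quadErr_sub_le (M := M) (t := n - i) (a := a) (η := h) (B := B)
      (x₁ := x (n - i)) (x₂ := x n) (C := C * ((n - i : ℕ) + 1) * B * h ^ (p + 1))
      (f := fun x y => k x y * u y)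
      (f' := fun x y => kernelDerivFst (kernelDomain a b m Nmin) k x y * u y)
      hp hpos.le (by omega) hmono
      (fun z hz => by
        rw [hxdef]
        exact hB1 _ _ htb.2 fun y hy => mem_kernelDomain_of_le hy.1 (hy.2.trans hz.1)
          (hz.2.trans hnb.2))
      (fun z hz => by
        rw [hxdef]
        exact (hB2 z ⟨hat.trans_le hz.1, hz.2.trans hnb.2⟩).mono le_rfl
          (Set.Icc_subset_Icc_right hz.1))
      (fun y hy z hz => by
        rw [hxdef] at hy
        refine (hasDerivWithinAt_slice_fst (F := Function.uncurry k)
          (hk.differentiableOn (by norm_cast; omega)) (fun z hz => ?_) hz).mul_const (u y)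
        exact mem_kernelDomain_of_le hy.1 (hy.2.trans hz.1) (hz.2.trans hnb.2))
      (fun z hz => by
        refine (hC a h B (n - i) _ hpos.le (by omega) ?_).2.2 (n - i) le_rfl
        rw [hxdef]
        exact (hB2 z ⟨hat.trans_le hz.1, hz.2.trans hnb.2⟩).mono le_rfl
          (Set.Icc_subset_Icc_right hz.1))
    refine key.trans ?_
    have h1 : x n - x (n - i) = i * h := by
      rw [hx, gridPt_sub, Nat.cast_sub (by omega)]; ring
    have h2 : (((n - i : ℕ) : ℝ) + 1) * h ≤ 2 * (b - a) := by
      rw [← hNh, ← mul_assoc]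
      gcongr
      have h3 : (n - i) + 1 ≤ 2 * N := by omega
      exact_mod_cast h3
    rw [h1]
    have him : (i : ℝ) ≤ m := by exact_mod_cast hi
    calc C * (((n - i : ℕ) : ℝ) + 1) * B * h ^ (p + 1) * (i * h)
        = C * B * h ^ (p + 1) * i * ((((n - i : ℕ) : ℝ) + 1) * h) := by ring
      _ ≤ C * B * h ^ (p + 1) * m * (2 * (b - a)) := by gcongr
      _ = _ := by ring
  have hfin := abs_sum_gammaInv_mul_le (M := M) (D := D * h ^ (p + 1))
    (f := fun r => if m ≤ r then τ (r + M.mu) (r + M.mu) else 0) (j := j) hsigma fun r hr => by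
    have hmu := M.mu_le
    -- For r < 2m the cut-off below m may truncate the α-combination, so it need not be a local
    -- error. At most 3m steps are involved there, so each global error is already O(h^{p+1}).
    by_cases hrm : r < 2 * m
    · have h1 : ∀ i ∈ Finset.range (r + 1), |M.alpha i
          * (if m ≤ r - i then τ (r - i + M.mu) (r - i + M.mu) else 0)|
          ≤ |M.alpha i| * (C * (3 * m + 1) * B * h ^ (p + 1)) := by
        intro i _
        rw [abs_mul]
        gcongr
        split_ifs with hi
        · refine (hτb _ _ (by omega) (by omega) le_rfl).trans ?_
          gcongr
          exact_mod_cast (by omega : r - i + M.mu ≤ 3 * m)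
        · rw [abs_zero]; positivity
      refine (Finset.abs_sum_le_sum_abs _ _).trans ((Finset.sum_le_sum h1).trans ?_)
      rw [← Finset.sum_mul]
      have h2 : ∑ i ∈ Finset.range (r + 1), |M.alpha i| ≤ Cα := by
        by_cases hmr : r ≤ m
        · exact Finset.sum_le_sum_of_subset_of_nonneg (Finset.range_mono (by omega))
            fun _ _ _ => abs_nonneg _
        · refine le_of_eq (Finset.sum_subset (Finset.range_mono (by omega)) fun i _ hi => ?_).symm
          rw [M.alpha_of_lt (by simpa using hi), abs_zero]
      calc _ ≤ Cα * (C * (3 * m + 1) * B * h ^ (p + 1)) := by gcongr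
        _ = Cα * (C * (3 * m + 1) * B) * h ^ (p + 1) := by ring
        _ ≤ D * h ^ (p + 1) := by
            gcongr
            rw [hDdef]
            have h3 : 0 ≤ C * B := by positivity
            have h4 : 0 ≤ Cα * (2 * C * B * m * (b - a)) := by positivity
            linarith
    · rw [sum_alpha_range_eq (fun i => if m ≤ r - i then τ (r - i + M.mu) (r - i + M.mu) else 0)
        (by omega : m ≤ r)]
      have hloc := (hC a h B (r + M.mu) _ hpos.le (by omega) (hT (r + M.mu) (by omega))).2.1
        (r + M.mu) (by omega) le_rfl
      rw [sum_alpha_range_eq (fun i => M.quadErr (fun y => k (x (r + M.mu)) y * u y) a h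
        (r + M.mu - i)) (by omega : m ≤ r + M.mu)] at hloc
      -- The row is frozen at r + μ, which gives a local error of one fixed integrand; the remainder
      -- is the row change bounded by `hτd`.
      have h1 : ∑ i ∈ Finset.range (m + 1), M.alpha i
          * (if m ≤ r - i then τ (r - i + M.mu) (r - i + M.mu) else 0)
          = ∑ i ∈ Finset.range (m + 1), M.alpha i * τ (r + M.mu) (r + M.mu - i)
            - ∑ i ∈ Finset.range (m + 1), M.alpha i * (τ (r + M.mu) (r + M.mu - i)
              - τ (r + M.mu - i) (r + M.mu - i)) := by
        rw [← Finset.sum_sub_distrib]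
        refine Finset.sum_congr rfl fun i hi => ?_
        rw [Finset.mem_range] at hi
        have h2 : r - i + M.mu = r + M.mu - i := by omega
        rw [if_pos (by omega), h2]
        ring
      rw [h1]
      have h3 : |∑ i ∈ Finset.range (m + 1), M.alpha i * (τ (r + M.mu) (r + M.mu - i)
              - τ (r + M.mu - i) (r + M.mu - i))|
          ≤ Cα * (2 * C * B * m * (b - a) * h ^ (p + 1)) := by
        rw [hCα, Finset.sum_mul]
        refine (Finset.abs_sum_le_sum_abs _ _).trans (Finset.sum_le_sum fun i hi => ?_)
        rw [Finset.mem_range] at hi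
        rw [abs_mul]
        gcongr
        exact hτd _ _ (by omega) (by omega) (by omega)
      have h4 := (abs_sub (∑ i ∈ Finset.range (m + 1), M.alpha i * τ (r + M.mu) (r + M.mu - i))
        (∑ i ∈ Finset.range (m + 1), M.alpha i * (τ (r + M.mu) (r + M.mu - i)
              - τ (r + M.mu - i) (r + M.mu - i))))
      have h5 : 0 ≤ Cα * (C * (3 * m + 1) * B) * h ^ (p + 1) := by positivity
      refine h4.trans ((add_le_add hloc h3).trans ?_)
      rw [hDdef]
      linarith
  refine hfin.trans (le_of_eq (by ring))

end

end MultistepMethod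

/-! ### The error estimate for noisy data -/

theorem abs_le_kernelMaxNorm {a b : ℝ} {m Nmin p : ℕ} {k : ℝ → ℝ → ℝ}
    (hk : ContDiffOn ℝ p (Function.uncurry k) (kernelDomain a b m Nmin)) {x y : ℝ}
    (hxy : (x, y) ∈ kernelDomain a b m Nmin) :
    |k x y| ≤ kernelMaxNorm (kernelDomain a b m Nmin) k := by
  obtain ⟨B, hB⟩ := isCompact_kernelDomain.exists_bound_of_continuousOn hk.continuousOn
  have hbdd : BddAbove (Set.range fun q : kernelDomain a b m Nmin => |k q.1.1 q.1.2|) := by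
    refine ⟨B, ?_⟩
    rintro _ ⟨q, rfl⟩
    exact hB q.1 q.2
  exact le_ciSup hbdd ⟨(x, y), hxy⟩

theorem kernelMaxNorm_nonneg {E : Set (ℝ × ℝ)} {k : ℝ → ℝ → ℝ} : 0 ≤ kernelMaxNorm E k :=
  Real.iSup_nonneg fun _ => abs_nonneg _

theorem C2a_nonneg {m : ℕ} {L : ℝ} (hL : 0 ≤ L) : 0 ≤ C2a m L :=
  mul_nonneg (by positivity) (matMaxNorm_nonneg _)

theorem C2b_nonneg {m : ℕ} {M : MultistepMethod m} {a b L : ℝ} (hL : 0 ≤ L) :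
    0 ≤ C2b M a b L := by
  have : 0 ≤ ∑' s : ℕ, |M.gammaInv s| := tsum_nonneg fun _ => abs_nonneg _
  rw [C2b]
  positivity

namespace MultistepMethod

variable {m : ℕ} {M : MultistepMethod m} {a b L : ℝ} {Nmin p q : ℕ} {k : ℝ → ℝ → ℝ} {u f : ℝ → ℝ}

theorem quad_sub (t : ℕ) (ψ ψ' : ℕ → ℝ) :
    M.quad t (fun s => ψ s - ψ' s) = M.quad t ψ - M.quad t ψ' := by
  simp only [quad, mul_sub, Finset.sum_sub_distrib]

/-- The error estimate for noisy data. -/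
theorem exists_error_bound (hab : a < b) (hnull : M.NullStable)
    (hsigma : M.SigmaSchur) (hord : M.HasOrder q) (hp : 1 ≤ p) (hpq : p ≤ q) (hqm : q ≤ m)
    (hNmin : m ≤ Nmin) (hu : ∃ Lu, MemHoelderLip (p - 1) Lu a b u)
    (hf : ∀ x ∈ Set.Icc a b, ∫ y in a..x, k x y * u y = f x)
    (hk : ContDiffOn ℝ p (Function.uncurry k) (kernelDomain a b m Nmin))
    (hkx : ∃ Lk, ∀ x ∈ Set.Icc a b,
      MemHoelderLip (p - 1) Lk a x (kernelDerivFst (kernelDomain a b m Nmin) k x))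
    (hdiag : ∀ x ∈ Set.Icc a b, k x x = 1) (hL : 0 ≤ L)
    (hLip : ∀ x₁ x₂ y, (x₁, y) ∈ kernelDomain a b m Nmin → (x₂, y) ∈ kernelDomain a b m Nmin →
      |k x₁ y - k x₂ y| ≤ L * |x₁ - x₂|) :
    ∃ C₁, 0 ≤ C₁ ∧ ∀ N, Nmin ≤ N → stepSize a b N ≤ hBar m k a b Nmin L → ∀ δ, 0 ≤ δ →
      ∀ g v : ℕ → ℝ, (∀ n, 1 ≤ n → n ≤ N → |g n - f (gridPt a b N n)| ≤ δ) →
        IsApproximation M k a b N g v → ∀ n ≤ N - M.mu, |v n - u (gridPt a b N n)|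
          ≤ C₁ * stepSize a b N ^ p + C2 M k a b Nmin L * (δ / stepSize a b N) := by
  have hm := M.one_le
  have hmu := M.mu_le
  obtain ⟨B, hB1, -⟩ := exists_taylorBdd_kernel_mul hab hm hNmin hp hu hk hkx
  obtain ⟨C, hC0, hC⟩ := exists_quadErr_bound hnull hord hp hpq hqm
  obtain ⟨Cτ, hCτ0, hCτ⟩ :=
    exists_bound_filtered_quadErr hab hnull hsigma hord hp hpq hqm hNmin hu hk hkx
  have hB0 : 0 ≤ B := (hB1 a a hab.le fun y hy => by
    rw [Set.Icc_self, Set.mem_singleton_iff] at hy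
    rw [hy]
    exact mem_kernelDomain_of_le le_rfl le_rfl hab.le).nonneg hp ⟨a, le_rfl, le_rfl⟩
  set K := kernelMaxNorm (kernelDomain a b m Nmin) k
  have hK0 : 0 ≤ K := kernelMaxNorm_nonneg
  set W := M.quadWeightBound
  have hW0 : 0 ≤ W := quadWeightBound_nonneg
  set S := ∑' s : ℕ, |M.gammaInv s|
  have hS0 : 0 ≤ S := tsum_nonneg fun _ => abs_nonneg _
  have hA0 : 0 ≤ C2a m L := C2a_nonneg hL
  have hb0 : 0 ≤ C2b M a b L := C2b_nonneg hL
  set X := Real.exp ((1 + M.mu * L) * M.C3 * L * (b - a)) with hX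
  have hX0 : 0 < X := Real.exp_pos _
  have hC2b : C2b M a b L = (1 + M.mu * L) * S * X := rfl
  refine ⟨C2a m L * (C * B) + C2b M a b L * (W * K * (C2a m L * (C * B)))
    + (1 + M.mu * L) * Cτ * X, by positivity, ?_⟩
  intro N hN hh δ hδ g v hg hv
  have hN1 : 1 ≤ N := hm.trans (hNmin.trans hN)
  obtain ⟨⟨θ, hθ, hκθ⟩, hκd⟩ := kernel_near_one hab hm hNmin hN hh hdiag hL hLip
  have hCτN := hCτ N hN
  rw [isApproximation_iff] at hv
  set h := stepSize a b N with hhdef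
  have hpos : 0 < h := stepSize_pos hab hN1
  have hNh : (N : ℝ) * h = b - a := mul_stepSize hN1
  set x := gridPt a b N with hx
  have hxdef : ∀ n : ℕ, a + n * h = x n := fun n => rfl
  have hxmem : ∀ n ≤ N, x n ∈ Set.Icc a b := fun n hn => gridPt_mem_Icc hab hN1 hn
  have htri : ∀ s n, s ≤ n → n ≤ N → (x n, x s) ∈ kernelDomain a b m Nmin := fun s n hs hn =>
    mem_kernelDomain_of_le (hxmem s (hs.trans hn)).1 (gridPt_mono hab hN1 hs) (hxmem n hn).2
  set e : ℕ → ℝ := fun s => v s - u (x s) with he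
  have hstart : ∀ s < m, |e s| ≤ C2a m L * (C * B) * h ^ p + C2a m L * (δ / h) := by
    intro s hs
    -- The starting rules use nodes to the right of x_n as well; this is why E contains a square at
    -- the corner.
    have hT0 : ∀ n ≤ m, TaylorBdd p B (Set.Icc a (a + m * h)) (fun y => k (x n) y * u y) := by
      intro n hn
      rw [hxdef]
      have hxm := gridPt_mem_square hab hm hNmin hN (le_refl m)
      refine hB1 _ _ (hxmem m (by omega)).2 fun y hy => ?_
      exact Or.inr ⟨gridPt_mem_square hab hm hNmin hN hn, hy.1, hy.2.trans hxm.2⟩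
    have h1 := abs_le_of_start_system (m := m) (D := δ + C * B * h ^ (p + 1)) hL hpos
      (κ := fun n s => k (x n) (x s)) hκθ hθ (e := e)
      (d := fun n => h * ∑ s ∈ Finset.range m, startWeight m n s * k (x n) (x s) * e s)
      (fun n hn hnm => by
        have h2 := (hC a h B m _ hpos.le le_rfl (hT0 n hnm)).1 n hnm
        rw [hxdef, hf (x n) (hxmem n (by omega))] at h2
        have h3 : h * ∑ s ∈ Finset.range m, startWeight m n s * k (x n) (x s) * e s
            = (g n - f (x n)) + (f (x n) - h * ∑ s ∈ Finset.range m,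
              startWeight m n s * (k (x n) (a + s * h) * u (a + s * h))) := by
          rw [← hv.1 n hn hnm, sub_add_sub_cancel, ← mul_sub, ← Finset.sum_sub_distrib]
          congr 1
          refine Finset.sum_congr rfl fun s _ => ?_
          rw [hxdef, he]
          ring
        rw [h3]
        exact (abs_add_le _ _).trans (add_le_add (hg n hn (by omega)) h2))
      (fun n _ _ => rfl) hs
    refine h1.trans (le_of_eq ?_)
    field_simp
    ring
  have hEs : 0 ≤ C2a m L * (C * B) * h ^ p + C2a m L * (δ / h) := by positivity
  set Es := C2a m L * (C * B) * h ^ p + C2a m L * (δ / h) with hEsdef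
  -- The starting errors are bounded separately and moved to the right-hand side; with zeros in
  -- their place the left-hand side is a convolution.
  set e' : ℕ → ℝ := fun s => if m ≤ s then e s else 0 with he'
  -- The error equation, divided by h. The quadrature errors are kept apart, since they must be
  -- filtered before being estimated, unlike the noise and the starting errors.
  have hsys : ∀ r, r + M.mu ≤ N → ∑ s ∈ Finset.range (r + 1),
      M.gamma (r - s) * (k (x (r + M.mu)) (x s) * e' s)
      = (if m ≤ r then (g (r + M.mu) - f (x (r + M.mu))) / h
          - ∑ s ∈ Finset.range m, M.quadWeight s (r + M.mu) * (k (x (r + M.mu)) (x s) * e s) else 0)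
        + h⁻¹ * (if m ≤ r then M.quadErr (fun y => k (x (r + M.mu)) y * u y) a h (r + M.mu)
          else 0) := by
    intro r hr
    split_ifs with hmr
    · have h1 := M.quad_split (fun s => k (x (r + M.mu)) (x s) * e s)
        (show m + M.mu ≤ r + M.mu by omega)
      rw [Nat.add_sub_cancel] at h1
      have h2 : ∑ s ∈ Finset.range (r + 1), M.gamma (r - s) * (k (x (r + M.mu)) (x s) * e' s)
          = M.quad (r + M.mu) (fun s => k (x (r + M.mu)) (x s) * e s)
            - ∑ s ∈ Finset.range m, M.quadWeight s (r + M.mu)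
              * (k (x (r + M.mu)) (x s) * e s) := by
        rw [h1, add_sub_cancel_left]
        refine Finset.sum_congr rfl fun s _ => ?_
        rw [he']
        beta_reduce
        split_ifs <;> simp
      have h3 : M.quad (r + M.mu) (fun s => k (x (r + M.mu)) (x s) * e s)
          = M.quad (r + M.mu) (fun s => k (x (r + M.mu)) (x s) * v s)
            - M.quad (r + M.mu) (fun s => k (x (r + M.mu)) (x s) * u (x s)) := by
        rw [← quad_sub]
        congr 1
        funext s
        rw [he]
        ring
      have h4 := hv.2 (r + M.mu) (by omega) hr
      have h5 : M.quad (r + M.mu) (fun s => k (x (r + M.mu)) (x s) * v s)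
          = g (r + M.mu) / h := by
        rw [← h4, mul_div_cancel_left₀ _ hpos.ne']
      have h6 : M.quadErr (fun y => k (x (r + M.mu)) y * u y) a h (r + M.mu)
          = f (x (r + M.mu))
            - h * M.quad (r + M.mu) (fun s => k (x (r + M.mu)) (x s) * u (x s)) := by
        rw [quadErr, hxdef, hf _ (hxmem _ hr)]
        rfl
      rw [h2, h3, h5, h6]
      field_simp
      ring
    · rw [mul_zero, add_zero]
      refine Finset.sum_eq_zero fun s hs => ?_
      rw [Finset.mem_range] at hs
      rw [he']
      beta_reduce
      rw [if_neg (by omega), mul_zero, mul_zero]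
  have hnoise : ∀ r, r + M.mu ≤ N → |if m ≤ r then (g (r + M.mu) - f (x (r + M.mu))) / h
      - ∑ s ∈ Finset.range m, M.quadWeight s (r + M.mu) * (k (x (r + M.mu)) (x s) * e s) else 0|
      ≤ δ / h + W * K * Es := by
    intro r hr
    split_ifs with hmr
    · refine (abs_sub _ _).trans (add_le_add ?_ ?_)
      · rw [abs_div, abs_of_pos hpos]
        gcongr
        exact hg _ (by omega) hr
      · calc _ ≤ ∑ s ∈ Finset.range m, |M.quadWeight s (r + M.mu)| * (K * Es) := by
              refine (Finset.abs_sum_le_sum_abs _ _).trans (Finset.sum_le_sum fun s hs => ?_)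
              rw [Finset.mem_range] at hs
              rw [abs_mul, abs_mul]
              gcongr
              · exact abs_le_kernelMaxNorm hk (htri s _ (by omega) hr)
              · exact hstart s hs
          _ = (∑ s ∈ Finset.range m, |M.quadWeight s (r + M.mu)|) * (K * Es) :=
              (Finset.sum_mul _ _ _).symm
          _ ≤ W * (K * Es) := by
              gcongr
              exact hnull.sum_quadWeight_le (by omega)
          _ = _ := by ring
    · rw [abs_zero]; positivity
  -- The noise part is estimated by ∑ |γ_s^{(-1)}|. The filtered quadrature errors are O(h^{p+1}),
  -- so h^p remains after the division by h.
  have hD : ∀ j ≤ N - M.mu, |∑ r ∈ Finset.range (j + 1), M.gammaInv (j - r)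
      * ∑ s ∈ Finset.range (r + 1), M.gamma (r - s) * (k (x (r + M.mu)) (x s) * e' s)|
      ≤ S * (δ / h + W * K * Es) + Cτ * h ^ p := by
    intro j hj
    rw [Finset.sum_congr rfl fun r hr => by
      rw [hsys r (by simp at hr; omega), mul_add, mul_left_comm], Finset.sum_add_distrib,
      ← Finset.mul_sum]
    refine (abs_add_le _ _).trans (add_le_add ?_ ?_)
    · calc _ ≤ ∑ r ∈ Finset.range (j + 1), |M.gammaInv (j - r)| * (δ / h + W * K * Es) := by
            refine (Finset.abs_sum_le_sum_abs _ _).trans (Finset.sum_le_sum fun r hr => ?_)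
            rw [abs_mul]
            gcongr
            exact hnoise r (by simp at hr; omega)
        _ = (∑ r ∈ Finset.range (j + 1), |M.gammaInv (j - r)|) * (δ / h + W * K * Es) :=
            (Finset.sum_mul _ _ _).symm
        _ ≤ _ := by
            gcongr
            exact hsigma.sum_gammaInv_le j
    · rw [abs_mul, abs_of_pos (inv_pos.2 hpos)]
      calc _ ≤ h⁻¹ * (Cτ * h ^ (p + 1)) := by
            gcongr
            exact hCτN j (by omega)
        _ = _ := by field_simp; ring
  -- Rows are shifted by μ, so the diagonal entry is k(x_{j+μ}, x_j) rather than k(x_j, x_j) = 1. It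
  -- is at least 1/(1 + μL), whence c = 1 + μL.
  have hmain := abs_le_of_gamma_system (M := M) (κ := fun r s => k (x (r + M.mu)) (x s)) (e := e')
    (J := N - M.mu) (c := 1 + M.mu * L) (w := b - a) hnull hsigma hL hpos.le (by positivity)
    (fun s r j hs hr hj => by
      refine (hLip _ _ _ (htri s _ (by omega) (by omega))
        (htri s _ (by omega) (by omega))).trans ?_
      gcongr
      rw [hx, gridPt_sub, abs_mul, abs_of_pos hpos]
      gcongr
      rw [Nat.cast_sub hr, abs_sub_comm]
      push_cast
      have : (r : ℝ) ≤ j := by exact_mod_cast hr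
      rw [add_sub_add_right_eq_sub, abs_of_nonneg (sub_nonneg.2 this)])
    (fun j hj => hκd j M.mu hmu (by omega))
    (by
      rw [← hNh]
      gcongr
      exact Nat.sub_le _ _) hD
  intro n hn
  have hr1 : 0 ≤ δ / h := by positivity
  have hr2 : 0 ≤ h ^ p := by positivity
  by_cases hnm : n < m
  · refine (hstart n hnm).trans ?_
    rw [hEsdef]
    refine add_le_add ?_ (mul_le_mul_of_nonneg_right (le_max_left _ _) hr1)
    refine mul_le_mul_of_nonneg_right ?_ hr2
    have h1 : 0 ≤ C2b M a b L * (W * K * (C2a m L * (C * B))) := by positivity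
    have h2 : 0 ≤ (1 + M.mu * L) * Cτ * X := by positivity
    linarith
  · have h1 := hmain n hn
    simp only [he', if_pos (not_lt.1 hnm)] at h1
    refine h1.trans ?_
    have h2 : C2b M a b L * (1 + C2a m L * K * W) * (δ / h) ≤ C2 M k a b Nmin L * (δ / h) :=
      mul_le_mul_of_nonneg_right (le_max_right _ _) hr1
    have h3 : 0 ≤ C2a m L * (C * B) * h ^ p := by positivity
    rw [hC2b] at h2 ⊢
    rw [hEsdef]
    linarith

end MultistepMethod

/-! ### The balancing principle -/

section gridNum

variable {a b : ℝ} {κ sbar Nlow : ℕ}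

theorem stepSize_mul {N c : ℕ} (hc : 1 ≤ c) : (c : ℝ) * stepSize a b (N * c) = stepSize a b N := by
  have : (c : ℝ) ≠ 0 := by positivity
  rw [stepSize, stepSize]
  push_cast
  rcases eq_or_ne (N : ℝ) 0 with h | h
  · simp [h]
  · field_simp

theorem gridPt_mul {N c n : ℕ} (hc : 1 ≤ c) : gridPt a b (N * c) (n * c) = gridPt a b N n := by
  rw [gridPt, gridPt, ← stepSize_mul (a := a) (b := b) (N := N) hc]
  push_cast
  ring

theorem gridNum_eq_mul {t t' : ℕ} (h : t ≤ t') (h' : t' ≤ sbar) :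
    gridNum κ sbar Nlow t = gridNum κ sbar Nlow t' * 2 ^ (κ * (t' - t)) := by
  rw [gridNum, gridNum, mul_assoc, ← pow_add, ← mul_add]
  congr 3
  omega

theorem one_le_gridNum {s : ℕ} (h : 1 ≤ Nlow) : 1 ≤ gridNum κ sbar Nlow s :=
  Nat.mul_pos h (by positivity)

theorem stepSize_gridNum_eq {t t' : ℕ} (h : t ≤ t') (h' : t' ≤ sbar) :
    stepSize a b (gridNum κ sbar Nlow t')
      = 2 ^ (κ * (t' - t)) * stepSize a b (gridNum κ sbar Nlow t) := by
  rw [gridNum_eq_mul h h', ← stepSize_mul (a := a) (b := b) (N := gridNum κ sbar Nlow t')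
    (Nat.one_le_two_pow (n := κ * (t' - t)))]
  push_cast
  rfl

theorem stepSize_gridNum_mono {t t' : ℕ} (hab : a < b) (hN : 1 ≤ Nlow) (h : t ≤ t')
    (h' : t' ≤ sbar) :
    stepSize a b (gridNum κ sbar Nlow t) ≤ stepSize a b (gridNum κ sbar Nlow t') := by
  rw [stepSize_gridNum_eq h h']
  exact le_mul_of_one_le_left (stepSize_pos hab (one_le_gridNum hN)).le
    (one_le_pow₀ one_le_two)

/-- The balancing principle for approximations with the error bound `C₁ h ^ p + C₂ δ / h`,
where `δ = d ^ (p + 1)`. -/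
theorem balancing_principle {mu p : ℕ} {β δ d C₁ C₂ ε Cu Cl : ℝ} {U : ℝ → ℝ} {v : ℕ → ℕ → ℝ}
    (hab : a < b) (hN : 1 ≤ Nlow) (hd : 0 < d) (hδ : δ = d ^ (p + 1)) (hC₁ : 0 ≤ C₁) (hC₂ : 0 ≤ C₂)
    (hβ : 0 ≤ β) (hε : 2 * C₁ * ε ^ (p + 1) ≤ β - 2 * C₂) (hεu : ε ≤ Cu)
    (hCl : 0 < Cl) (hlε : 2 ^ κ * Cl ≤ ε)
    (h0 : stepSize a b (gridNum κ sbar Nlow 0) ≤ Cu * d)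
    (hsbar : Cl * d ≤ stepSize a b (gridNum κ sbar Nlow sbar))
    (herr : ∀ s ≤ sbar, ∀ n ≤ gridNum κ sbar Nlow s - mu,
      |v (gridNum κ sbar Nlow s) n - U (gridPt a b (gridNum κ sbar Nlow s) n)|
        ≤ C₁ * stepSize a b (gridNum κ sbar Nlow s) ^ p
          + C₂ * (δ / stepSize a b (gridNum κ sbar Nlow s)))
    {s : ℕ} (hs : IsGreatest (balancingSet mu a b κ sbar Nlow β δ v) s) :
    (∀ n ≤ gridNum κ sbar Nlow s - mu,
      |v (gridNum κ sbar Nlow s) n - U (gridPt a b (gridNum κ sbar Nlow s) n)|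
        ≤ (C₁ * Cu ^ p + (C₂ + β) / Cl) * d ^ p) ∧
      Cl * d ≤ stepSize a b (gridNum κ sbar Nlow s) := by
  set N := gridNum κ sbar Nlow with hNdef
  set h : ℕ → ℝ := fun s => stepSize a b (N s) with hh
  have hpos : ∀ s, 0 < h s := fun s => stepSize_pos hab (one_le_gridNum hN)
  have hmono : ∀ t t', t ≤ t' → t' ≤ sbar → h t ≤ h t' := fun t t' h1 h2 =>
    stepSize_gridNum_mono hab hN h1 h2
  have hδ0 : 0 ≤ δ := by rw [hδ]; positivity
  have hε0 : 0 ≤ ε := le_trans (by positivity) hlε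
  -- Two approximations differ by at most the sum of their errors. When h' ≤ ε d, the choice of ε
  -- bounds both terms C₁ h^p together by (β - 2C₂) δ/h.
  have hsmall : ∀ t ≤ sbar, h t ≤ ε * d → t ∈ balancingSet mu a b κ sbar Nlow β δ v := by
    intro t ht hte
    refine ⟨ht, fun r r' hrr' hr't n' hn' n hn hpt => ?_⟩
    have e1 := herr r' (by omega) n' hn'
    have e2 := herr r (by omega) n hn
    rw [hpt] at e1
    have hrle : h r ≤ h r' := hmono r r' hrr'.le (by omega)
    have h1 : C₁ * h r ^ p ≤ C₁ * h r' ^ p := by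
      have := (hpos r).le
      gcongr
    have h2 : C₂ * (δ / h r') ≤ C₂ * (δ / h r) := by
      have := hpos r
      gcongr
    have h3 : 2 * C₁ * h r' ^ p ≤ (β - 2 * C₂) * (δ / h r) := by
      rw [← mul_div_assoc, le_div_iff₀ (hpos r)]
      calc 2 * C₁ * h r' ^ p * h r ≤ 2 * C₁ * h r' ^ p * h r' := by
            have := hpos r'
            gcongr
        _ = 2 * C₁ * h r' ^ (p + 1) := by ring
        _ ≤ 2 * C₁ * (ε * d) ^ (p + 1) := by
            have := (hpos r').le
            gcongr
            exact (hmono r' t hr't ht).trans hte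
        _ = 2 * C₁ * ε ^ (p + 1) * d ^ (p + 1) := by ring
        _ ≤ (β - 2 * C₂) * δ := by
            rw [hδ]
            gcongr
    have h4 := abs_sub_le (v (N r') n') (U (gridPt a b (N r) n)) (v (N r) n)
    rw [abs_sub_comm (U _)] at h4
    change |v (N r') n' - v (N r) n| ≤ β * (δ / h r)
    linarith
  -- If the next step size exceeds ε d, then this one exceeds 2^(-κ) ε d, because consecutive step
  -- sizes have ratio 2^κ.
  have hlow : ∀ t, t ≤ sbar → (t < sbar → ε * d < h (t + 1)) → Cl * d ≤ h t := by
    intro t ht htl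
    rcases ht.eq_or_lt with rfl | hlt
    · exact hsbar
    · have h1 := htl hlt
      have h2 : h (t + 1) = 2 ^ (κ * (t + 1 - t)) * h t :=
        stepSize_gridNum_eq (Nat.le_succ t) hlt
      rw [Nat.add_sub_cancel_left, mul_one] at h2
      rw [h2] at h1
      have h3 : 2 ^ κ * (Cl * d) < 2 ^ κ * h t := by
        refine lt_of_le_of_lt ?_ h1
        rw [← mul_assoc]
        gcongr
      exact (lt_of_mul_lt_mul_left h3 (by positivity)).le
  have hs1 : s ≤ sbar := hs.1.1
  -- By maximality index s + 1 fails the test, so its step size exceeds ε d.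
  have hlows : Cl * d ≤ h s := by
    refine hlow s hs1 fun hlt => ?_
    by_contra hle
    exact absurd (hs.2 (hsmall (s + 1) hlt (not_lt.1 hle))) (by omega)
  refine ⟨fun n hn => ?_, hlows⟩
  classical
  -- The comparison index: the largest t ≤ s with h_t ≤ ε d, or the default 0 if there is none. In
  -- the latter case the assumption on h_0 supplies the upper bound, so in both cases h_t is of
  -- order d.
  set t := Nat.findGreatest (fun t => h t ≤ ε * d) s with htdef
  have hts : t ≤ s := Nat.findGreatest_le s
  have htu : h t ≤ Cu * d := by
    rcases Nat.eq_zero_or_pos t with h1 | h1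
    · rw [h1]; exact h0
    · exact (Nat.findGreatest_of_ne_zero htdef.symm h1.ne').trans (by gcongr)
  have htl : Cl * d ≤ h t := by
    rcases hts.eq_or_lt with h1 | h1
    · rw [h1]; exact hlows
    · exact hlow t (by omega) fun _ =>
        not_le.1 (Nat.findGreatest_is_greatest (P := fun t => h t ≤ ε * d)
          (Nat.lt_succ_self t) (by omega))
  have hδh : δ / h t ≤ d ^ p / Cl := by
    rw [div_le_div_iff₀ (hpos t) hCl, hδ]
    calc d ^ (p + 1) * Cl = d ^ p * (Cl * d) := by ring
      _ ≤ _ := by gcongr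
  have hc : 1 ≤ 2 ^ (κ * (s - t)) := Nat.one_le_two_pow
  have hNt : N t = N s * 2 ^ (κ * (s - t)) := gridNum_eq_mul hts hs1
  -- Refinement multiplies the cut-off μ as well, so a usable node of the coarse grid remains usable
  -- on the finer one.
  have hn' : n * 2 ^ (κ * (s - t)) ≤ N t - mu := by
    rw [hNt]
    calc n * 2 ^ (κ * (s - t)) ≤ (N s - mu) * 2 ^ (κ * (s - t)) := by gcongr
      _ = N s * 2 ^ (κ * (s - t)) - mu * 2 ^ (κ * (s - t)) := Nat.sub_mul _ _ _
      _ ≤ _ := Nat.sub_le_sub_left (Nat.le_mul_of_pos_right _ hc) _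
  have hpt : gridPt a b (N s) n = gridPt a b (N t) (n * 2 ^ (κ * (s - t))) := by
    rw [hNt, gridPt_mul hc]
  have e1 := herr t (hts.trans hs1) _ hn'
  have e2 : |v (N s) n - v (N t) (n * 2 ^ (κ * (s - t)))| ≤ β * (δ / h t) := by
    rcases hts.eq_or_lt with h1 | h1
    · have h2 : n * 2 ^ (κ * (s - t)) = n := by rw [h1]; simp
      rw [h2, h1, sub_self, abs_zero]
      have := hpos s
      positivity
    · exact hs.1.2 t s h1 le_rfl n hn _ hn' hpt
  rw [← hpt] at e1
  have e3 := abs_sub_le (v (N s) n) (v (N t) (n * 2 ^ (κ * (s - t)))) (U (gridPt a b (N s) n))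
  have e4 : C₁ * h t ^ p ≤ C₁ * (Cu ^ p * d ^ p) := by
    rw [← mul_pow]
    have := (hpos t).le
    gcongr
  have e5 : (C₂ + β) * (δ / h t) ≤ (C₂ + β) * (d ^ p / Cl) := by gcongr
  have e6 : (C₁ * Cu ^ p + (C₂ + β) / Cl) * d ^ p
      = C₁ * (Cu ^ p * d ^ p) + (C₂ + β) * (d ^ p / Cl) := by ring
  rw [e6]
  change _ ≤ C₁ * h t ^ p + C₂ * (δ / h t) at e1
  linarith

end gridNum

/-! ### The main theorem -/

theorem mainTheorem3
    {m : ℕ} (M : MultistepMethod m) (p₀ p Nmin κ : ℕ) (a b : ℝ)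
    (k : ℝ → ℝ → ℝ) (u f : ℝ → ℝ) (L β c₁ c₂ δ₀ : ℝ)
    (hab : a < b)
    -- the multistep method
    (hnull : M.NullStable) (hord : M.HasMaximalOrder p₀) (hp₀ : 1 ≤ p₀) (hp₀m : p₀ ≤ m)
    (hsigma : M.SigmaSchur)
    -- the integral equation and its solution
    (hp : 1 ≤ p) (hpp₀ : p ≤ p₀)
    (hu : ∃ Lu, MemHoelderLip (p - 1) Lu a b u)
    (hf : ∀ x ∈ Set.Icc a b, ∫ y in a..x, k x y * u y = f x)
    -- the kernel
    (hNmin : m ≤ Nmin)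
    (hk : ContDiffOn ℝ p (Function.uncurry k) (kernelDomain a b m Nmin))
    (hkx : ∃ Lk, ∀ x ∈ Set.Icc a b,
      MemHoelderLip (p - 1) Lk a x (kernelDerivFst (kernelDomain a b m Nmin) k x))
    (hdiag : ∀ x ∈ Set.Icc a b, k x x = 1)
    (hL : 0 ≤ L)
    (hLip : ∀ x₁ x₂ y, (x₁, y) ∈ kernelDomain a b m Nmin → (x₂, y) ∈ kernelDomain a b m Nmin →
      |k x₁ y - k x₂ y| ≤ L * |x₁ - x₂|)
    -- the parameters of the balancing principle
    (hβ : 2 * C2 M k a b Nmin L < β) (hκ : 1 ≤ κ)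
    (hc₁ : 0 < c₁) (hc₂ : 0 < c₂) (hδ₀ : 0 < δ₀) :
    -- the scheme is well defined for all admissible step sizes
    (∀ N, Nmin ≤ N → stepSize a b N ≤ hBar m k a b Nmin L → ∀ g : ℕ → ℝ,
      (∃ v, IsApproximation M k a b N g v) ∧
      ∀ v w, IsApproximation M k a b N g v → IsApproximation M k a b N g w →
        ∀ n ≤ N - M.mu, v n = w n) ∧
    -- the error estimate and the lower bound for the chosen step size
    ∃ K > 0, ∃ C > 0, ∀ δ, 0 < δ → δ ≤ δ₀ → ∀ sbar Nlow : ℕ, 1 ≤ Nlow →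
      stepSize a b (gridNum κ sbar Nlow 0) ≤ c₁ * δ ^ (1 / 2 : ℝ) →
      c₂ * δ ^ (1 / ((p₀ : ℝ) + 1)) ≤ stepSize a b (gridNum κ sbar Nlow sbar) →
      stepSize a b (gridNum κ sbar Nlow sbar) ≤ hBar m k a b Nmin L →
      ∀ fδ v : ℕ → ℕ → ℝ,
        (∀ s ≤ sbar, ∀ n, 1 ≤ n → n ≤ gridNum κ sbar Nlow s →
          |fδ (gridNum κ sbar Nlow s) n - f (gridPt a b (gridNum κ sbar Nlow s) n)| ≤ δ) →
        (∀ s ≤ sbar, IsApproximation M k a b (gridNum κ sbar Nlow s)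
          (fδ (gridNum κ sbar Nlow s)) (v (gridNum κ sbar Nlow s))) →
        ∀ s, IsGreatest (balancingSet M.mu a b κ sbar Nlow β δ v) s →
          (∀ n ≤ gridNum κ sbar Nlow s - M.mu,
            |v (gridNum κ sbar Nlow s) n - u (gridPt a b (gridNum κ sbar Nlow s) n)|
              ≤ K * δ ^ ((p : ℝ) / ((p : ℝ) + 1))) ∧
          C * δ ^ (1 / ((p : ℝ) + 1)) ≤ stepSize a b (gridNum κ sbar Nlow s) := by
  have hm := M.one_le
  have hNmin1 : 1 ≤ Nmin := hm.trans hNmin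
  refine ⟨fun N hN hh g => ?_, ?_⟩
  · obtain ⟨⟨θ, hθ, hκθ⟩, hκd⟩ := kernel_near_one hab hm hNmin hN hh hdiag hL hLip
    refine MultistepMethod.exists_unique_approximation hL (stepSize_pos hab (hNmin1.trans hN))
      hκθ hθ (fun j hj h0 => ?_) g
    have h1 := hκd j M.mu M.mu_le hj
    rw [h0, mul_zero] at h1
    exact absurd h1 (by norm_num)
  obtain ⟨C₁, hC₁, herr⟩ := MultistepMethod.exists_error_bound hab hnull hsigma hord.1 hp hpp₀
    hp₀m hNmin hu hf hk hkx hdiag hL hLip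
  set C₂ := C2 M k a b Nmin L
  have hC₂ : 0 ≤ C₂ := (C2a_nonneg hL).trans (le_max_left _ _)
  have hβ0 : 0 < β := by linarith
  have hp1 : (0 : ℝ) < (p : ℝ) + 1 := by positivity
  have hp1' : ((p + 1 : ℕ) : ℝ) = (p : ℝ) + 1 := by push_cast; rfl
  -- Chosen so that 2 C₁ ε^(p+1) ≤ β - 2 C₂; writing C₁ + 1 avoids division by zero.
  set ε := ((β - 2 * C₂) / (2 * (C₁ + 1))) ^ (1 / ((p : ℝ) + 1)) with hε
  have hε1 : 0 < (β - 2 * C₂) / (2 * (C₁ + 1)) := div_pos (by linarith) (by positivity)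
  have hε0 : 0 < ε := Real.rpow_pos_of_pos hε1 _
  have hεpow : ε ^ (p + 1) = (β - 2 * C₂) / (2 * (C₁ + 1)) := by
    rw [hε, ← Real.rpow_natCast, ← Real.rpow_mul hε1.le, hp1', one_div_mul_cancel hp1.ne',
      Real.rpow_one]
  have hεle : 2 * C₁ * ε ^ (p + 1) ≤ β - 2 * C₂ := by
    rw [hεpow, ← mul_div_assoc, div_le_iff₀ (by positivity)]
    nlinarith
  -- These express the step size conditions in units of d = δ^(1/(p+1)): as 1/2 ≥ 1/(p+1) ≥
  -- 1/(p₀+1), the surplus powers of δ are bounded by those of δ₀ in the required directions.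
  set Cu := max ε (c₁ * δ₀ ^ (1 / 2 - 1 / ((p : ℝ) + 1))) with hCu
  set Cl := min (c₂ * δ₀ ^ (1 / ((p₀ : ℝ) + 1) - 1 / ((p : ℝ) + 1))) (ε / 2 ^ κ) with hCl
  have hCl0 : 0 < Cl :=
    lt_min (mul_pos hc₂ (Real.rpow_pos_of_pos hδ₀ _)) (by positivity)
  have hCu0 : 0 < Cu := lt_of_lt_of_le hε0 (le_max_left _ _)
  refine ⟨C₁ * Cu ^ p + (C₂ + β) / Cl, by positivity, Cl, hCl0, ?_⟩
  intro δ hδ hδle sbar Nlow hN h0 hsb hsb' fδ v hfδ hv s hs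
  have hpδ : δ ^ ((p : ℝ) / ((p : ℝ) + 1)) = (δ ^ (1 / ((p : ℝ) + 1))) ^ p := by
    rw [← Real.rpow_natCast, ← Real.rpow_mul hδ.le]
    congr 1
    ring
  rw [hpδ]
  refine balancing_principle (ε := ε) hab hN (Real.rpow_pos_of_pos hδ _) ?_ hC₁ hC₂ hβ0.le hεle
    (le_max_left _ _) hCl0 ?_ (h0.trans ?_) (le_trans ?_ hsb) (fun t ht n hn => ?_) hs
  · rw [← Real.rpow_natCast, ← Real.rpow_mul hδ.le, hp1', one_div_mul_cancel hp1.ne',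
      Real.rpow_one]
  · rw [mul_comm, ← le_div_iff₀ (by positivity)]
    exact min_le_right _ _
  · have h1 : δ ^ (1 / 2 : ℝ) = δ ^ (1 / 2 - 1 / ((p : ℝ) + 1)) * δ ^ (1 / ((p : ℝ) + 1)) := by
      rw [← Real.rpow_add hδ, sub_add_cancel]
    have h2 : (0 : ℝ) ≤ 1 / 2 - 1 / ((p : ℝ) + 1) := by
      have : (1 : ℝ) ≤ p := by exact_mod_cast hp
      rw [sub_nonneg]
      exact one_div_le_one_div_of_le two_pos (by linarith)
    rw [h1, ← mul_assoc]
    refine mul_le_mul_of_nonneg_right ?_ (Real.rpow_nonneg hδ.le _)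
    refine le_trans ?_ (le_max_right _ _)
    gcongr
  · have h1 : δ ^ (1 / ((p₀ : ℝ) + 1))
        = δ ^ (1 / ((p₀ : ℝ) + 1) - 1 / ((p : ℝ) + 1)) * δ ^ (1 / ((p : ℝ) + 1)) := by
      rw [← Real.rpow_add hδ, sub_add_cancel]
    have h2 : 1 / ((p₀ : ℝ) + 1) - 1 / ((p : ℝ) + 1) ≤ 0 := by
      have : (p : ℝ) ≤ p₀ := by exact_mod_cast hpp₀
      rw [sub_nonpos]
      exact one_div_le_one_div_of_le hp1 (by linarith)
    rw [h1, ← mul_assoc]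
    refine mul_le_mul_of_nonneg_right ?_ (Real.rpow_nonneg hδ.le _)
    refine (min_le_left _ _).trans ?_
    gcongr c₂ * ?_
    exact Real.rpow_le_rpow_of_nonpos hδ hδle h2
  · have hN1 : 1 ≤ gridNum κ sbar Nlow t := one_le_gridNum hN
    have hle := (stepSize_gridNum_mono (κ := κ) hab hN ht le_rfl).trans hsb'
    -- The step size bound never exceeds h_max, so an admissible step size forces N ≥ N_min.
    have hNt : Nmin ≤ gridNum κ sbar Nlow t := by
      have h1 := hle.trans hBar_le
      rw [stepSize, stepSize, div_le_div_iff_of_pos_left (sub_pos.2 hab)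
        (by exact_mod_cast hN1) (by exact_mod_cast hNmin1)] at h1
      exact_mod_cast h1
    exact herr _ hNt hle δ hδ.le _ _ (hfδ t ht) (hv t ht) n hn
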